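/- Notation. For a partition $\lambda=(\lambda_1\ge\lambda_2\ge\cdots)=(1^{m_1}2^{m_2}\cdots)$ write $|\lambda|$ for its size and $b(\lambda)=\sum_{i\ge1}(i-1)\lambda_i$. If $a_1,\dots,a_s$ are parts of $\lambda$ (with multiplicity), let $\lambda\binom{a_1,\dots,a_s}{b_1,\dots,b_s}$ be the partition obtained by replacing the parts $a_1,\dots,a_s$ by $b_1,\dots,b_s$, rearranging and dropping zeros; $\lambda\cup\mu$ is the partition whose multiset of parts is the union of those of $\lambda$ and $\mu$. For $\mu\subset\lambda$, $\mu\ne\lambda$, let $\operatorname{ht}(\lambda/\mu)$ be the height of the skew diagram $\lambda/\mu$, that is, $\max\{r:\lambda_r>\mu_r\}-\min\{r:\lambda_r>\mu_r\}$. Let $P_\lambda(x;t)$ be the Hall–Littlewood $P$-functions, let $X^\lambda_\rho(t)\in\mathbb{Q}[t]$ be defined by $p_\rho=\sum_\lambda X^\lambda_\rho(t)P_\lambda(x;t)$, where $p_\rho$ is the power sum symmetric function, and let $Q^\lambda_\rho(t)=t^{b(\lambda)}X^\lambda_\rho(t^{-1})$ be the Green polynomials. Theorem. Let $\lambda=(1^{m_1}2^{m_2}\cdots)$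 be the Jordan type of a nilpotent element of $\mathfrak{so}_{2r+1}(\mathbb{C})$, $\mathfrak{sp}_{2r}(\mathbb{C})$ or $\mathfrak{so}_{2r}(\mathbb{C})$ for some $r$, let $k\ge1$, and let $\rho$ be a partition with $|\rho|=|\lambda|-2k$. Then $$\begin{aligned} Q^\lambda_{\rho\cup(2k)}(-1)={}&\sum_{i\ge k,\ m_i\ge2}2\left\lfloor\tfrac{m_i}{2}\right\rfloor Q^{\lambda\binom{i,i}{i-k,\,i-k}}_{\rho}(-1)\\ &+\sum_{i\ge2k,\ m_i\text{ odd}}(-1)^{\operatorname{ht}\left(\lambda/\lambda\binom{i}{i-2k}\right)}\,Q^{\lambda\binom{i}{i-2k}}_{\rho}(-1)\\ &+\sum_{\substack{0<i-j<2k\le i+j\\ m_i,\,m_j\text{ odd}}}(-1)^{\operatorname{ht}\left(\lambda/\lambda\binom{i}{j}\right)}\,2\,Q^{\lambda\binom{i,\;j}{\frac{i+j}{2}-k,\,\frac{i+j}{2}-k}}_{\rho}(-1), \end{aligned}$$ where $i$ and $j$ run over the distinct parts of $\lambda$ (in the last sum $i+j$ is automatically even). -/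

import Mathlib

open Polynomial

noncomputable section

namespace GreenHL

/-! ### Partitions -/

/-- A partition (of an arbitrary size): a finite multiset of positive integers, its parts. -/
abbrev Ptn : Type := {s : Multiset ℕ // ∀ a ∈ s, 0 < a}

namespace Ptn

/-- The partition whose parts are the nonzero members of `s`. -/
def ofMultiset (s : Multiset ℕ) : Ptn :=
  ⟨s.filter (fun a => 0 < a), fun _ ha => (Multiset.mem_filter.1 ha).2⟩

/-- The size `|lam|`. -/
def size (lam : Ptn) : ℕ := lam.1.sum

/-- The number `l(lam)` of parts. -/
def length (lam : Ptn) : ℕ := lam.1.card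

/-- The multiplicity `m_i` of `i` as a part of `lam`. -/
def mult (lam : Ptn) (i : ℕ) : ℕ := lam.1.count i

/-- The parts in weakly decreasing order, padded by zeros, rows being numbered from `0`:
`lam.row r` is the part usually written with the index `r + 1`. -/
def row (lam : Ptn) (r : ℕ) : ℕ := (lam.1.sort (fun a b => a ≥ b)).getD r 0

/-- The union of two partitions: the union of the multisets of parts. -/
def cup (lam mu : Ptn) : Ptn := ofMultiset (lam.1 + mu.1)

/-- The parts listed in `s` are replaced by the members of `t`; zeros are dropped. -/
def replace (lam : Ptn) (s t : Multiset ℕ) : Ptn := ofMultiset (lam.1 - s + t)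

/-- The weighted size `b(lam)`, the sum of `(r - 1) * lam_r` over `r ≥ 1`. -/
def b (lam : Ptn) : ℕ := ∑ r ∈ Finset.range lam.length, r * lam.row r

/-- The (indices of the) rows which the skew diagram `lam / mu` meets. -/
def skewRows (lam mu : Ptn) : Finset ℕ :=
  (Finset.range lam.length).filter (fun r => mu.row r < lam.row r)

/-- The height of `lam / mu`: the index of its lowest row minus the index of its highest row. -/
def height (lam mu : Ptn) : ℕ :=
  (skewRows lam mu).sup id - sInf (skewRows lam mu : Set ℕ)

end Ptn

/-! ### Hall-Littlewood functions and Green polynomials -/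

/-- The field of rational functions in `x_0, …, x_{n-1}` and `t`, as the field of fractions of
`ℚ[t][x_0, …, x_{n-1}]`. -/
abbrev RatFun (n : ℕ) : Type := FractionRing (MvPolynomial (Fin n) ℚ[X])

/-- The parameter `t`. -/
def tVar (n : ℕ) : RatFun n :=
  algebraMap (MvPolynomial (Fin n) ℚ[X]) (RatFun n) (MvPolynomial.C Polynomial.X)

/-- The variable `x_i`. -/
def xVar {n : ℕ} (i : Fin n) : RatFun n :=
  algebraMap (MvPolynomial (Fin n) ℚ[X]) (RatFun n) (MvPolynomial.X i)

/-- `v_m(t)`, the product over `i = 1, …, m` of `(1 - t ^ i) / (1 - t) = 1 + t + ⋯ + t ^ (i - 1)`. -/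
def vFactor (n m : ℕ) : RatFun n :=
  ∏ i ∈ Finset.range m, ∑ e ∈ Finset.range (i + 1), tVar n ^ e

/-- `v_lam(t)`, the product of `v_{m_i}(t)` over `i ≥ 0`, where `lam` is regarded as a sequence of
`n` nonnegative integers, so that `m_0 = n - l(lam)`. -/
def vLam (n : ℕ) (lam : Ptn) : RatFun n :=
  vFactor n (n - lam.length) * ∏ i ∈ lam.1.toFinset, vFactor n (lam.mult i)

/-- The Hall-Littlewood polynomial `P_lam(x_0, …, x_{n-1}; t)`, which is `0` if `l(lam) > n`. -/
def hlPoly (n : ℕ) (lam : Ptn) : RatFun n :=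
  if lam.length ≤ n then
    (vLam n lam)⁻¹ * ∑ w : Equiv.Perm (Fin n),
      (∏ i : Fin n, xVar (w i) ^ lam.row i) *
        ∏ i : Fin n, ∏ j ∈ Finset.univ.filter (fun j : Fin n => i < j),
          (xVar (w i) - tVar n * xVar (w j)) / (xVar (w i) - xVar (w j))
  else 0

/-- A symmetric function in infinitely many variables over `ℚ[t]` is determined by the sequence of
its specializations to `n` variables, `n = 0, 1, 2, …`; it is represented by this sequence. -/
abbrev SymSeq : Type := (n : ℕ) → RatFun n

/-- The Hall-Littlewood function `P_lam(x; t)`. -/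
def hlP (lam : Ptn) : SymSeq := fun n => hlPoly n lam

/-- The power sum function `p_rho`. -/
def powerSum (rho : Ptn) : SymSeq :=
  fun n => (rho.1.map (fun r => ∑ i : Fin n, xVar i ^ r)).prod

/-- The finitely supported family `(X^lam_rho(t))_lam` of coordinates of `p_rho` with respect to the
`ℚ[t]`-basis of the functions `P_lam(x; t)`, that is, `p_rho = ∑_lam X^lam_rho(t) P_lam(x; t)`. -/
def transition (rho : Ptn) : Ptn →₀ ℚ[X] :=
  Function.invFun (fun c : Ptn →₀ ℚ[X] => (Finsupp.linearCombination ℚ[X] hlP c : SymSeq))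
    (powerSum rho)

/-- The Green polynomial `t ^ b(lam) * X^lam_rho(t⁻¹)`, as a Laurent polynomial over `ℚ`. -/
def green (lam rho : Ptn) : LaurentPolynomial ℚ :=
  LaurentPolynomial.T (lam.b : ℤ) *
    LaurentPolynomial.invert (Polynomial.toLaurent (transition rho lam))

/-- The value of the Green polynomial at `t = -1`. -/
def greenNegOne (lam rho : Ptn) : ℚ :=
  LaurentPolynomial.eval₂ (RingHom.id ℚ) (-1 : ℚˣ) (green lam rho)

/-! ### Jordan types -/

/-- The nilpotent matrix `N` has Jordan type `lam`: there is a basis of the space of column vectors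
which consists of Jordan chains whose lengths are the parts of `lam`. -/
def HasJordanType {ι : Type} [Fintype ι] [DecidableEq ι] (N : Matrix ι ι ℂ) (lam : Ptn) : Prop :=
  IsNilpotent N ∧
    ∃ e : Module.Basis (Σ r : Fin lam.length, Fin (lam.row r)) ℂ (ι → ℂ),
      (∀ (r : Fin lam.length) (h : 0 < lam.row r), N.mulVec (e ⟨r, ⟨0, h⟩⟩) = 0) ∧
      ∀ (r : Fin lam.length) (c : ℕ) (h : c + 1 < lam.row r),
        N.mulVec (e ⟨r, ⟨c + 1, h⟩⟩) = e ⟨r, ⟨c, Nat.lt_of_succ_lt h⟩⟩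

/-- `lam` is the Jordan type of a nilpotent element of `𝔰𝔬_{2r+1}(ℂ)` (type `B`). -/
def IsJordanTypeB (lam : Ptn) : Prop :=
  ∃ r : ℕ, ∃ N ∈ LieAlgebra.Orthogonal.so (Fin (2 * r + 1)) ℂ, HasJordanType N lam

/-- `lam` is the Jordan type of a nilpotent element of `𝔰𝔭_{2r}(ℂ)` (type `C`). -/
def IsJordanTypeC (lam : Ptn) : Prop :=
  ∃ r : ℕ, ∃ N ∈ LieAlgebra.Symplectic.sp (Fin r) ℂ, HasJordanType N lam

/-- `lam` is the Jordan type of a nilpotent element of `𝔰𝔬_{2r}(ℂ)` (type `D`). -/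
def IsJordanTypeD (lam : Ptn) : Prop :=
  ∃ r : ℕ, ∃ N ∈ LieAlgebra.Orthogonal.so (Fin (2 * r)) ℂ, HasJordanType N lam

end GreenHL

end

/-!
The recursion comes from one description of the transition coefficients: `X^lam_rho(t)` is the
coefficient of `x ^ lam` in `p_rho(x) * ∏_{i < j} (x_i - x_j) / (x_i - t x_j)`, where every factor is
expanded in powers of `x_j / x_i`, in any number `n ≥ l(lam)` of variables (`transition_apply`). This
coefficient makes sense for an arbitrary integer sequence in the place of `lam`, and since `p_{2k}` is
`∑ x_i ^ (2k)`, enlarging `rho` by `2k` amounts to summing over the ways of lowering one entry of the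
sequence by `2k` (`hlPolyCoeff_cons`, `listValue_cons`).

**The coefficient formula.** In the ring of power series in `t` over the Laurent polynomials the
`1 - t x_j / x_i` are invertible. Multiplied by the Vandermonde product, the Hall-Littlewood polynomial
of `lam` becomes, up to its normalization, the alternating sum `alternant lam` of the images of
`x ^ lam * ∏_{i < j} (x_i - t x_j)` under the permutations of the variables. Dividing an alternating
element by `∏_{i < j} (x_i - t x_j)` and taking the coefficient of `x ^ μ` defines a functional
`altCoeff μ`. It is also the pairing with `alternant μ` for the symmetric form
`⟨F, G⟩ = [x ^ 0] F(x) G(x⁻¹) ∏_{i ≠ j} (1 - t x_i / x_j)⁻¹` (`pairing_alternant`), so the matrix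
`altCoeff μ (alternant ν)` is symmetric. It is triangular as well, hence diagonal
(`eq_of_altCoeff_alternant_ne_zero`), and its diagonal entries are the generating functions of the
inversions over the stabilizers of the `μ`, that is, the normalizing factors of the Hall-Littlewood
polynomials (`sum_stabilizer_pow_invCount`). An alternating polynomial which all the `altCoeff μ` kill
is zero (`IsAlternating.eq_zero`). Together this expands power sums in Hall-Littlewood functions and
proves that the latter are linearly independent.

**Exchanging entries at `t = -1`.** For neighbouring positions the coefficients `g a b` of sequences
with entries `a`, `b` there have the form `y (a + 1) b - t * y a (b + 1)` with `y` antisymmetric. At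
`t = -1` this forces `g a b + g b a = 0` if `a - b` is odd and
`g (c + m) (c - m) + g (c - m) (c + m) = 2 (-1) ^ m * g c c` (`exchange_odd`, `exchange_even`). With the
sign `(-1) ^ b(lam)` of the Green polynomial the signs become uniform: `exchangeRule_listValue`.

**Straightening.** By the exchange relations a pair of equal entries may be moved freely. So `lam` is
written as pairs of equal parts followed by the parts of odd multiplicity in decreasing order. Lowering
one member of a pair `i, i` by `2k`, in either way, gives twice the pair `i - k, i - k`. A part of odd
multiplicity which is lowered to `i - 2k` moves to the right; when it passes a larger part `j` it leaves
the pair `(i + j) / 2 - k` behind or changes the sign (`insert_entry`). This yields the three sums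
(`sortedValue_of_lowerSum`), the sign being that of the height of the skew diagram
(`Ptn.height_replace`). The parts of odd multiplicity must have the same parity for this, which holds
for Jordan types in the orthogonal and symplectic Lie algebras because the ranks of the odd powers
(respectively even powers) of such a nilpotent matrix are ranks of skew-symmetric matrices
(`odd_mult_parity`).
-/

noncomputable section

namespace GreenHL

/-! ### Parts of odd multiplicity of a Jordan type -/

/-- A skew-symmetric matrix induces a nondegenerate alternating form on a complement of its kernel,
whose Gram matrix `M` satisfies `det M = (-1) ^ rank * det M`. -/
theorem even_rank_of_transpose_eq_neg {ι : Type} [Fintype ι] [DecidableEq ι] (A : Matrix ι ι ℂ)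
    (hA : A.transpose = -A) : Even A.rank := by
  obtain ⟨C, hC⟩ := Submodule.exists_isCompl (LinearMap.ker A.mulVecLin)
  have hr : A.rank = Module.finrank ℂ C := by
    have h1 := LinearMap.finrank_range_add_finrank_ker A.mulVecLin
    have h2 := Submodule.finrank_add_eq_of_isCompl hC
    unfold Matrix.rank
    omega
  rw [hr]
  let b := Module.finBasis ℂ C
  let M : Matrix (Fin (Module.finrank ℂ C)) (Fin (Module.finrank ℂ C)) ℂ :=
    fun i j => (b i : ι → ℂ) ⬝ᵥ A.mulVec (b j : ι → ℂ)
  have hskew : ∀ v w : ι → ℂ, v ⬝ᵥ A.mulVec w = -(w ⬝ᵥ A.mulVec v) := by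
    intro v w
    have h : A.mulVec v = -(Matrix.vecMul v A) := by
      rw [← Matrix.vecMul_transpose, hA, Matrix.vecMul_neg]
    rw [Matrix.dotProduct_mulVec, h, dotProduct_neg, neg_neg, dotProduct_comm]
  have hMT : M.transpose = -M := by
    ext i j
    exact hskew _ _
  have hdet : M.det ≠ 0 := by
    intro h0
    obtain ⟨v, hv, hMv⟩ := Matrix.exists_mulVec_eq_zero_iff.2 h0
    apply hv
    set u : C := ∑ j, v j • b j with hu
    have hb : ∀ i, (b i : ι → ℂ) ⬝ᵥ A.mulVec (u : ι → ℂ) = 0 := by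
      intro i
      have := congrFun hMv i
      simp only [Matrix.mulVec, dotProduct, M, Pi.zero_apply] at this
      rw [← Matrix.mulVecLin_apply, hu]
      simp only [Submodule.coe_sum, Submodule.coe_smul, map_sum, map_smul, dotProduct_sum,
        dotProduct_smul, Matrix.mulVecLin_apply]
      simpa [dotProduct, Matrix.mulVec, mul_comm] using this
    have hCu : ∀ w : C, (w : ι → ℂ) ⬝ᵥ A.mulVec (u : ι → ℂ) = 0 := by
      intro w
      rw [← b.sum_repr w]
      simp only [Submodule.coe_sum, Submodule.coe_smul, sum_dotProduct, smul_dotProduct, hb,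
        smul_zero, Finset.sum_const_zero]
    have hAu : A.mulVec (u : ι → ℂ) = 0 := by
      rw [← dotProduct_eq_zero_iff]
      intro w
      have hw : w ∈ LinearMap.ker A.mulVecLin ⊔ C := by rw [hC.sup_eq_top]; trivial
      obtain ⟨y, hy, z, hz, rfl⟩ := Submodule.mem_sup.1 hw
      rw [dotProduct_comm, add_dotProduct, hCu ⟨z, hz⟩, hskew]
      rw [LinearMap.mem_ker, Matrix.mulVecLin_apply] at hy
      simp [hy]
    have hu0 : u = 0 := by
      have : (u : ι → ℂ) ∈ LinearMap.ker A.mulVecLin ⊓ C := ⟨hAu, u.2⟩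
      rw [hC.inf_eq_bot] at this
      exact Subtype.ext (by simpa using this)
    funext j
    exact (Fintype.linearIndependent_iff.1 b.linearIndependent v hu0) j
  have h := congrArg Matrix.det hMT
  rw [Matrix.det_transpose, Matrix.det_neg, Fintype.card_fin] at h
  by_contra hodd
  rw [Nat.not_even_iff_odd] at hodd
  rw [hodd.neg_one_pow] at h
  apply hdet
  linear_combination h / 2

theorem Ptn.map_row_range (lam : Ptn) (f : ℕ → ℕ) :
    ∑ r ∈ Finset.range lam.length, f (lam.row r) = (lam.1.map f).sum := by
  have hl : (lam.1.sort (fun a b => a ≥ b)).length = lam.length :=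
    Multiset.length_sort _
  conv_rhs => rw [← Multiset.sort_eq lam.1 (fun a b => a ≥ b)]
  rw [Multiset.map_coe, Multiset.sum_coe, ← hl, Finset.sum_range, ← Fin.sum_univ_getElem]
  simp only [Ptn.row]
  rw [← Fin.sum_congr' _ (List.length_map f).symm]
  refine Finset.sum_congr rfl fun i _ => ?_
  rw [List.getD_eq_getElem _ _ i.2]
  simp

/-- A Jordan chain of length `a` contributes `a - i`, truncated at `0`, to the rank of `N ^ i`. -/
theorem HasJordanType.rank_pow {ι : Type} [Fintype ι] [DecidableEq ι] {N : Matrix ι ι ℂ} {lam : Ptn}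
    (h : HasJordanType N lam) (i : ℕ) : (N ^ i).rank = (lam.1.map (fun a => a - i)).sum := by
  obtain ⟨-, e, h0, h1⟩ := h
  have key : ∀ (i : ℕ) (r : Fin lam.length) (c : ℕ) (hc : c < lam.row r),
      (N ^ i).mulVec (e ⟨r, ⟨c, hc⟩⟩) =
        if h : i ≤ c then e ⟨r, ⟨c - i, by omega⟩⟩ else 0 := by
    intro i
    induction i with
    | zero => intro r c hc; simp
    | succ i ih =>
      intro r c hc
      rw [pow_succ, ← Matrix.mulVec_mulVec]
      rcases c with _ | c
      · rw [h0 r hc, Matrix.mulVec_zero]; simp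
      · rw [h1 r c hc, ih]
        by_cases hic : i ≤ c
        · rw [dif_pos hic, dif_pos (by omega)]
          congr 3
          omega
        · rw [dif_neg hic, dif_neg (by omega)]
  let T : Set (Σ r : Fin lam.length, Fin (lam.row r)) := {p | p.2.1 + i < lam.row p.1}
  have hspan : LinearMap.range (N ^ i).mulVecLin = Submodule.span ℂ (Set.range fun p : T => e p.1) := by
    rw [LinearMap.range_eq_map, ← e.span_eq, Submodule.map_span]
    apply le_antisymm
    · rw [Submodule.span_le]
      rintro _ ⟨_, ⟨⟨r, c, hc⟩, rfl⟩, rfl⟩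
      rw [Matrix.mulVecLin_apply, key]
      split_ifs with h
      · exact Submodule.subset_span ⟨⟨⟨r, ⟨c - i, by omega⟩⟩, by simp only [T, Set.mem_ofPred_eq]; omega⟩, rfl⟩
      · exact Submodule.zero_mem _
    · rw [Submodule.span_le]
      rintro _ ⟨⟨⟨r, c, hc⟩, hT⟩, rfl⟩
      simp only [T, Set.mem_ofPred_eq] at hT
      apply Submodule.subset_span
      refine ⟨e ⟨r, ⟨c + i, hT⟩⟩, ⟨_, rfl⟩, ?_⟩
      rw [Matrix.mulVecLin_apply, key, dif_pos (by omega)]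
      simp
  unfold Matrix.rank
  rw [hspan]
  classical
  rw [finrank_span_eq_card (b := fun p : T => e p.1)
    (e.linearIndependent.comp _ Subtype.val_injective), ← Ptn.map_row_range,
    Finset.sum_range]
  have : Fintype.card T = Fintype.card (Σ r : Fin lam.length, Fin (lam.row r - i)) := by
    refine Fintype.card_congr ⟨fun p => ⟨p.1.1, ⟨p.1.2.1, ?_⟩⟩, fun p => ⟨⟨p.1, ⟨p.2.1, ?_⟩⟩, ?_⟩, ?_, ?_⟩
    · have := p.2
      simp only [T, Set.mem_ofPred_eq] at this
      omega
    · have := p.2.2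
      omega
    · have := p.2.2
      simp only [T, Set.mem_ofPred_eq]
      omega
    · intro p; rfl
    · intro p; rfl
  rw [this]
  simp

/-- The multiplicity of `i` in a Jordan type is a second difference of the ranks of powers. -/
theorem HasJordanType.mult_add {ι : Type} [Fintype ι] [DecidableEq ι] {N : Matrix ι ι ℂ} {lam : Ptn}
    (h : HasJordanType N lam) (i : ℕ) :
    lam.mult (i + 1) + 2 * (N ^ (i + 1)).rank = (N ^ i).rank + (N ^ (i + 2)).rank := by
  simp only [h.rank_pow, Ptn.mult]
  generalize lam.1 = s
  induction s using Multiset.induction_on with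
  | empty => simp
  | cons a s ih =>
    simp only [Multiset.map_cons, Multiset.sum_cons, Multiset.count_cons]
    split_ifs <;> omega

theorem transpose_pow_mul_of_skewAdjoint {ι : Type} [Fintype ι] [DecidableEq ι] {J N : Matrix ι ι ℂ}
    (h : N.transpose * J = J * -N) (i : ℕ) :
    (N ^ i).transpose * J = (-1 : ℂ) ^ i • (J * N ^ i) := by
  induction i with
  | zero => simp
  | succ i ih =>
    rw [pow_succ, Matrix.transpose_mul, mul_assoc, ih, Matrix.mul_smul, ← mul_assoc, h]
    rw [pow_succ (-1 : ℂ), mul_smul, mul_assoc]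
    simp [← pow_succ, ← pow_succ']

/-- If `N` is skew-adjoint for a nondegenerate form `J` which is symmetric (`e = 0`) or alternating
(`e = 1`), then `J * N ^ i` is skew-symmetric whenever `i + e` is odd, so that the parts
`i ≡ e (mod 2)` have even multiplicity. -/
theorem HasJordanType.even_mult {ι : Type} [Fintype ι] [DecidableEq ι] {J N : Matrix ι ι ℂ}
    {lam : Ptn} (h : HasJordanType N lam) (e : ℕ) (hJ : J.transpose = (-1 : ℂ) ^ e • J)
    (hdet : IsUnit J.det) (hN : N.transpose * J = J * -N) (i : ℕ) (hi : Even (i + 1 + e)) :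
    Even (lam.mult (i + 1)) := by
  have key : ∀ j, Odd (j + e) → Even (N ^ j).rank := by
    intro j hj
    rw [← Matrix.rank_mul_eq_right_of_isUnit_det J (N ^ j) hdet]
    apply even_rank_of_transpose_eq_neg
    rw [Matrix.transpose_mul, hJ, Matrix.mul_smul, transpose_pow_mul_of_skewAdjoint hN, smul_smul,
      ← pow_add, add_comm e j, hj.neg_one_pow, neg_one_smul]
  have h1 := key i (by rw [Nat.odd_iff, Nat.even_iff] at *; omega)
  have h2 := key (i + 2) (by rw [Nat.odd_iff, Nat.even_iff] at *; omega)
  have h3 := h.mult_add i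
  rw [Nat.even_iff] at *
  omega

theorem HasJordanType.odd_of_so {ι : Type} [Fintype ι] [DecidableEq ι] {N : Matrix ι ι ℂ}
    {lam : Ptn} (hN : N ∈ LieAlgebra.Orthogonal.so ι ℂ) (h : HasJordanType N lam) (i : ℕ)
    (hi : Odd (lam.mult i)) : Odd i := by
  rcases i with _ | i
  · have : lam.mult 0 = 0 := Multiset.count_eq_zero.2 fun h0 => absurd (lam.2 0 h0) (by omega)
    simp [this] at hi
  · by_contra hcon
    rw [LieAlgebra.Orthogonal.mem_so] at hN
    have := h.even_mult (J := 1) 0 (by simp) (by simp) (by simp [hN]) i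
      (by rw [Nat.not_odd_iff_even] at hcon; simpa using hcon)
    exact (Nat.not_even_iff_odd.2 hi) this

theorem HasJordanType.even_of_sp {r : ℕ} {N : Matrix (Fin r ⊕ Fin r) (Fin r ⊕ Fin r) ℂ}
    {lam : Ptn} (hN : N ∈ LieAlgebra.Symplectic.sp (Fin r) ℂ) (h : HasJordanType N lam) (i : ℕ)
    (hi : Odd (lam.mult i)) : Even i := by
  rcases i with _ | i
  · simp
  · by_contra hcon
    rw [LieAlgebra.Symplectic.sp, mem_skewAdjointMatricesLieSubalgebra,
      mem_skewAdjointMatricesSubmodule] at hN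
    have := h.even_mult (J := Matrix.J (Fin r) ℂ) 1 (by simp) (Matrix.isUnit_det_J _ _) hN i
      (by rw [Nat.not_even_iff_odd] at hcon; exact hcon.add_odd (by decide))
    exact (Nat.not_even_iff_odd.2 hi) this

/-- The parts of odd multiplicity are odd in the orthogonal and even in the symplectic case. -/
theorem odd_mult_parity {lam : Ptn}
    (hlam : IsJordanTypeB lam ∨ IsJordanTypeC lam ∨ IsJordanTypeD lam) :
    ∃ e : ℕ, ∀ i, Odd (lam.mult i) → i % 2 = e := by
  rcases hlam with ⟨r, N, hN, h⟩ | ⟨r, N, hN, h⟩ | ⟨r, N, hN, h⟩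
  · exact ⟨1, fun i hi => Nat.odd_iff.1 (h.odd_of_so hN i hi)⟩
  · exact ⟨0, fun i hi => Nat.even_iff.1 (h.even_of_sp hN i hi)⟩
  · exact ⟨1, fun i hi => Nat.odd_iff.1 (h.odd_of_so hN i hi)⟩

/-! ### Straightening at `t = -1` -/

/-- The exchange relations satisfied by the (signed) values at `t = -1` of the Green functions, which
are regarded as functions of arbitrary integer sequences. A zero at the end may be dropped, and a
negative entry at the end makes the value zero. -/
structure ExchangeRule (Γ : List ℤ → ℚ) : Prop where
  even : ∀ l r c m, Γ (l ++ (c + m) :: (c - m) :: r) + Γ (l ++ (c - m) :: (c + m) :: r) =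
    2 * Γ (l ++ c :: c :: r)
  odd : ∀ l r a b, Odd (a - b) → Γ (l ++ a :: b :: r) = Γ (l ++ b :: a :: r)
  zero : ∀ l, Γ (l ++ [0]) = Γ l
  neg : ∀ l a, a < 0 → Γ (l ++ [a]) = 0

/-- The sequence in which each member of `C` is written twice. -/
def pairs (C : List ℕ) : List ℤ := C.flatMap fun c => [(c : ℤ), (c : ℤ)]

/-- The value of `Γ` at the weakly decreasing arrangement of `s`. -/
def sortedValue (Γ : List ℤ → ℚ) (s : Multiset ℕ) : ℚ :=
  Γ ((s.sort (fun a b => a ≥ b)).map Nat.cast)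

@[simp] theorem pairs_nil : pairs [] = [] := rfl

@[simp] theorem pairs_cons (c : ℕ) (C : List ℕ) :
    pairs (c :: C) = (c : ℤ) :: (c : ℤ) :: pairs C := rfl

theorem pairs_append (C D : List ℕ) : pairs (C ++ D) = pairs C ++ pairs D := by
  simp [pairs, List.flatMap_append]

theorem sort_eq_of_pairwise {l : List ℕ} {s : Multiset ℕ} (h : (l : Multiset ℕ) = s)
    (hl : l.Pairwise (fun a b => a ≥ b)) : s.sort (fun a b => a ≥ b) = l := by
  apply List.Perm.eq_of_pairwise' (r := fun a b => a ≥ b) (Multiset.pairwise_sort _ _) hl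
  rw [← Multiset.coe_eq_coe, Multiset.sort_eq, h]

theorem add_coe_sub_singleton (s : Multiset ℕ) (l r : List ℕ) (j : ℕ) :
    s + ((l ++ j :: r : List ℕ) : Multiset ℕ) - {j} = s + ((l ++ r : List ℕ) : Multiset ℕ) := by
  have : s + ((l ++ j :: r : List ℕ) : Multiset ℕ) = j ::ₘ (s + ((l ++ r : List ℕ) : Multiset ℕ)) := by
    simp only [← Multiset.coe_add, ← Multiset.cons_coe, ← Multiset.singleton_add]
    abel
  rw [this, Multiset.sub_singleton, Multiset.erase_cons_head]

theorem exists_split_insert (c : ℕ) (S : List ℕ) (hS : S.Pairwise (fun a b => a ≥ b)) :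
    ∃ S₁ S₂, S = S₁ ++ S₂ ∧ (S₁ ++ c :: c :: S₂).Pairwise (fun a b => a ≥ b) := by
  induction S with
  | nil => exact ⟨[], [], rfl, by simp⟩
  | cons a S ih =>
    rw [List.pairwise_cons] at hS
    by_cases h : a ≤ c
    · refine ⟨[], a :: S, rfl, ?_⟩
      simp only [List.nil_append, List.pairwise_cons, List.mem_cons]
      grind
    · obtain ⟨S₁, S₂, rfl, h2⟩ := ih hS.2
      refine ⟨a :: S₁, S₂, rfl, ?_⟩
      simp only [List.cons_append, List.pairwise_cons]
      refine ⟨?_, h2⟩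
      intro b hb
      have := hS.1 b
      simp only [List.mem_append, List.mem_cons] at hb this
      grind

namespace ExchangeRule

variable {Γ : List ℤ → ℚ}

/-- A pair of equal entries `c` may be exchanged with a neighbouring entry `d`. If `d - c = 2 m`, both
sides are reduced to the sequences with entries `c, c + m, c + m` and `c + m, c + m, c`. -/
theorem pair_comm (h : ExchangeRule Γ) (l r : List ℤ) (c d : ℤ) :
    Γ (l ++ c :: c :: d :: r) = Γ (l ++ d :: c :: c :: r) := by
  induction hn : (d - c).natAbs using Nat.strong_induction_on generalizing c d with
  | _ n ih =>
    rcases Int.even_or_odd (d - c) with ⟨m, hm⟩ | hodd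
    · by_cases hm0 : m = 0
      · obtain rfl : d = c := by omega
        rfl
      · obtain rfl : d = c + m + m := by omega
        have h1 := h.even (l ++ [c]) r (c + m) m
        have h2 := h.even l (c :: r) (c + m) m
        have h3 := ih m.natAbs (by omega) (c + m) c (by omega)
        simp only [List.append_assoc, List.cons_append, List.nil_append, add_sub_cancel_right] at *
        linarith
    · have h1 := h.odd (l ++ [c]) r c d (by rw [← neg_sub]; exact hodd.neg)
      have h2 := h.odd l (c :: r) c d (by rw [← neg_sub]; exact hodd.neg)
      simp only [List.append_assoc, List.cons_append, List.nil_append] at *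
      rw [h1, h2]

theorem pair_move (h : ExchangeRule Γ) (c : ℤ) (s : List ℤ) : ∀ (l r : List ℤ),
    Γ (l ++ c :: c :: (s ++ r)) = Γ (l ++ (s ++ c :: c :: r)) := by
  induction s with
  | nil => intro l r; rfl
  | cons d s ih =>
    intro l r
    have h1 := h.pair_comm l (s ++ r) c d
    have h2 := ih (l ++ [d]) r
    simp only [List.append_assoc, List.cons_append, List.nil_append] at *
    rw [h1, h2]

/-- A pair of negative entries may be moved to the end. -/
theorem neg_pair (h : ExchangeRule Γ) {c : ℤ} (hc : c < 0) (l r : List ℤ) :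
    Γ (l ++ c :: c :: r) = 0 := by
  have h1 := h.pair_move c r l []
  have h2 := h.neg (l ++ (r ++ [c])) c hc
  simp only [List.append_assoc, List.cons_append, List.nil_append, List.append_nil] at *
  rw [h1, h2]

theorem pairs_append_sorted (h : ExchangeRule Γ) (C μ : List ℕ)
    (hμ : μ.Pairwise (fun a b => a ≥ b)) : ∀ p : List ℤ,
    Γ (p ++ (pairs C ++ μ.map Nat.cast)) =
      Γ (p ++ (((C + C + μ : Multiset ℕ).sort (fun a b => a ≥ b)).map Nat.cast)) := by
  induction C with
  | nil =>
    intro p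
    rw [sort_eq_of_pairwise (l := μ) (by simp) hμ]
    simp
  | cons c C ih =>
    intro p
    obtain ⟨S₁, S₂, hS, hS'⟩ := exists_split_insert c
      ((C + C + μ : Multiset ℕ).sort (fun a b => a ≥ b)) (Multiset.pairwise_sort _ _)
    have hms : ((S₁ ++ c :: c :: S₂ : List ℕ) : Multiset ℕ) =
        ((c :: C : List ℕ) : Multiset ℕ) + ((c :: C : List ℕ) : Multiset ℕ) + (μ : Multiset ℕ) := by
      have h1 : ((S₁ ++ S₂ : List ℕ) : Multiset ℕ) = (C + C + μ : Multiset ℕ) := by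
        rw [← hS, Multiset.sort_eq]
      simp only [← Multiset.coe_add, ← Multiset.cons_coe] at *
      simp only [Multiset.cons_add, Multiset.add_cons, h1]
    rw [sort_eq_of_pairwise hms hS']
    have h1 := ih (p ++ [(c : ℤ), (c : ℤ)])
    rw [hS] at h1
    have h2 := h.pair_move c (S₁.map Nat.cast) p (S₂.map Nat.cast)
    simp only [List.append_assoc, List.cons_append, List.nil_append, pairs_cons, List.map_append,
      List.map_cons] at *
    rw [h1, h2]

/-- By moving the pairs, the pairs followed by a weakly decreasing sequence may be sorted. -/
theorem eq_sortedValue (h : ExchangeRule Γ) (C μ : List ℕ)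
    (hμ : μ.Pairwise (fun a b => a ≥ b)) {s : Multiset ℕ} (hs : (C + C + μ : Multiset ℕ) = s) :
    Γ (pairs C ++ μ.map Nat.cast) = sortedValue Γ s := by
  have := h.pairs_append_sorted C μ hμ []
  rw [sortedValue, ← hs]
  simpa using this

theorem append_replicate_zero (h : ExchangeRule Γ) (l : List ℤ) (z : ℕ) :
    Γ (l ++ List.replicate z 0) = Γ l := by
  induction z with
  | zero => simp
  | succ z ih => rw [List.replicate_succ', ← List.append_assoc, h.zero, ih]

theorem sortedValue_filter (h : ExchangeRule Γ) (s : Multiset ℕ) :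
    sortedValue Γ (s.filter (fun a => 0 < a)) = sortedValue Γ s := by
  have hs : s.sort (fun a b => a ≥ b) =
      (s.filter (fun a => 0 < a)).sort (fun a b => a ≥ b) ++
        List.replicate (s.count 0) 0 := by
    apply sort_eq_of_pairwise
    · rw [← Multiset.coe_add, Multiset.sort_eq, Multiset.coe_replicate, ← Multiset.filter_eq']
      conv_rhs => rw [← Multiset.filter_add_not (fun a => 0 < a) s]
      congr 1
      apply Multiset.filter_congr
      intro x _
      omega
    · rw [List.pairwise_append]
      refine ⟨Multiset.pairwise_sort _ _, ?_, ?_⟩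
      · rw [List.pairwise_replicate]; simp
      · intro a _ b hb
        rw [List.eq_of_mem_replicate hb]
        exact Nat.zero_le a
  rw [sortedValue, sortedValue, hs, List.map_append, List.map_replicate, Nat.cast_zero,
    h.append_replicate_zero]

/-- An entry `a` is moved to the right past the larger entries `j` of a strictly decreasing sequence;
each step changes the sign and leaves behind a pair of entries `(a + j) / 2`. -/
theorem insert_entry (h : ExchangeRule Γ) (C : List ℕ) (a : ℤ) (r : List ℕ) : ∀ (l : List ℕ),
    (l ++ r).Pairwise (fun a b => a > b) → (∀ x ∈ l, a < (x : ℤ)) →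
    (∀ x ∈ r, Even ((x : ℤ) - a)) →
    Γ (pairs C ++ l.map Nat.cast ++ a :: r.map Nat.cast) =
      (r.map fun j : ℕ => if a < (j : ℤ) ∧ 0 ≤ (j : ℤ) + a then
        (-1 : ℚ) ^ (r.filter (fun x => j < x)).length * 2 *
          sortedValue Γ ((C + C + (l ++ r : List ℕ) : Multiset ℕ) - {j} +
            {(((j : ℤ) + a) / 2).toNat, (((j : ℤ) + a) / 2).toNat}) else 0).sum +
      (if 0 ≤ a then (-1 : ℚ) ^ (r.filter (fun x : ℕ => a < (x : ℤ))).length *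
        sortedValue Γ ((C + C + (l ++ r : List ℕ) : Multiset ℕ) + {a.toNat}) else 0) := by
  induction r with
  | nil =>
    intro l hl hla _
    simp only [List.map_nil, List.sum_nil, zero_add, List.filter_nil, List.length_nil, pow_zero,
      one_mul, List.append_nil] at *
    split_ifs with ha
    · have hsort : (l ++ [a.toNat]).Pairwise (fun a b => a ≥ b) := by
        rw [List.pairwise_append]
        refine ⟨hl.imp fun h => le_of_lt h, by simp, ?_⟩
        intro x hx b hb
        have := hla x hx
        simp only [List.mem_singleton] at hb
        omega
      have := h.eq_sortedValue C (l ++ [a.toNat]) hsort rfl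
      rw [List.map_append, List.map_singleton, Int.toNat_of_nonneg ha] at this
      rw [List.append_assoc, this, ← Multiset.coe_add, Multiset.coe_singleton]
      simp only [add_assoc]
    · rw [h.neg _ _ (by omega)]
  | cons j r ih =>
    intro l hl hla hpar
    have hlr := List.pairwise_append.1 hl
    have hjr := List.pairwise_cons.1 hlr.2.1
    by_cases haj : a < (j : ℤ)
    · -- exchange `a` and `j`
      obtain ⟨m, hm⟩ := hpar j (by simp)
      have hex := h.even (pairs C ++ l.map Nat.cast) (r.map Nat.cast) (a + m) m
      have e1 : a + m + m = j := by omega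
      have e2 : a + m - m = a := by omega
      have e3 : ((j : ℤ) + a) / 2 = a + m := by omega
      rw [e1, e2] at hex
      have hih := ih (l ++ [j]) (by simpa using hl)
        (by simp only [List.mem_append, List.mem_singleton]; rintro x (hx | rfl); exacts [hla x hx, haj])
        (fun x hx => hpar x (List.mem_cons_of_mem _ hx))
      simp only [List.append_assoc, List.cons_append, List.nil_append, List.map_append, List.map_cons,
        List.map_nil] at hih hex ⊢
      have hf1 : r.filter (fun x => decide (j < x)) = [] := by
        rw [List.filter_eq_nil_iff]
        intro x hx
        have := hjr.1 x hx
        simp only [decide_eq_true_eq]; omega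
      have hpair : Γ (pairs C ++ (l.map Nat.cast ++ (a + m) :: (a + m) ::
          r.map Nat.cast)) = if 0 ≤ (j : ℤ) + a then
          sortedValue Γ ((C + C + (l ++ j :: r : List ℕ) : Multiset ℕ) - {j} +
            {(a + m).toNat, (a + m).toNat}) else 0 := by
        split_ifs with h0
        · have hsub : (l ++ r).Pairwise (fun a b => a ≥ b) := by
            rw [List.pairwise_append]
            refine ⟨hlr.1.imp fun h => le_of_lt h, hjr.2.imp fun h => le_of_lt h, ?_⟩
            intro x hx y hy
            exact le_of_lt (hlr.2.2 x hx y (List.mem_cons_of_mem _ hy))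
          have h1 := h.eq_sortedValue (C ++ [(a + m).toNat]) (l ++ r) hsub (s :=
            (C + C + (l ++ j :: r : List ℕ) : Multiset ℕ) - {j} +
              {(a + m).toNat, (a + m).toNat}) (by
              rw [add_coe_sub_singleton]
              simp only [← Multiset.coe_add, Multiset.coe_singleton, Multiset.insert_eq_cons,
                ← Multiset.singleton_add]
              abel)
          rw [← h1, pairs_append, List.append_assoc, List.map_append]
          simp only [pairs_cons, pairs_nil, List.cons_append, List.nil_append]
          rw [Int.toNat_of_nonneg (by omega)]
          have h2 := h.pair_move (a + m) (l.map Nat.cast) (pairs C)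
            (r.map Nat.cast)
          rw [h2]
        · have h2 := h.neg_pair (c := a + m) (by omega) (pairs C ++ l.map Nat.cast)
            (r.map Nat.cast)
          simpa using h2
      have hstep : Γ (pairs C ++ (l.map Nat.cast ++ a :: (j : ℤ) ::
          r.map Nat.cast)) = 2 * Γ (pairs C ++ (l.map Nat.cast ++
            (a + m) :: (a + m) :: r.map Nat.cast)) - Γ (pairs C ++
              (l.map Nat.cast ++ (j : ℤ) :: a :: r.map Nat.cast)) := by
        linarith
      rw [hstep, hih, hpair]
      have hsum : (r.map fun j' : ℕ => if a < (j' : ℤ) ∧ 0 ≤ (j' : ℤ) + a then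
          (-1 : ℚ) ^ ((j :: r).filter (fun x => j' < x)).length * 2 *
            sortedValue Γ ((C + C + (l ++ j :: r : List ℕ) : Multiset ℕ) - {j'} +
              {(((j' : ℤ) + a) / 2).toNat, (((j' : ℤ) + a) / 2).toNat}) else 0).sum =
          - (r.map fun j' : ℕ => if a < (j' : ℤ) ∧ 0 ≤ (j' : ℤ) + a then
          (-1 : ℚ) ^ (r.filter (fun x => j' < x)).length * 2 *
            sortedValue Γ ((C + C + (l ++ j :: r : List ℕ) : Multiset ℕ) - {j'} +
              {(((j' : ℤ) + a) / 2).toNat, (((j' : ℤ) + a) / 2).toNat}) else 0).sum := by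
        rw [List.sum_neg, List.map_map]
        congr 1
        apply List.map_congr_left
        intro j' hj'
        have : j' < j := hjr.1 j' hj'
        simp only [Function.comp, List.filter_cons, this, decide_true, if_true, List.length_cons,
          pow_succ]
        split_ifs <;> ring
      simp only [List.sum_cons]
      rw [hsum]
      simp only [List.filter_cons, haj, decide_true, if_true, lt_irrefl, decide_false, hf1, e3,
        true_and, List.length_cons, List.length_nil, pow_zero, pow_succ, Bool.false_eq_true, if_false]
      split_ifs <;> ring
    · -- `a` is in its place
      have hf : ∀ x ∈ j :: r, ¬ a < (x : ℤ) := by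
        intro x hx
        rcases List.mem_cons.1 hx with rfl | hx
        · exact haj
        · have := hjr.1 x hx; omega
      have hz : ((j :: r).map fun j' : ℕ => if a < (j' : ℤ) ∧ 0 ≤ (j' : ℤ) + a then
          (-1 : ℚ) ^ ((j :: r).filter (fun x => j' < x)).length * 2 *
            sortedValue Γ ((C + C + (l ++ j :: r : List ℕ) : Multiset ℕ) - {j'} +
              {(((j' : ℤ) + a) / 2).toNat, (((j' : ℤ) + a) / 2).toNat}) else 0).sum = 0 := by
        apply List.sum_eq_zero
        intro x hx
        obtain ⟨y, hy, rfl⟩ := List.mem_map.1 hx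
        rw [if_neg fun hh => hf y hy hh.1]
      have hf1 : (j :: r).filter (fun x : ℕ => decide (a < (x : ℤ))) = [] := by
        rw [List.filter_eq_nil_iff]
        intro x hx
        simpa using hf x hx
      have ha : 0 ≤ a := by omega
      rw [hz, hf1, if_pos ha, zero_add, List.length_nil, pow_zero, one_mul]
      have hsort : (l ++ a.toNat :: j :: r).Pairwise (fun a b => a ≥ b) := by
        rw [List.pairwise_append, List.pairwise_cons]
        refine ⟨hlr.1.imp fun h => le_of_lt h, ⟨?_, hlr.2.1.imp fun h => le_of_lt h⟩, ?_⟩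
        · intro x hx
          have := hf x hx
          omega
        · intro x hx y hy
          rcases List.mem_cons.1 hy with rfl | hy
          · have := hla x hx; omega
          · exact le_of_lt (hlr.2.2 x hx y hy)
      have := h.eq_sortedValue C _ hsort (s := (C + C + (l ++ j :: r : List ℕ) : Multiset ℕ) +
        {a.toNat}) (by
          simp only [← Multiset.coe_add, ← Multiset.cons_coe, ← Multiset.singleton_add]
          abel)
      rw [← this, List.append_assoc, List.map_append, List.map_cons (a := a.toNat),
        Int.toNat_of_nonneg ha]

end ExchangeRule

/-- The sum of the values of `Γ` at the sequences which arise from `p ++ l` when one of the entries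
of `l` is lowered by `d`. -/
def lowerSum (Γ : List ℤ → ℚ) (d : ℤ) : List ℤ → List ℤ → ℚ
  | _, [] => 0
  | p, a :: l => Γ (p ++ (a - d) :: l) + lowerSum Γ d (p ++ [a]) l

namespace ExchangeRule

variable {Γ : List ℤ → ℚ}

/-- In a pair of equal entries `c`, the two ways of lowering one of them by `2 * k` add up to twice
the value at the pair `c - k`, `c - k`. -/
theorem lowerSum_pairs (h : ExchangeRule Γ) (k : ℕ) (μ : List ℕ)
    (hμ : μ.Pairwise (fun a b => a ≥ b)) (C : List ℕ) : ∀ P : List ℕ,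
    lowerSum Γ (2 * k) (pairs P) (pairs C ++ μ.map Nat.cast) =
      (C.map fun c => if k ≤ c then 2 * sortedValue Γ
        (((P ++ C : List ℕ) + (P ++ C : List ℕ) + μ : Multiset ℕ) - {c, c} + {c - k, c - k}) else 0).sum
      + lowerSum Γ (2 * k) (pairs (P ++ C)) (μ.map Nat.cast) := by
  induction C with
  | nil => intro P; simp
  | cons c C ih =>
    intro P
    have h1 := ih (P ++ [c])
    have h2 := h.even (pairs P) (pairs C ++ μ.map Nat.cast) ((c : ℤ) - k) k
    rw [sub_add_cancel, sub_sub, ← two_mul] at h2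
    have h3 : Γ (pairs P ++ ((c : ℤ) - k) :: ((c : ℤ) - k) :: (pairs C ++ μ.map Nat.cast)) =
        if k ≤ c then sortedValue Γ
          (((P ++ c :: C : List ℕ) + (P ++ c :: C : List ℕ) + μ : Multiset ℕ) - {c, c} +
            {c - k, c - k}) else 0 := by
      split_ifs with hkc
      · rw [← h.eq_sortedValue (P ++ (c - k) :: C) μ hμ]
        · rw [pairs_append, pairs_cons]
          push_cast [hkc]
          simp
        · have : ((P ++ c :: C : List ℕ) + (P ++ c :: C : List ℕ) + μ : Multiset ℕ) =
              (P + C + (P + C) + μ) + {c, c} := by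
            simp only [← Multiset.coe_add, ← Multiset.cons_coe, ← Multiset.singleton_add,
              Multiset.insert_eq_cons]
            abel
          rw [this, add_tsub_cancel_right]
          simp only [← Multiset.coe_add, ← Multiset.cons_coe, ← Multiset.singleton_add,
              Multiset.insert_eq_cons]
          abel
      · exact h.neg_pair (by omega) _ _
    simp only [List.append_assoc, List.cons_append, List.nil_append, pairs_cons, lowerSum,
      pairs_append, pairs_nil, List.map_cons, List.sum_cons] at *
    rw [h1]
    have h4 : Γ (pairs P ++ ((c : ℤ) - 2 * k) :: (c : ℤ) :: (pairs C ++ μ.map Nat.cast)) +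
        Γ (pairs P ++ (c : ℤ) :: ((c : ℤ) - 2 * k) :: (pairs C ++ μ.map Nat.cast)) =
        if k ≤ c then 2 * sortedValue Γ
          (((P ++ c :: C : List ℕ) + (P ++ c :: C : List ℕ) + μ : Multiset ℕ) - {c, c} +
            {c - k, c - k}) else 0 := by
      rw [add_comm, h2, h3]
      split_ifs <;> simp
    rw [← add_assoc, ← add_assoc, h4, add_assoc]

/-- Lowering one of the parts of odd multiplicity, `r` being those which are still to be lowered. All of
them are congruent to `e` modulo `2`, so that the lowered entry differs from each by an even number. -/
theorem lowerSum_strict (h : ExchangeRule Γ) (k : ℕ) (hk : 1 ≤ k) (C μ : List ℕ)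
    (hμ : μ.Pairwise (fun a b => a > b)) (e : ℕ) (hpar : ∀ i ∈ μ, i % 2 = e) (r : List ℕ) :
    ∀ l : List ℕ, l ++ r = μ →
    lowerSum Γ (2 * k) (pairs C ++ l.map Nat.cast) (r.map Nat.cast) =
      (r.map fun i =>
        (∑ j ∈ μ.toFinset.filter (fun j => j < i ∧ i - j < 2 * k ∧ 2 * k ≤ i + j),
          (-1 : ℚ) ^ (μ.toFinset.filter (fun x => j < x ∧ x < i)).card * 2 *
            sortedValue Γ ((C + C + μ : Multiset ℕ) - {i, j} +
              {(i + j) / 2 - k, (i + j) / 2 - k})) +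
        (if 2 * k ≤ i then
          (-1 : ℚ) ^ (μ.toFinset.filter (fun x => i - 2 * k < x ∧ x < i)).card *
            sortedValue Γ ((C + C + μ : Multiset ℕ) - {i} + {i - 2 * k}) else 0)).sum := by
  induction r with
  | nil => intro l _; simp [lowerSum]
  | cons i r ih =>
    intro l hl
    have hlr := List.pairwise_append.1 (hl ▸ hμ)
    have hir := List.pairwise_cons.1 hlr.2.1
    have hmem : ∀ x, x ∈ μ ↔ x ∈ l ∨ x = i ∨ x ∈ r := by intro x; rw [← hl]; simp
    have hli : ∀ x ∈ l, i < x := fun x hx => hlr.2.2 x hx i (by simp)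
    have hnod : r.Nodup := hir.2.imp fun h => ne_of_gt h
    rw [List.map_cons, List.map_cons, List.sum_cons, lowerSum]
    congr 1
    swap
    · have := ih (l ++ [i]) (by simpa using hl)
      simpa using this
    have hsub : (l ++ r).Pairwise (fun a b => a > b) := by
      rw [List.pairwise_append]
      exact ⟨hlr.1, hir.2, fun x hx y hy => hlr.2.2 x hx y (List.mem_cons_of_mem _ hy)⟩
    rw [h.insert_entry C ((i : ℤ) - 2 * k) r l hsub (fun x hx => by have := hli x hx; omega)
      (fun x hx => by
        have h1 := hpar x ((hmem x).2 (by simp [hx]))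
        have h2 := hpar i ((hmem i).2 (by simp))
        rw [Int.even_iff]
        omega)]
    have hS : ((C + C + (l ++ r : List ℕ) : Multiset ℕ)) = (C + C + μ : Multiset ℕ) - {i} := by
      rw [← hl, add_coe_sub_singleton]
    have hfil : ∀ (p q : ℕ → Prop) [DecidablePred p] [DecidablePred q], (∀ x, x < i → (p x ↔ q x)) →
        r.toFinset.filter p = μ.toFinset.filter (fun x => x < i ∧ q x) := by
      intro p q _ _ hpq
      ext x
      simp only [Finset.mem_filter, List.mem_toFinset, hmem]
      constructor
      · rintro ⟨hx, hp⟩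
        exact ⟨Or.inr (Or.inr hx), hir.1 x hx, (hpq x (hir.1 x hx)).1 hp⟩
      · rintro ⟨hx | rfl | hx, hxi, hq⟩
        · have := hli x hx; omega
        · omega
        · exact ⟨hx, (hpq x hxi).2 hq⟩
    have hlen : ∀ (p q : ℕ → Prop) [DecidablePred p] [DecidablePred q], (∀ x, x < i → (p x ↔ q x)) →
        (r.filter (fun x => p x)).length = (μ.toFinset.filter (fun x => q x ∧ x < i)).card := by
      intro p q _ _ hpq
      rw [← List.toFinset_card_of_nodup (hnod.filter _), List.toFinset_filter]
      simp only [decide_eq_true_eq]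
      rw [hfil p q hpq]
      simp only [and_comm]
    congr 1
    · rw [← List.sum_toFinset _ hnod, ← Finset.sum_filter,
        hfil _ (fun j => i - j < 2 * k ∧ 2 * k ≤ i + j) (by intro x hx; omega)]
      apply Finset.sum_congr rfl
      intro j hj
      simp only [Finset.mem_filter] at hj
      rw [hlen (fun x => j < x) (fun x => j < x) (fun x _ => Iff.rfl), hS]
      have e1 : (((j : ℤ) + ((i : ℤ) - 2 * k)) / 2).toNat = (i + j) / 2 - k := by omega
      rw [e1, tsub_tsub, Multiset.singleton_add, Multiset.insert_eq_cons i]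
    · by_cases hki : 2 * k ≤ i
      · have e1 : ((i : ℤ) - 2 * k).toNat = i - 2 * k := by omega
        rw [if_pos (by omega), if_pos hki, e1, hS,
          hlen (fun x => (i : ℤ) - 2 * k < (x : ℤ)) (fun x => i - 2 * k < x) (fun x _ => by omega)]
      · rw [if_neg (by omega), if_neg hki]

end ExchangeRule

/-- The combinatorial core: a multiset of parts is split into pairs of equal parts and the strictly
decreasing sequence of the parts of odd multiplicity. -/
theorem sortedValue_of_lowerSum {Γ Γ' : List ℤ → ℚ} (h : ExchangeRule Γ) (h' : ExchangeRule Γ')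
    (k : ℕ) (hk : 1 ≤ k) (hrec : ∀ l, Γ' l = lowerSum Γ (2 * k) [] l) (s : Multiset ℕ) (e : ℕ)
    (hpar : ∀ i, Odd (s.count i) → i % 2 = e) :
    sortedValue Γ' s =
      (∑ i ∈ s.toFinset.filter (fun i => k ≤ i ∧ 2 ≤ s.count i),
        (2 * (s.count i / 2 : ℕ) : ℚ) * sortedValue Γ (s - {i, i} + {i - k, i - k})) +
      (∑ i ∈ s.toFinset.filter (fun i => 2 * k ≤ i ∧ Odd (s.count i)),
        (-1 : ℚ) ^ (s.filter (fun x => i - 2 * k < x ∧ x < i)).card *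
          sortedValue Γ (s - {i} + {i - 2 * k})) +
      (∑ p ∈ (s.toFinset ×ˢ s.toFinset).filter
          (fun p => p.2 < p.1 ∧ p.1 - p.2 < 2 * k ∧ 2 * k ≤ p.1 + p.2 ∧
            Odd (s.count p.1) ∧ Odd (s.count p.2)),
        (-1 : ℚ) ^ (s.filter (fun x => p.2 < x ∧ x < p.1)).card * 2 *
          sortedValue Γ (s - {p.1, p.2} + {(p.1 + p.2) / 2 - k, (p.1 + p.2) / 2 - k})) := by
  set U := s.toFinset.filter (fun i => Odd (s.count i)) with hU
  set μ := U.sort (fun a b => a ≥ b) with hμdef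
  set M : Multiset ℕ := ∑ i ∈ s.toFinset, (s.count i / 2) • {i} with hM
  have hcM : ∀ x, M.count x = s.count x / 2 := by
    intro x
    rw [hM, Multiset.count_sum']
    simp only [Multiset.count_nsmul, Multiset.count_singleton, mul_ite, mul_one,
      mul_zero]
    rw [Finset.sum_ite_eq]
    split_ifs with hx
    · rfl
    · rw [Multiset.mem_toFinset, ← Multiset.count_eq_zero] at hx
      simp [hx]
  have hμU : μ.toFinset = U := Finset.sort_toFinset _ _
  have hμnd : μ.Nodup := Finset.sort_nodup _ _
  have hμge : μ.Pairwise (fun a b => a ≥ b) := Finset.pairwise_sort _ _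
  have hμgt : μ.Pairwise (fun a b => a > b) :=
    (hμge.and hμnd).imp fun hab => lt_of_le_of_ne hab.1 hab.2.symm
  have hμmem : ∀ x, x ∈ μ ↔ Odd (s.count x) := by
    intro x
    rw [← List.mem_toFinset, hμU, hU, Finset.mem_filter, Multiset.mem_toFinset]
    refine ⟨fun hh => hh.2, fun hh => ⟨?_, hh⟩⟩
    rw [← Multiset.count_pos]
    exact hh.pos
  have hs : (M.toList + M.toList + μ : Multiset ℕ) = s := by
    rw [Multiset.coe_toList]
    ext x
    rw [Multiset.count_add, Multiset.count_add, hcM, Multiset.coe_count]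
    by_cases hx : Odd (s.count x)
    · rw [List.count_eq_one_of_mem hμnd ((hμmem x).2 hx)]
      rw [Nat.odd_iff] at hx
      omega
    · rw [List.count_eq_zero_of_not_mem (fun hh => hx ((hμmem x).1 hh))]
      rw [Nat.not_odd_iff] at hx
      omega
  have hsign : ∀ (p : ℕ → Prop) [DecidablePred p],
      (-1 : ℚ) ^ (U.filter p).card = (-1 : ℚ) ^ (s.filter p).card := by
    intro p _
    have h1 : (s.filter p).card = 2 * (M.filter p).card + (U.filter p).card := by
      conv_lhs => rw [← hs]
      rw [Multiset.filter_add, Multiset.filter_add, Multiset.coe_toList, Multiset.card_add,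
        Multiset.card_add, ← two_mul, ← hμU, Multiset.filter_coe, Multiset.coe_card]
      have h2 := List.toFinset_card_of_nodup (hμnd.filter (fun x => decide (p x)))
      simp only [List.toFinset_filter, decide_eq_true_eq] at h2
      rw [h2]
    rw [h1, pow_add, pow_mul]
    simp
  rw [← h'.eq_sortedValue M.toList μ hμge hs, hrec]
  have h1 := h.lowerSum_pairs k μ hμge M.toList []
  have h2 := h.lowerSum_strict k hk M.toList μ hμgt e (fun i hi => hpar i ((hμmem i).1 hi)) μ [] rfl
  simp only [pairs_nil, List.nil_append, List.map_nil, List.append_nil] at h1 h2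
  rw [h1, h2, hs, ← List.sum_toFinset _ hμnd, hμU, Finset.sum_add_distrib]
  have e1 : (M.toList.map fun c => if k ≤ c then 2 * sortedValue Γ (s - {c, c} + {c - k, c - k})
      else 0).sum = ∑ i ∈ s.toFinset.filter (fun i => k ≤ i ∧ 2 ≤ s.count i),
        (2 * (s.count i / 2 : ℕ) : ℚ) * sortedValue Γ (s - {i, i} + {i - k, i - k}) := by
    rw [← Multiset.sum_coe, ← Multiset.map_coe, Multiset.coe_toList,
      Finset.sum_multiset_map_count]
    have hsub : s.toFinset.filter (fun i => k ≤ i ∧ 2 ≤ s.count i) =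
        M.toFinset.filter (fun i => k ≤ i) := by
      ext x
      rw [Finset.mem_filter, Finset.mem_filter, Multiset.mem_toFinset, Multiset.mem_toFinset,
        ← Multiset.count_pos, ← Multiset.count_pos, hcM]
      omega
    rw [hsub, Finset.sum_filter]
    apply Finset.sum_congr rfl
    intro x _
    rw [hcM, nsmul_eq_mul]
    split_ifs
    · ring
    · simp
  have e2 : (∑ i ∈ U, if 2 * k ≤ i then
          (-1 : ℚ) ^ (U.filter (fun x => i - 2 * k < x ∧ x < i)).card *
            sortedValue Γ (s - {i} + {i - 2 * k}) else 0) =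
      ∑ i ∈ s.toFinset.filter (fun i => 2 * k ≤ i ∧ Odd (s.count i)),
        (-1 : ℚ) ^ (s.filter (fun x => i - 2 * k < x ∧ x < i)).card *
          sortedValue Γ (s - {i} + {i - 2 * k}) := by
    rw [← Finset.sum_filter, hU, Finset.filter_filter, ← hU]
    simp only [and_comm, hsign]
  have e3 : (∑ i ∈ U, ∑ j ∈ U.filter (fun j => j < i ∧ i - j < 2 * k ∧ 2 * k ≤ i + j),
          (-1 : ℚ) ^ (U.filter (fun x => j < x ∧ x < i)).card * 2 *
            sortedValue Γ (s - {i, j} + {(i + j) / 2 - k, (i + j) / 2 - k})) =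
      ∑ p ∈ (s.toFinset ×ˢ s.toFinset).filter
          (fun p => p.2 < p.1 ∧ p.1 - p.2 < 2 * k ∧ 2 * k ≤ p.1 + p.2 ∧
            Odd (s.count p.1) ∧ Odd (s.count p.2)),
        (-1 : ℚ) ^ (s.filter (fun x => p.2 < x ∧ x < p.1)).card * 2 *
          sortedValue Γ (s - {p.1, p.2} + {(p.1 + p.2) / 2 - k, (p.1 + p.2) / 2 - k}) := by
    simp only [hsign]
    rw [Finset.sum_sigma']
    refine Finset.sum_bij' (fun p _ => (p.1, p.2)) (fun p _ => ⟨p.1, p.2⟩) ?_ ?_ ?_ ?_ ?_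
    · rintro ⟨i, j⟩ hp
      simp only [hU, Finset.mem_sigma, Finset.mem_filter, Finset.mem_product] at hp ⊢
      tauto
    · rintro ⟨i, j⟩ hp
      simp only [hU, Finset.mem_sigma, Finset.mem_filter, Finset.mem_product] at hp ⊢
      tauto
    · intro _ _; rfl
    · intro _ _; rfl
    · intro _ _; rfl
  rw [e1, e2, e3]
  ring

/-! ### Rows and heights -/

theorem lt_getD_iff (L : List ℕ) (hL : L.Pairwise (fun a b => a ≥ b)) (x r : ℕ) :
    x < L.getD r 0 ↔ r < L.countP (fun a => x < a) := by
  induction L generalizing r with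
  | nil => simp
  | cons a L ih =>
    rw [List.pairwise_cons] at hL
    have h0 : ¬ x < a → L.countP (fun a => x < a) = 0 := by
      intro hxa
      rw [List.countP_eq_zero]
      intro b hb
      have := hL.1 b hb
      simp only [decide_eq_true_eq]
      omega
    rw [List.countP_cons]
    rcases r with _ | r
    · simp only [List.getD_cons_zero, decide_eq_true_eq]
      split_ifs with hxa
      · simp [hxa]
      · simp [hxa, h0 hxa]
    · simp only [List.getD_cons_succ, decide_eq_true_eq, ih hL.2]
      split_ifs with hxa
      · omega
      · rw [h0 hxa]; omega

theorem Ptn.lt_row_iff (lam : Ptn) (x r : ℕ) :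
    x < lam.row r ↔ r < lam.1.countP (fun a => x < a) := by
  rw [Ptn.row, lt_getD_iff _ (Multiset.pairwise_sort _ _)]
  conv_rhs => rw [← Multiset.sort_eq lam.1 (fun a b => a ≥ b), Multiset.coe_countP]

theorem Ptn.row_antitone (lam : Ptn) : Antitone lam.row := by
  intro r r' hr
  by_contra! hcon
  have h1 := (lam.lt_row_iff _ _).1 hcon
  have h2 := (lam.lt_row_iff (lam.row r) r).2 (by omega)
  exact lt_irrefl _ h2

theorem Ptn.countP_pos_eq_length (lam : Ptn) : lam.1.countP (fun a => 0 < a) = lam.length :=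
  Multiset.countP_eq_card.2 lam.2

theorem Ptn.row_pos_iff (lam : Ptn) (r : ℕ) : 0 < lam.row r ↔ r < lam.length := by
  rw [lam.lt_row_iff, lam.countP_pos_eq_length]

/-- With `c x` the number of parts greater than `x`, the lowest row of `lam / lam(i → j)` is the row of
index `c j - 1` and the highest row that of index `c (i - 1) - 1`. -/
theorem Ptn.height_replace (lam : Ptn) {i j : ℕ} (hi : i ∈ lam.1) (hj : j < i) :
    lam.height (lam.replace {i} {j}) = (lam.1.filter (fun x => j < x ∧ x < i)).card := by
  have hcnt : ∀ x, (lam.replace {i} {j}).1.countP (fun a => x < a) + (if x < i then 1 else 0) =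
      lam.1.countP (fun a => x < a) + (if x < j then 1 else 0) := by
    intro x
    have h1 : (lam.replace {i} {j}).1.countP (fun a => x < a) =
        (lam.1 - {i} + {j}).countP (fun a => x < a) := by
      rw [Ptn.replace, Ptn.ofMultiset, Multiset.countP_filter]
      apply Multiset.countP_congr rfl
      intro y _
      simp only [eq_iff_iff]
      omega
    have h2 : lam.1 = (lam.1 - {i}) + {i} := by
      rw [tsub_add_cancel_of_le (Multiset.singleton_le.2 hi)]
    rw [h1, Multiset.countP_add]
    conv_rhs => rw [h2, Multiset.countP_add]
    simp only [← Multiset.cons_zero, Multiset.countP_cons, Multiset.countP_zero]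
    omega
  have hmono : ∀ x y, x ≤ y → lam.1.countP (fun a => y < a) ≤ lam.1.countP (fun a => x < a) := by
    intro x y hxy
    rw [Multiset.countP_eq_card_filter, Multiset.countP_eq_card_filter]
    exact Multiset.card_le_card (Multiset.monotone_filter_right _ fun a h => by omega)
  have hpos : ∀ x, x < i → 0 < lam.1.countP (fun a => x < a) := by
    intro x hx
    exact Multiset.countP_pos.2 ⟨i, hi, hx⟩
  have hrows : ∀ r, r ∈ Ptn.skewRows lam (lam.replace {i} {j}) ↔
      ∃ x, j ≤ x ∧ x < i ∧ r + 1 = lam.1.countP (fun a => x < a) := by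
    intro r
    rw [Ptn.skewRows, Finset.mem_filter, Finset.mem_range]
    constructor
    · rintro ⟨-, hr⟩
      have h1 := (lam.lt_row_iff _ _).1 hr
      have h2 := mt ((lam.replace {i} {j}).lt_row_iff _ _).2 (lt_irrefl ((lam.replace {i} {j}).row r))
      have h3 := hcnt ((lam.replace {i} {j}).row r)
      refine ⟨(lam.replace {i} {j}).row r, ?_, ?_, ?_⟩ <;>
      · split_ifs at h3 <;> omega
    · rintro ⟨x, hjx, hxi, hr⟩
      have h3 := hcnt x
      rw [if_pos hxi, if_neg (by omega)] at h3
      have h1 : x < lam.row r := (lam.lt_row_iff _ _).2 (by omega)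
      have h2 := mt ((lam.replace {i} {j}).lt_row_iff x r).1 (by omega)
      refine ⟨(lam.row_pos_iff r).1 (by omega), by omega⟩
  have hsup : (Ptn.skewRows lam (lam.replace {i} {j})).sup id + 1 =
      lam.1.countP (fun a => j < a) := by
    have h0 := hpos j hj
    have hm : lam.1.countP (fun a => j < a) - 1 ∈ Ptn.skewRows lam (lam.replace {i} {j}) :=
      (hrows _).2 ⟨j, le_rfl, hj, by omega⟩
    have h1 := Finset.le_sup (f := id) hm
    have h2 : (Ptn.skewRows lam (lam.replace {i} {j})).sup id ≤ lam.1.countP (fun a => j < a) - 1 := by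
      apply Finset.sup_le
      intro r hr
      obtain ⟨x, hx, -, hrx⟩ := (hrows r).1 hr
      have := hmono j x hx
      simp only [id]
      omega
    simp only [id] at h1
    omega
  have hinf : sInf (Ptn.skewRows lam (lam.replace {i} {j}) : Set ℕ) + 1 =
      lam.1.countP (fun a => i - 1 < a) := by
    have h0 := hpos (i - 1) (by omega)
    have hm : lam.1.countP (fun a => i - 1 < a) - 1 ∈
        (Ptn.skewRows lam (lam.replace {i} {j}) : Set ℕ) :=
      Finset.mem_coe.2 ((hrows _).2 ⟨i - 1, by omega, by omega, by omega⟩)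
    have h1 := Nat.sInf_le hm
    have h2 := Nat.sInf_mem ⟨_, hm⟩
    obtain ⟨x, -, hx, hrx⟩ := (hrows _).1 (Finset.mem_coe.1 h2)
    have := hmono x (i - 1) (by omega)
    omega
  have hsplit : lam.1.countP (fun a => j < a) = lam.1.countP (fun a => i - 1 < a) +
      (lam.1.filter (fun x => j < x ∧ x < i)).card := by
    rw [← Multiset.countP_eq_card_filter]
    generalize lam.1 = s
    induction s using Multiset.induction_on with
    | empty => simp
    | cons a s ih =>
      simp only [Multiset.countP_cons, ih]
      split_ifs <;> omega
  rw [Ptn.height]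
  omega

/-! ### The exchange relation at `t = -1` -/

section Exchange

variable {g : ℤ → ℤ → ℚ[X]} {y : ℤ → ℤ → PowerSeries ℚ}

/-- The defining relation of `g`, used `N` times to shift the arguments of `y`. -/
theorem exchange_iterate (hg : ∀ a b, ((g a b : ℚ[X]) : PowerSeries ℚ) =
      y (a + 1) b - PowerSeries.X * y a (b + 1)) (a b : ℤ) (N : ℕ) :
    y a (b + 1) = ∑ n ∈ Finset.range N,
      PowerSeries.X ^ n * ((g (a - 1 - n) (b + 1 + n) : ℚ[X]) : PowerSeries ℚ) +
        PowerSeries.X ^ N * y (a - N) (b + 1 + N) := by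
  induction N with
  | zero => simp
  | succ N ih =>
    rw [ih, Finset.sum_range_succ, hg]
    have e1 : a - 1 - (N : ℤ) + 1 = a - N := by ring
    have e2 : a - ((N + 1 : ℕ) : ℤ) = a - 1 - N := by push_cast; ring
    have e3 : b + 1 + ((N + 1 : ℕ) : ℤ) = b + 1 + N + 1 := by push_cast; ring
    rw [e1, e2, e3]
    ring

/-- The exchange relation for an indeterminate `t`. Expressing the antisymmetric `y a (b + 1)` through
the `g`'s brings in the factor `1 + t ^ N`, which vanishes at `t = -1` if `N` is odd. -/
theorem exchange_polynomial (hy : ∀ a b, y b a = -y a b)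
    (hg : ∀ a b, ((g a b : ℚ[X]) : PowerSeries ℚ) = y (a + 1) b - PowerSeries.X * y a (b + 1))
    (a : ℤ) (N : ℕ) :
    (1 + X ^ N) * (g (a - 1 - N) a - X * g a (a - 1 - N)) =
      -((1 - X) * (1 + X) * ∑ n ∈ Finset.range N, X ^ n * g (a - 1 - n) (a - N + n)) := by
  apply Polynomial.coe_injective ℚ
  have h1 := exchange_iterate hg a (a - 1 - N) N
  have e1 : a - 1 - (N : ℤ) + 1 = a - N := by ring
  have e2 : a - (N : ℤ) + N = a := by ring
  rw [e1, e2, hy a (a - N)] at h1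
  have h2 : (1 + PowerSeries.X ^ N) * y a (a - N) = ∑ n ∈ Finset.range N,
      PowerSeries.X ^ n * ((g (a - 1 - n) (a - N + n) : ℚ[X]) : PowerSeries ℚ) := by
    linear_combination h1
  have h3 : ((∑ n ∈ Finset.range N, X ^ n * g (a - 1 - n) (a - N + n) : ℚ[X]) : PowerSeries ℚ) =
      ∑ n ∈ Finset.range N,
        PowerSeries.X ^ n * ((g (a - 1 - n) (a - N + n) : ℚ[X]) : PowerSeries ℚ) := by
    rw [← Polynomial.coeToPowerSeries.ringHom_apply, map_sum]
    simp
  push_cast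
  rw [h3, ← h2, hg, hg, e1, hy a (a - N), hy (a + 1) (a - 1 - N)]
  ring

theorem exchange_odd (hy : ∀ a b, y b a = -y a b)
    (hg : ∀ a b, ((g a b : ℚ[X]) : PowerSeries ℚ) = y (a + 1) b - PowerSeries.X * y a (b + 1))
    (a b : ℤ) (hab : Odd (a - b)) : (g a b).eval (-1) + (g b a).eval (-1) = 0 := by
  wlog hlt : b < a generalizing a b with H
  · rw [add_comm]
    have : b ≠ a := by rintro rfl; simp at hab
    exact H b a (by rw [← neg_sub]; exact hab.neg) (by omega)
  obtain ⟨N, hN⟩ := Int.eq_ofNat_of_zero_le (show 0 ≤ a - 1 - b by omega)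
  obtain rfl : b = a - 1 - N := by omega
  have hev : Even N := by
    rw [Int.odd_iff] at hab
    rw [Nat.even_iff]
    omega
  have h := congrArg (Polynomial.eval (-1)) (exchange_polynomial hy hg a N)
  simp only [eval_mul, eval_add, eval_sub, eval_neg, eval_pow, eval_X, eval_one, hev.neg_one_pow] at h
  linear_combination h / 2

/-- For odd `N`, the factor `1 + t` may be cancelled from `exchange_polynomial` before `t = -1` is
inserted. -/
theorem exchange_sum (hy : ∀ a b, y b a = -y a b)
    (hg : ∀ a b, ((g a b : ℚ[X]) : PowerSeries ℚ) = y (a + 1) b - PowerSeries.X * y a (b + 1))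
    (a : ℤ) (N : ℕ) (hN : Odd N) :
    (N : ℚ) * ((g (a - 1 - N) a).eval (-1) + (g a (a - 1 - N)).eval (-1)) =
      -2 * ∑ n ∈ Finset.range N, (-1) ^ n * (g (a - 1 - n) (a - N + n)).eval (-1) := by
  have h := exchange_polynomial hy hg a N
  have hq : (1 + X ^ N : ℚ[X]) = (1 + X) * ∑ i ∈ Finset.range N, (-X) ^ i := by
    have := mul_neg_geom_sum (-X : ℚ[X]) N
    rw [hN.neg_pow] at this
    linear_combination -this
  have hne : (1 + X : ℚ[X]) ≠ 0 := by
    intro h0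
    have := congrArg (Polynomial.eval 0) h0
    simp at this
  rw [hq] at h
  have h2 : (∑ i ∈ Finset.range N, (-X) ^ i) * (g (a - 1 - N) a - X * g a (a - 1 - N)) =
      -((1 - X) * ∑ n ∈ Finset.range N, X ^ n * g (a - 1 - n) (a - N + n)) := by
    apply mul_left_cancel₀ hne
    linear_combination h
  have h3 := congrArg (Polynomial.eval (-1)) h2
  simp only [eval_mul, eval_sub, eval_neg, eval_pow, eval_X, eval_one, eval_finsetSum, neg_neg,
    one_pow, Finset.sum_const, Finset.card_range, nsmul_eq_mul, mul_one] at h3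
  linear_combination h3

/-- Induction on `m`: by `exchange_sum` the left side is expressed through the values with smaller `m`. -/
theorem exchange_even (hy : ∀ a b, y b a = -y a b)
    (hg : ∀ a b, ((g a b : ℚ[X]) : PowerSeries ℚ) = y (a + 1) b - PowerSeries.X * y a (b + 1))
    (c m : ℤ) : (g (c + m) (c - m)).eval (-1) + (g (c - m) (c + m)).eval (-1) =
      2 * (-1) ^ m * (g c c).eval (-1) := by
  induction hM : m.natAbs using Nat.strong_induction_on generalizing m with
  | _ M ih =>
    wlog hm : 0 ≤ m generalizing m
    · have := this (-m) (by omega) (by omega)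
      rw [sub_neg_eq_add, ← sub_eq_add_neg, zpow_neg, ← inv_zpow] at this
      norm_num at this
      rw [← this]
      ring
    obtain rfl : m = M := by omega
    rcases M with _ | M
    · simp; ring
    have h := exchange_sum hy hg (c + (M + 1 : ℕ)) (2 * M + 1) ⟨M, rfl⟩
    set f : ℕ → ℚ := fun n =>
      (-1) ^ n * (g (c + ((M : ℤ) - n)) (c - ((M : ℤ) - n))).eval (-1) with hf
    have hS : ∑ n ∈ Finset.range (2 * M + 1), (-1) ^ n *
        (g (c + (M + 1 : ℕ) - 1 - n) (c + (M + 1 : ℕ) - (2 * M + 1 : ℕ) + n)).eval (-1) =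
          ∑ n ∈ Finset.range (2 * M + 1), f n := by
      apply Finset.sum_congr rfl
      intro n _
      rw [hf]
      have e1 : c + ((M + 1 : ℕ) : ℤ) - 1 - n = c + ((M : ℤ) - n) := by push_cast; ring
      have e2 : c + ((M + 1 : ℕ) : ℤ) - ((2 * M + 1 : ℕ) : ℤ) + n = c - ((M : ℤ) - n) := by
        push_cast; ring
      rw [e1, e2]
    have hpair : ∀ n ∈ Finset.range (2 * M + 1), f n + f (2 * M + 1 - 1 - n) =
        2 * (-1) ^ M * (g c c).eval (-1) := by
      intro n hn
      rw [Finset.mem_range] at hn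
      have h1 := ih ((M : ℤ) - n).natAbs (by omega) ((M : ℤ) - n) rfl
      have e1 : ((2 * M + 1 - 1 - n : ℕ) : ℤ) = 2 * M - n := by omega
      have e2 : (-1 : ℚ) ^ (2 * M + 1 - 1 - n) = (-1) ^ n := by
        rw [Nat.add_sub_cancel, neg_one_pow_eq_pow_mod_two, neg_one_pow_eq_pow_mod_two (n := n)]
        congr 1
        omega
      have e3 : (-1 : ℚ) ^ ((M : ℤ) - n) = (-1) ^ M * (-1) ^ n := by
        rw [zpow_sub₀ (by norm_num), zpow_natCast, zpow_natCast, div_eq_mul_inv, ← inv_pow]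
        norm_num
      have e4 : ((-1 : ℚ) ^ n) * (-1) ^ n = 1 := by
        rw [← mul_pow]; norm_num
      simp only [hf]
      rw [e1, e2]
      have e5 : c + ((M : ℤ) - (2 * M - n)) = c - ((M : ℤ) - n) := by ring
      have e6 : c - ((M : ℤ) - (2 * M - n)) = c + ((M : ℤ) - n) := by ring
      rw [e5, e6, ← mul_add, h1, e3]
      linear_combination (2 * (-1) ^ M * (g c c).eval (-1)) * e4
    have h2 : 2 * ∑ n ∈ Finset.range (2 * M + 1), f n =
        (2 * M + 1 : ℕ) * (2 * (-1) ^ M * (g c c).eval (-1)) := by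
      have hr := Finset.sum_range_reflect f (2 * M + 1)
      rw [two_mul]
      nth_rewrite 2 [← hr]
      rw [← Finset.sum_add_distrib, Finset.sum_congr rfl hpair, Finset.sum_const, Finset.card_range,
        nsmul_eq_mul]
    rw [hS] at h
    have e1 : c + ((M + 1 : ℕ) : ℤ) - 1 - ((2 * M + 1 : ℕ) : ℤ) = c - (M + 1 : ℕ) := by
      push_cast; ring
    rw [e1] at h
    have hne : ((2 * M + 1 : ℕ) : ℚ) ≠ 0 := by positivity
    apply mul_left_cancel₀ hne
    rw [zpow_natCast, pow_succ]
    linear_combination h - h2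

end Exchange

/-! ### Power series in `t` with Laurent polynomial coefficients -/

/-- The ring `ℚ[x_0^±1, …, x_{n-1}^±1][[t]]`. It contains the inverses of all the elements
`1 - t x_i / x_j`, and the variables may be permuted and inverted in it. -/
abbrev LaurentSer (n : ℕ) : Type := PowerSeries (AddMonoidAlgebra ℚ (Fin n → ℤ))

/-- The monomial `x ^ α`. -/
def mon {n : ℕ} (α : Fin n → ℤ) : LaurentSer n := PowerSeries.C (AddMonoidAlgebra.single α 1)

/-- The variable `t`. -/
def tSer (n : ℕ) : LaurentSer n := PowerSeries.X

/-- A power series in `t`, as a constant in the variables `x_i`. -/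
def constSer (n : ℕ) : PowerSeries ℚ →+* LaurentSer n :=
  PowerSeries.map (algebraMap ℚ (AddMonoidAlgebra ℚ (Fin n → ℤ)))

/-- The coefficient of `x ^ α`, which is a power series in `t`. -/
def coeffAt {n : ℕ} (α : Fin n → ℤ) : LaurentSer n →+ PowerSeries ℚ where
  toFun g := PowerSeries.mk fun d => (PowerSeries.coeff d g).coeff α
  map_zero' := by ext; simp
  map_add' g h := by ext; simp

/-- The geometric series `(1 - t x ^ γ)⁻¹`. -/
def geom {n : ℕ} (γ : Fin n → ℤ) : LaurentSer n :=
  PowerSeries.mk fun d => AddMonoidAlgebra.single (d • γ) 1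

/-- The substitution of monomials for the variables given by an automorphism of the lattice of
exponents. -/
def substAut {n : ℕ} (e : (Fin n → ℤ) ≃+ (Fin n → ℤ)) : LaurentSer n →+* LaurentSer n :=
  PowerSeries.map (AddMonoidAlgebra.mapDomainRingHom ℚ e.toAddMonoidHom)

section

variable {n : ℕ}

theorem coeff_coeffAt (d : ℕ) (α : Fin n → ℤ) (g : LaurentSer n) :
    PowerSeries.coeff d (coeffAt α g) = (PowerSeries.coeff d g).coeff α := by
  simp [coeffAt]

theorem LaurentSer.ext {g h : LaurentSer n} (H : ∀ α, coeffAt α g = coeffAt α h) : g = h := by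
  ext d α
  rw [← coeff_coeffAt, H, coeff_coeffAt]

theorem mon_zero : mon (0 : Fin n → ℤ) = 1 := by
  rw [mon, ← AddMonoidAlgebra.one_def, map_one]

theorem mon_mul_mon (α β : Fin n → ℤ) : mon α * mon β = mon (α + β) := by
  rw [mon, mon, mon, ← map_mul, AddMonoidAlgebra.single_mul_single, one_mul]

theorem mon_pow (α : Fin n → ℤ) (k : ℕ) : mon α ^ k = mon (k • α) := by
  rw [mon, mon, ← map_pow, AddMonoidAlgebra.single_pow, one_pow]

theorem prod_mon {ι : Type*} (s : Finset ι) (f : ι → Fin n → ℤ) :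
    ∏ i ∈ s, mon (f i) = mon (∑ i ∈ s, f i) := by
  classical
  induction s using Finset.induction_on with
  | empty => simp [mon_zero]
  | insert a s ha ih => rw [Finset.prod_insert ha, Finset.sum_insert ha, ih, mon_mul_mon]

theorem coeffAt_mon_mul (α β : Fin n → ℤ) (g : LaurentSer n) :
    coeffAt α (mon β * g) = coeffAt (α - β) g := by
  ext d
  rw [coeff_coeffAt, coeff_coeffAt, mon, PowerSeries.coeff_C_mul,
    AddMonoidAlgebra.coeff_single_mul_apply, one_mul, neg_add_eq_sub]

theorem coeffAt_one (α : Fin n → ℤ) : coeffAt α 1 = if α = 0 then 1 else 0 := by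
  ext d
  rw [coeff_coeffAt, PowerSeries.coeff_one]
  by_cases hd : d = 0 <;> by_cases hα : α = 0 <;>
    simp [hd, hα, AddMonoidAlgebra.one_def, PowerSeries.coeff_one]

theorem coeffAt_constSer_mul (α : Fin n → ℤ) (p : PowerSeries ℚ) (g : LaurentSer n) :
    coeffAt α (constSer n p * g) = p * coeffAt α g := by
  ext d
  rw [coeff_coeffAt, PowerSeries.coeff_mul, PowerSeries.coeff_mul, AddMonoidAlgebra.coeff_sum,
    Finset.sum_apply']
  refine Finset.sum_congr rfl fun x _ => ?_
  rw [constSer, PowerSeries.coeff_map, coeff_coeffAt, ← Algebra.smul_def]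
  simp

theorem constSer_X : constSer n PowerSeries.X = tSer n := by
  simp [constSer, tSer]

theorem coeffAt_tSer_mul (α : Fin n → ℤ) (g : LaurentSer n) :
    coeffAt α (tSer n * g) = PowerSeries.X * coeffAt α g := by
  rw [← constSer_X, coeffAt_constSer_mul]

theorem one_sub_mul_geom (γ : Fin n → ℤ) : (1 - tSer n * mon γ) * geom γ = 1 := by
  rw [sub_mul, one_mul, sub_eq_iff_eq_add]
  ext1 d
  rw [tSer, mul_assoc, map_add]
  rcases d with _ | d
  · simp [geom, AddMonoidAlgebra.one_def]
  · rw [PowerSeries.coeff_succ_X_mul, mon, PowerSeries.coeff_C_mul, geom, PowerSeries.coeff_mk,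
      PowerSeries.coeff_mk, AddMonoidAlgebra.single_mul_single, PowerSeries.coeff_one,
      if_neg (Nat.succ_ne_zero d), zero_add, one_mul, succ_nsmul']

theorem substAut_mon (e : (Fin n → ℤ) ≃+ (Fin n → ℤ)) (α : Fin n → ℤ) :
    substAut e (mon α) = mon (e α) := by
  simp [substAut, mon]

theorem substAut_tSer (e : (Fin n → ℤ) ≃+ (Fin n → ℤ)) : substAut e (tSer n) = tSer n := by
  simp [substAut, tSer]

theorem substAut_geom (e : (Fin n → ℤ) ≃+ (Fin n → ℤ)) (γ : Fin n → ℤ) :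
    substAut e (geom γ) = geom (e γ) := by
  ext1 d
  simp [substAut, geom, -nsmul_eq_mul, map_nsmul]

theorem coeffAt_substAut (e : (Fin n → ℤ) ≃+ (Fin n → ℤ)) (α : Fin n → ℤ) (g : LaurentSer n) :
    coeffAt (e α) (substAut e g) = coeffAt α g := by
  ext d
  rw [coeff_coeffAt, coeff_coeffAt, substAut, PowerSeries.coeff_map]
  exact Finsupp.mapDomain_apply e.injective _ _

theorem substAut_comp (e f : (Fin n → ℤ) ≃+ (Fin n → ℤ)) (g : LaurentSer n) :
    substAut e (substAut f g) = substAut (f.trans e) g := by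
  apply LaurentSer.ext
  intro α
  obtain ⟨β, rfl⟩ := e.surjective α
  obtain ⟨δ, rfl⟩ := f.surjective β
  rw [coeffAt_substAut, coeffAt_substAut]
  exact (coeffAt_substAut (f.trans e) δ g).symm

/-- The elements all of whose terms `t ^ d x ^ α` have `(d, α)` in a given monoid. -/
def supportedIn (M : AddSubmonoid (ℕ × (Fin n → ℤ))) : Subring (LaurentSer n) where
  carrier := {g | ∀ d α, (PowerSeries.coeff d g).coeff α ≠ 0 → (d, α) ∈ M}
  zero_mem' := by intro d α h; simp at h
  one_mem' := by
    intro d α h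
    rw [← coeff_coeffAt, coeffAt_one] at h
    split_ifs at h with hα
    · rw [PowerSeries.coeff_one] at h
      have hd : d = 0 := by by_contra hd; simp [hd] at h
      rw [hα, hd]
      exact M.zero_mem
    · simp at h
  add_mem' := by
    intro g h hg hh d α hne
    rw [map_add, AddMonoidAlgebra.coeff_add, Finsupp.add_apply] at hne
    by_cases h1 : (PowerSeries.coeff d g).coeff α = 0
    · exact hh d α (by simpa [h1] using hne)
    · exact hg d α h1
  neg_mem' := by
    intro g hg d α hne
    exact hg d α (by simpa using hne)
  mul_mem' := by
    intro g h hg hh d α hne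
    rw [PowerSeries.coeff_mul, AddMonoidAlgebra.coeff_sum, Finset.sum_apply'] at hne
    obtain ⟨p, hp, hne⟩ := Finset.exists_ne_zero_of_sum_ne_zero hne
    rw [Finset.HasAntidiagonal.mem_antidiagonal] at hp
    classical
    rw [AddMonoidAlgebra.coeff_mul] at hne
    obtain ⟨β, hβ, hne⟩ := Finset.exists_ne_zero_of_sum_ne_zero hne
    obtain ⟨γ, hγ, hne⟩ := Finset.exists_ne_zero_of_sum_ne_zero hne
    have hα : β + γ = α := by
      by_contra hcon
      simp [hcon] at hne
    rw [← hp, ← hα]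
    exact M.add_mem (hg _ _ (Finsupp.mem_support_iff.1 hβ)) (hh _ _ (Finsupp.mem_support_iff.1 hγ))

theorem coeffAt_eq_zero_of_supportedIn {M : AddSubmonoid (ℕ × (Fin n → ℤ))} {g : LaurentSer n}
    (hg : g ∈ supportedIn M) {α : Fin n → ℤ} (h : ∀ d, (d, α) ∉ M) : coeffAt α g = 0 := by
  ext d
  rw [coeff_coeffAt]
  by_contra hne
  exact h d (hg d α hne)

theorem mon_mem_supportedIn {M : AddSubmonoid (ℕ × (Fin n → ℤ))} {γ : Fin n → ℤ}
    (h : (0, γ) ∈ M) : mon γ ∈ supportedIn M := by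
  intro d α hne
  rw [mon, PowerSeries.coeff_C] at hne
  split_ifs at hne with hd
  · rw [AddMonoidAlgebra.coeff_single, Finsupp.single_apply] at hne
    split_ifs at hne with hα
    · rwa [← hα, hd]
    · simp at hne
  · simp at hne

theorem geom_mem_supportedIn {M : AddSubmonoid (ℕ × (Fin n → ℤ))} {γ : Fin n → ℤ}
    (h : (1, γ) ∈ M) : geom γ ∈ supportedIn M := by
  intro d α hne
  rw [geom, PowerSeries.coeff_mk, AddMonoidAlgebra.coeff_single, Finsupp.single_apply] at hne
  split_ifs at hne with hα
  · have := M.nsmul_mem h d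
    rw [← hα]
    simpa using this
  · simp at hne

theorem tSer_mul_mon_mem_supportedIn {M : AddSubmonoid (ℕ × (Fin n → ℤ))} {γ : Fin n → ℤ}
    (h : (1, γ) ∈ M) : tSer n * mon γ ∈ supportedIn M := by
  intro d α hne
  rcases d with _ | d
  · simp [tSer] at hne
  · rw [tSer, PowerSeries.coeff_succ_X_mul, mon, PowerSeries.coeff_C] at hne
    split_ifs at hne with hd
    · rw [AddMonoidAlgebra.coeff_single, Finsupp.single_apply] at hne
      split_ifs at hne with hα
      · rwa [← hα, hd]
      · simp at hne
    · simp at hne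

end

/-! ### Alternants and their orthogonality -/

section

variable {n : ℕ}

/-- The exponent of the variable `x_i`. -/
def expo (i : Fin n) : Fin n → ℤ := Pi.single i 1

/-- The exponent of `x_j / x_i`. -/
def root (i j : Fin n) : Fin n → ℤ := expo j - expo i

/-- The pairs `i < j`. -/
def ltPairs (n : ℕ) : Finset (Fin n × Fin n) := Finset.univ.filter fun p => p.1 < p.2

/-- The action of a permutation of the variables on exponents. -/
def permExp (w : Equiv.Perm (Fin n)) : (Fin n → ℤ) ≃+ (Fin n → ℤ) where
  toFun α := fun i => α (w.symm i)
  invFun α := fun i => α (w i)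
  left_inv α := by ext; simp
  right_inv α := by ext; simp
  map_add' α β := rfl

/-- The permutation `x_i ↦ x_{w i}` of the variables. -/
def permVar (w : Equiv.Perm (Fin n)) : LaurentSer n →+* LaurentSer n := substAut (permExp w)

/-- The substitution `x_i ↦ x_i⁻¹`. -/
def invVar : LaurentSer n →+* LaurentSer n := substAut (AddEquiv.neg (Fin n → ℤ))

/-- The product of the `x_i - x_j`, `i < j`. -/
def vand (n : ℕ) : LaurentSer n := ∏ p ∈ ltPairs n, (mon (expo p.1) - mon (expo p.2))

/-- The product of the `x_i - t x_j`, `i < j`. -/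
def tVand (n : ℕ) : LaurentSer n := ∏ p ∈ ltPairs n, (mon (expo p.1) - tSer n * mon (expo p.2))

/-- The exponent `(n - 1, …, 1, 0)`. -/
def rho (n : ℕ) : Fin n → ℤ := ∑ p ∈ ltPairs n, expo p.1

/-- The product of the `(1 - t x_j / x_i)⁻¹`, `i < j`. -/
def geomPos (n : ℕ) : LaurentSer n := ∏ p ∈ ltPairs n, geom (root p.1 p.2)

/-- The product of the `(1 - t x_i / x_j)⁻¹`, `i < j`. -/
def geomNeg (n : ℕ) : LaurentSer n := ∏ p ∈ ltPairs n, geom (root p.2 p.1)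

/-- The sign of a permutation, as an element of the ring. -/
def sgn (w : Equiv.Perm (Fin n)) : LaurentSer n := ((Equiv.Perm.sign w : ℤ) : LaurentSer n)

/-- The Hall-Littlewood alternant, the numerator of the Hall-Littlewood polynomial of `μ`. -/
def alternant (μ : Fin n → ℤ) : LaurentSer n :=
  ∑ w : Equiv.Perm (Fin n), sgn w * permVar w (mon μ * tVand n)

/-- The coefficient functional which picks out of an alternating element the coordinate with respect
to the alternant of `μ` (up to normalization). -/
def altCoeff (μ : Fin n → ℤ) (F : LaurentSer n) : PowerSeries ℚ :=
  coeffAt (μ + rho n) (F * geomPos n)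

/-- Alternating elements. -/
def IsAlternating (F : LaurentSer n) : Prop := ∀ w, permVar w F = sgn w * F

theorem permExp_apply (w : Equiv.Perm (Fin n)) (α : Fin n → ℤ) (i : Fin n) :
    permExp w α i = α (w.symm i) := rfl

theorem permExp_expo (w : Equiv.Perm (Fin n)) (i : Fin n) : permExp w (expo i) = expo (w i) := by
  ext j
  simp only [permExp_apply, expo, Pi.single_apply, Equiv.symm_apply_eq]

theorem permExp_root (w : Equiv.Perm (Fin n)) (i j : Fin n) :
    permExp w (root i j) = root (w i) (w j) := by
  rw [root, map_sub, permExp_expo, permExp_expo, root]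

theorem permVar_mul (v w : Equiv.Perm (Fin n)) (F : LaurentSer n) :
    permVar v (permVar w F) = permVar (v * w) F := by
  rw [permVar, permVar, substAut_comp]
  rfl

theorem sgn_mul (v w : Equiv.Perm (Fin n)) : sgn (v * w) = sgn v * sgn w := by
  simp [sgn]

theorem sgn_mul_self (w : Equiv.Perm (Fin n)) : sgn w * sgn w = 1 := by
  rw [sgn, ← Int.cast_mul, ← Units.val_mul, Int.units_mul_self]
  simp

theorem permVar_sgn (v w : Equiv.Perm (Fin n)) : permVar v (sgn w) = sgn w := by
  rw [sgn, map_intCast]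

theorem permVar_invVar (w : Equiv.Perm (Fin n)) (F : LaurentSer n) :
    permVar w (invVar F) = invVar (permVar w F) := by
  rw [permVar, invVar, substAut_comp, substAut_comp]
  rfl

theorem coeffAt_zero_permVar (w : Equiv.Perm (Fin n)) (F : LaurentSer n) :
    coeffAt 0 (permVar w F) = coeffAt 0 F := by
  rw [← map_zero (permExp w), permVar, coeffAt_substAut, map_zero]

theorem coeffAt_invVar (α : Fin n → ℤ) (F : LaurentSer n) :
    coeffAt α (invVar F) = coeffAt (-α) F := by
  have := coeffAt_substAut (AddEquiv.neg (Fin n → ℤ)) (-α) F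
  rwa [AddEquiv.neg_apply, neg_neg] at this

theorem invVar_invVar (F : LaurentSer n) : invVar (invVar F) = F := by
  apply LaurentSer.ext
  intro α
  rw [coeffAt_invVar, coeffAt_invVar, neg_neg]

theorem isAlternating_alternant (μ : Fin n → ℤ) : IsAlternating (alternant μ) := by
  intro v
  rw [alternant, map_sum, Finset.mul_sum]
  refine Fintype.sum_equiv (Equiv.mulLeft v) _ _ fun w => ?_
  rw [map_mul, permVar_sgn, permVar_mul, Equiv.coe_mulLeft, sgn_mul, ← mul_assoc, ← mul_assoc,
    sgn_mul_self, one_mul]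

theorem prod_ltPairs {R : Type*} [CommMonoid R] (f : Fin n → Fin n → R) :
    ∏ p ∈ ltPairs n, f p.1 p.2 = ∏ i, ∏ j ∈ Finset.Ioi i, f i j := by
  rw [ltPairs, Finset.prod_filter, Fintype.prod_prod_type]
  refine Finset.prod_congr rfl fun i _ => ?_
  rw [← Finset.prod_filter]
  congr 1
  ext j
  simp

theorem prod_ltPairs_comp (w : Equiv.Perm (Fin n)) (f : Fin n → Fin n → LaurentSer n)
    (hf : ∀ i j, f i j = -f j i) :
    ∏ p ∈ ltPairs n, f (w p.1) (w p.2) = sgn w * ∏ p ∈ ltPairs n, f p.1 p.2 := by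
  rw [prod_ltPairs (fun i j => f (w i) (w j)), prod_ltPairs f, w.prod_Ioi_comp_eq_sign_mul_prod hf]
  rfl

theorem isAlternating_vand : IsAlternating (vand n) := by
  intro w
  rw [vand, map_prod, ← prod_ltPairs_comp w (fun i j => mon (expo i) - mon (expo j))
    (fun i j => by ring)]
  refine Finset.prod_congr rfl fun p _ => ?_
  rw [map_sub, permVar, substAut_mon, substAut_mon, permExp_expo, permExp_expo]

theorem geomPos_mul_geomNeg : geomPos n * geomNeg n =
    ∏ p ∈ Finset.univ.filter (fun p : Fin n × Fin n => p.1 ≠ p.2), geom (root p.1 p.2) := by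
  have h1 : Finset.univ.filter (fun p : Fin n × Fin n => p.1 ≠ p.2) =
      ltPairs n ∪ Finset.univ.filter (fun p : Fin n × Fin n => p.2 < p.1) := by
    ext p
    simp only [ltPairs, Finset.mem_filter, Finset.mem_union, Finset.mem_univ, true_and]
    exact ne_iff_lt_or_gt
  have h2 : Disjoint (ltPairs n) (Finset.univ.filter (fun p : Fin n × Fin n => p.2 < p.1)) := by
    rw [Finset.disjoint_left]
    intro p hp hp'
    simp only [ltPairs, Finset.mem_filter, Finset.mem_univ, true_and] at hp hp'
    exact lt_asymm hp hp'
  rw [h1, Finset.prod_union h2, geomPos, geomNeg]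
  congr 1
  refine Finset.prod_bij' (fun p _ => p.swap) (fun p _ => p.swap) ?_ ?_ ?_ ?_ ?_ <;>
    simp [ltPairs]

theorem permVar_geomPos_mul_geomNeg (w : Equiv.Perm (Fin n)) :
    permVar w (geomPos n * geomNeg n) = geomPos n * geomNeg n := by
  rw [geomPos_mul_geomNeg, map_prod]
  refine Finset.prod_equiv (Equiv.prodCongr w w) (by simp) ?_
  intro p _
  rw [permVar, substAut_geom, permExp_root]
  rfl

theorem invVar_geomPos : invVar (geomPos n) = geomNeg n := by
  rw [geomPos, geomNeg, map_prod]
  refine Finset.prod_congr rfl fun p _ => ?_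
  rw [invVar, substAut_geom]
  simp [root]

theorem invVar_geomNeg : invVar (geomNeg n) = geomPos n := by
  rw [← invVar_geomPos, invVar_invVar]

theorem mon_expo_mul (i j : Fin n) : mon (expo i) * mon (root i j) = mon (expo j) := by
  rw [mon_mul_mon, root, add_sub_cancel]

theorem tVand_mul_geomPos : tVand n * geomPos n = mon (rho n) := by
  rw [tVand, geomPos, ← Finset.prod_mul_distrib, rho, ← prod_mon]
  refine Finset.prod_congr rfl fun p _ => ?_
  rw [← mon_expo_mul p.1 p.2]
  linear_combination mon (expo p.1) * one_sub_mul_geom (root p.1 p.2)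

/-- The constant term of `F(x) G(x⁻¹) ∏_{i ≠ j} (1 - t x_i / x_j)⁻¹` is a symmetric bilinear form, for
which pairing with an alternant is a coefficient extraction. -/
theorem pairing_alternant (μ : Fin n → ℤ) {G : LaurentSer n} (hG : IsAlternating G) :
    coeffAt 0 (alternant μ * invVar G * (geomPos n * geomNeg n)) =
      (n.factorial : PowerSeries ℚ) * altCoeff μ G := by
  have key : ∀ w : Equiv.Perm (Fin n),
      sgn w * permVar w (mon μ * tVand n) * invVar G * (geomPos n * geomNeg n) =
        permVar w (mon μ * tVand n * invVar G * (geomPos n * geomNeg n)) := by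
    intro w
    have h0 : invVar (sgn w) = sgn w := by rw [sgn, map_intCast]
    rw [map_mul (permVar w) _ (geomPos n * geomNeg n), map_mul (permVar w) _ (invVar G),
      permVar_geomPos_mul_geomNeg, permVar_invVar, hG w, map_mul invVar, h0]
    ring
  rw [alternant, Finset.sum_mul, Finset.sum_mul, map_sum]
  simp only [key, coeffAt_zero_permVar]
  rw [Finset.sum_const, Finset.card_univ, Fintype.card_perm, Fintype.card_fin, nsmul_eq_mul]
  congr 1
  have h1 : mon μ * tVand n * invVar G * (geomPos n * geomNeg n) =
      mon (μ + rho n) * invVar (G * geomPos n) := by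
    rw [map_mul, invVar_geomPos, ← mon_mul_mon, ← tVand_mul_geomPos]
    ring
  rw [h1, coeffAt_mon_mul, coeffAt_invVar, altCoeff, zero_sub, neg_neg]

/-- The pairing is symmetric because the constant term is invariant under `x_i ↦ x_i⁻¹`. -/
theorem altCoeff_alternant_comm (μ ν : Fin n → ℤ) :
    altCoeff μ (alternant ν) = altCoeff ν (alternant μ) := by
  have h1 := pairing_alternant μ (isAlternating_alternant ν)
  have h2 := pairing_alternant ν (isAlternating_alternant μ)
  have h3 : invVar (alternant ν * invVar (alternant μ) * (geomPos n * geomNeg n)) =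
      alternant μ * invVar (alternant ν) * (geomPos n * geomNeg n) := by
    rw [map_mul invVar, map_mul invVar, map_mul invVar, invVar_invVar, invVar_geomPos,
      invVar_geomNeg, mul_comm (geomNeg n), mul_comm (invVar (alternant ν))]
  have h4 := coeffAt_invVar 0 (alternant ν * invVar (alternant μ) * (geomPos n * geomNeg n))
  rw [neg_zero, h3, h1, h2] at h4
  have hne : (n.factorial : PowerSeries ℚ) ≠ 0 := by
    rw [← map_natCast (PowerSeries.C (R := ℚ)), map_ne_zero_iff _ PowerSeries.C_injective]
    exact Nat.cast_ne_zero.2 n.factorial_ne_zero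
  exact mul_left_cancel₀ hne h4

/-- The factor which a pair `i < j` contributes to the term of `w`. -/
def pairFactor (w : Equiv.Perm (Fin n)) (p : Fin n × Fin n) : LaurentSer n :=
  if w.symm p.1 < w.symm p.2 then 1
  else (tSer n - mon (root p.1 p.2)) * geom (root p.1 p.2)

/-- After division by `∏ (x_i - t x_j)`, the term of `w` in `alternant μ` is `x ^ (w μ)` times a series
in the `x_j / x_i`, `i < j`. -/
theorem permVar_mul_geomPos (w : Equiv.Perm (Fin n)) (μ : Fin n → ℤ) :
    sgn w * permVar w (mon μ * tVand n) * geomPos n =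
      mon (permExp w μ + rho n) * ∏ p ∈ ltPairs n, pairFactor w p := by
  set f : Fin n → Fin n → LaurentSer n := fun a b =>
    if a = b then 0 else if w.symm a < w.symm b then mon (expo a) - tSer n * mon (expo b)
    else -(mon (expo b) - tSer n * mon (expo a)) with hf
  have hanti : ∀ a b, f a b = -f b a := by
    intro a b
    simp only [hf]
    rcases eq_or_ne a b with rfl | hab
    · simp
    · rw [if_neg hab, if_neg hab.symm]
      have hne : w.symm a ≠ w.symm b := fun h => hab (w.symm.injective h)
      rcases lt_or_gt_of_ne hne with h | h
      · rw [if_pos h, if_neg (lt_asymm h), neg_neg]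
      · rw [if_neg (lt_asymm h), if_pos h]
  have h1 : permVar w (tVand n) = sgn w * ∏ p ∈ ltPairs n, f p.1 p.2 := by
    rw [← prod_ltPairs_comp w f hanti, tVand, map_prod]
    refine Finset.prod_congr rfl fun p hp => ?_
    simp only [ltPairs, Finset.mem_filter, Finset.mem_univ, true_and] at hp
    simp only [hf, Equiv.symm_apply_apply, if_pos hp, w.injective.eq_iff, if_neg hp.ne]
    rw [map_sub, map_mul, permVar, substAut_mon, substAut_mon, substAut_tSer, permExp_expo,
      permExp_expo]
  have h2 : (∏ p ∈ ltPairs n, f p.1 p.2) * geomPos n =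
      mon (rho n) * ∏ p ∈ ltPairs n, pairFactor w p := by
    rw [geomPos, ← Finset.prod_mul_distrib, rho, ← prod_mon, ← Finset.prod_mul_distrib]
    refine Finset.prod_congr rfl fun p hp => ?_
    simp only [ltPairs, Finset.mem_filter, Finset.mem_univ, true_and] at hp
    simp only [hf, if_neg hp.ne, pairFactor]
    rw [← mon_expo_mul p.1 p.2]
    split_ifs
    · linear_combination mon (expo p.1) * one_sub_mul_geom (root p.1 p.2)
    · ring
  have h3 : permVar w (mon μ) = mon (permExp w μ) := substAut_mon _ _
  rw [map_mul, h3, h1, ← mon_mul_mon]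
  linear_combination mon (permExp w μ) * (∏ p ∈ ltPairs n, f p.1 p.2) * geomPos n * sgn_mul_self w +
    mon (permExp w μ) * h2

theorem altCoeff_alternant (μ ν : Fin n → ℤ) :
    altCoeff μ (alternant ν) = ∑ w : Equiv.Perm (Fin n),
      coeffAt (μ - permExp w ν) (∏ p ∈ ltPairs n, pairFactor w p) := by
  rw [altCoeff, alternant, Finset.sum_mul, map_sum]
  refine Finset.sum_congr rfl fun w _ => ?_
  rw [permVar_mul_geomPos, coeffAt_mon_mul, add_sub_add_right_eq_sub]

/-- The linear functional `α ↦ -∑ i * α_i` on exponents; it is negative on `x_j / x_i` for `i < j`. -/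
def level : (Fin n → ℤ) →+ ℤ where
  toFun α := ∑ i : Fin n, -(i : ℤ) * α i
  map_zero' := by simp
  map_add' α β := by simp [mul_add, Finset.sum_add_distrib]

theorem level_expo (i : Fin n) : level (expo i) = -(i : ℤ) := by
  simp [level, expo, Pi.single_apply]

theorem level_root (i j : Fin n) : level (root i j) = (i : ℤ) - j := by
  rw [root, map_sub, level_expo, level_expo]
  ring

/-- The exponents which are zero or of negative level. -/
def negLevel (n : ℕ) : AddSubmonoid (ℕ × (Fin n → ℤ)) where
  carrier := {p | level p.2 < 0 ∨ p.2 = 0}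
  zero_mem' := Or.inr rfl
  add_mem' := by
    rintro a b (ha | ha) (hb | hb)
    · left; rw [Prod.snd_add, map_add]; omega
    · left; rw [Prod.snd_add, hb, add_zero]; exact ha
    · left; rw [Prod.snd_add, ha, zero_add]; exact hb
    · right; rw [Prod.snd_add, ha, hb, add_zero]

theorem mem_negLevel {d : ℕ} {α : Fin n → ℤ} : (d, α) ∈ negLevel n ↔ level α < 0 ∨ α = 0 := Iff.rfl

theorem root_mem_negLevel {d : ℕ} {i j : Fin n} (h : i < j) : (d, root i j) ∈ negLevel n := by
  rw [mem_negLevel, level_root]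
  left
  have : (i : ℕ) < j := h
  omega

theorem tSer_mem_negLevel : tSer n ∈ supportedIn (negLevel n) := by
  have := tSer_mul_mon_mem_supportedIn (M := negLevel n) (γ := 0) (Or.inr rfl)
  rwa [mon_zero, mul_one] at this

theorem pairFactor_mem (w : Equiv.Perm (Fin n)) {p : Fin n × Fin n} (hp : p ∈ ltPairs n) :
    pairFactor w p ∈ supportedIn (negLevel n) := by
  simp only [ltPairs, Finset.mem_filter, Finset.mem_univ, true_and] at hp
  rw [pairFactor]
  split_ifs
  · exact one_mem _
  · exact mul_mem (sub_mem tSer_mem_negLevel (mon_mem_supportedIn (root_mem_negLevel hp)))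
      (geom_mem_supportedIn (root_mem_negLevel hp))

theorem coeffAt_zero_mul {g h : LaurentSer n} (hg : g ∈ supportedIn (negLevel n))
    (hh : h ∈ supportedIn (negLevel n)) : coeffAt 0 (g * h) = coeffAt 0 g * coeffAt 0 h := by
  ext d
  rw [coeff_coeffAt, PowerSeries.coeff_mul, PowerSeries.coeff_mul, AddMonoidAlgebra.coeff_sum,
    Finset.sum_apply']
  refine Finset.sum_congr rfl fun x _ => ?_
  rw [coeff_coeffAt, coeff_coeffAt]
  classical
  rw [AddMonoidAlgebra.coeff_mul]
  have hne : ∀ β γ : Fin n → ℤ, (PowerSeries.coeff x.1 g).coeff β ≠ 0 →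
      (PowerSeries.coeff x.2 h).coeff γ ≠ 0 → β + γ = 0 → β = 0 ∧ γ = 0 := by
    intro β γ hβ hγ h0
    have h1 := mem_negLevel.1 (hg _ _ hβ)
    have h2 := mem_negLevel.1 (hh _ _ hγ)
    have h3 := congrArg level h0
    rw [map_add, map_zero] at h3
    rcases h1 with h1 | rfl
    · rcases h2 with h2 | rfl
      · omega
      · rw [map_zero] at h3; omega
    · exact ⟨rfl, by simpa using h0⟩
  rw [Finsupp.sum, Finset.sum_eq_single 0]
  · rw [Finsupp.sum, Finset.sum_eq_single 0]
    · simp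
    · intro γ _ hγ0
      rw [if_neg]
      simpa using hγ0
    · intro h0
      rw [Finsupp.notMem_support_iff.1 h0]
      simp
  · intro β hβ hβ0
    rw [Finsupp.sum]
    refine Finset.sum_eq_zero fun γ hγ => ?_
    rw [if_neg]
    intro h0
    exact hβ0 (hne β γ (Finsupp.mem_support_iff.1 hβ) (Finsupp.mem_support_iff.1 hγ) h0).1
  · intro h0
    rw [Finsupp.notMem_support_iff.1 h0]
    simp [Finsupp.sum]

theorem coeffAt_zero_pairFactor (w : Equiv.Perm (Fin n)) {p : Fin n × Fin n} (hp : p ∈ ltPairs n) :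
    coeffAt 0 (pairFactor w p) = if w.symm p.1 < w.symm p.2 then 1 else PowerSeries.X := by
  rw [pairFactor]
  simp only [ltPairs, Finset.mem_filter, Finset.mem_univ, true_and] at hp
  split_ifs
  · rw [coeffAt_one, if_pos rfl]
  · have hmon := mon_mem_supportedIn (root_mem_negLevel (d := 0) hp)
    have hgeom := geom_mem_supportedIn (root_mem_negLevel (d := 1) hp)
    have h0 : coeffAt 0 (mon (root p.1 p.2)) = 0 := by
      rw [← mul_one (mon _), coeffAt_mon_mul, coeffAt_one, if_neg]
      intro h
      have := congrArg level h
      rw [map_sub, map_zero, level_root] at this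
      have : (p.1 : ℕ) < p.2 := hp
      omega
    have h1 := congrArg (coeffAt 0) (one_sub_mul_geom (root p.1 p.2))
    rw [coeffAt_zero_mul (sub_mem (one_mem _) (mul_mem tSer_mem_negLevel hmon)) hgeom, map_sub,
      coeffAt_tSer_mul, h0, mul_zero, sub_zero, coeffAt_one, if_pos rfl, one_mul] at h1
    rw [coeffAt_zero_mul (sub_mem tSer_mem_negLevel hmon) hgeom, h1, map_sub, h0,
      ← mul_one (tSer n), coeffAt_tSer_mul, coeffAt_one, if_pos rfl]
    ring

theorem coeffAt_zero_prod_pairFactor (w : Equiv.Perm (Fin n)) :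
    coeffAt 0 (∏ p ∈ ltPairs n, pairFactor w p) =
      PowerSeries.X ^ ((ltPairs n).filter fun p => ¬ w.symm p.1 < w.symm p.2).card := by
  have h : ∀ s ⊆ ltPairs n, coeffAt 0 (∏ p ∈ s, pairFactor w p) =
      ∏ p ∈ s, if w.symm p.1 < w.symm p.2 then 1 else PowerSeries.X := by
    intro s
    induction s using Finset.induction_on with
    | empty => intro _; simp [coeffAt_one]
    | insert a s ha ih =>
      intro hs
      rw [Finset.prod_insert ha, Finset.prod_insert ha, coeffAt_zero_mul
        (pairFactor_mem w (hs (Finset.mem_insert_self _ _)))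
        (prod_mem fun p hp => pairFactor_mem w (hs (Finset.mem_insert_of_mem hp))),
        coeffAt_zero_pairFactor w (hs (Finset.mem_insert_self _ _)),
        ih (fun p hp => hs (Finset.mem_insert_of_mem hp))]
  rw [h _ subset_rfl, Finset.prod_ite, Finset.prod_const_one, one_mul, Finset.prod_const]

/-- The rearrangement inequality. -/
theorem level_permExp_le {μ : Fin n → ℤ} (hμ : Antitone μ) (w : Equiv.Perm (Fin n)) :
    level (permExp w μ) ≤ level μ ∧ (level (permExp w μ) = level μ → permExp w μ = μ) := by
  have hmono : Monovary (fun i : Fin n => -(i : ℤ)) μ := by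
    intro i j hij
    have : j < i := by
      by_contra hcon
      exact absurd (hμ (not_lt.1 hcon)) (not_le.2 hij)
    have : (j : ℕ) < i := this
    simp only
    omega
  refine ⟨hmono.sum_mul_comp_perm_le_sum_mul (σ := w.symm), fun heq => ?_⟩
  have h1 : Monovary (fun i : Fin n => -(i : ℤ)) (μ ∘ w.symm) :=
    (hmono.sum_mul_comp_perm_eq_sum_mul_iff (σ := w.symm)).1 heq
  have h2 : Antitone (μ ∘ w.symm) := by
    intro i j hij
    by_contra hcon
    have h3 := h1 (not_le.1 hcon)
    have h4 : (i : ℕ) ≤ j := hij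
    simp only at h3
    have : i = j := by ext; omega
    rw [this] at hcon
    exact hcon le_rfl
  have h5 := Tuple.unique_monotone (f := fun i => -μ i) (σ := w.symm) (τ := 1)
    (fun i j hij => neg_le_neg (h2 hij)) (fun i j hij => neg_le_neg (hμ hij))
  ext i
  have := congrFun h5 i
  simp only [Function.comp, Equiv.Perm.one_apply, neg_inj] at this
  exact this

/-- By `altCoeff_alternant`, a nonzero value forces `level μ ≤ level ν`, with equality only if `μ = ν`;
by symmetry the opposite inequality holds too. -/
theorem eq_of_altCoeff_alternant_ne_zero {μ ν : Fin n → ℤ} (hμ : Antitone μ) (hν : Antitone ν)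
    (h : altCoeff μ (alternant ν) ≠ 0) : μ = ν := by
  have key : ∀ {μ ν : Fin n → ℤ}, Antitone ν → altCoeff μ (alternant ν) ≠ 0 →
      level μ ≤ level ν ∧ (level μ = level ν → μ = ν) := by
    intro μ ν hν h
    rw [altCoeff_alternant] at h
    obtain ⟨w, -, hw⟩ := Finset.exists_ne_zero_of_sum_ne_zero h
    have h1 := level_permExp_le hν w
    have h2 : level (μ - permExp w ν) < 0 ∨ μ - permExp w ν = 0 := by
      by_contra hcon
      refine hw (coeffAt_eq_zero_of_supportedIn
        (prod_mem fun p hp => pairFactor_mem w hp) fun d hd => hcon (mem_negLevel.1 hd))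
    rw [map_sub, sub_eq_zero] at h2
    rcases h2 with h2 | h2
    · exact ⟨by omega, fun h3 => by omega⟩
    · rw [h2]
      exact h1
  have h1 := key hν h
  have h2 := key hμ (altCoeff_alternant_comm μ ν ▸ h)
  exact h1.2 (le_antisymm h1.1 h2.1)

theorem altCoeff_alternant_self {μ : Fin n → ℤ} (hμ : Antitone μ) :
    altCoeff μ (alternant μ) = ∑ w ∈ Finset.univ.filter (fun w : Equiv.Perm (Fin n) => μ ∘ w = μ),
      PowerSeries.X ^ ((ltPairs n).filter fun p => ¬ w p.1 < w p.2).card := by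
  rw [altCoeff_alternant, Finset.sum_filter]
  refine Fintype.sum_equiv (Equiv.inv _) _ _ fun w => ?_
  have he : μ ∘ (w⁻¹ : Equiv.Perm (Fin n)) = permExp w μ := rfl
  simp only [Equiv.inv_apply, he]
  split_ifs with h
  · rw [h, sub_self, coeffAt_zero_prod_pairFactor]
    rfl
  · apply coeffAt_eq_zero_of_supportedIn (prod_mem fun p hp => pairFactor_mem w hp)
    intro d hd
    rw [mem_negLevel, map_sub, sub_eq_zero] at hd
    have h1 := level_permExp_le hμ w
    rcases hd with hd | hd
    · omega
    · exact h hd.symm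

end

/-! ### The Poincaré polynomial of the stabilizer of a weakly decreasing sequence -/

section

variable {n : ℕ}

/-- The number of inversions of `w`. -/
def invCount (w : Equiv.Perm (Fin n)) : ℕ := ((ltPairs n).filter fun p => ¬ w p.1 < w p.2).card

/-- The product of `1 + t + ⋯ + t ^ i` over `i < m`. -/
def tFactorial {R : Type*} [CommRing R] (t : R) (m : ℕ) : R :=
  ∏ i ∈ Finset.range m, ∑ e ∈ Finset.range (i + 1), t ^ e

theorem invCount_eq_sum (w : Equiv.Perm (Fin n)) :
    invCount w = ∑ i, ∑ j, if i < j ∧ ¬ w i < w j then 1 else 0 := by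
  rw [invCount, ltPairs, Finset.filter_filter, Finset.card_filter, Fintype.sum_prod_type]

/-- The permutation with `0 ↦ k` whose other values are in the same relative order as those of `u`. -/
def insertFirst (k : Fin (n + 1)) (u : Equiv.Perm (Fin n)) : Equiv.Perm (Fin (n + 1)) :=
  k.cycleRange.symm * Equiv.Perm.decomposeFin.symm (0, u)

theorem insertFirst_zero (k : Fin (n + 1)) (u : Equiv.Perm (Fin n)) : insertFirst k u 0 = k := by
  simp [insertFirst, Equiv.Perm.decomposeFin_symm_apply_zero, Fin.cycleRange_symm_zero]

theorem insertFirst_succ (k : Fin (n + 1)) (u : Equiv.Perm (Fin n)) (i : Fin n) :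
    insertFirst k u i.succ = k.succAbove (u i) := by
  simp [insertFirst, Equiv.Perm.decomposeFin_symm_apply_succ, Fin.cycleRange_symm_succ]

theorem insertFirst_bijective :
    Function.Bijective fun p : Fin (n + 1) × Equiv.Perm (Fin n) => insertFirst p.1 p.2 := by
  rw [Fintype.bijective_iff_injective_and_card]
  constructor
  · rintro ⟨k, u⟩ ⟨k', u'⟩ h
    simp only at h
    have h0 : k = k' := by rw [← insertFirst_zero k u, h, insertFirst_zero]
    subst h0
    congr 1
    ext1 i
    have := congrArg (fun w : Equiv.Perm (Fin (n + 1)) => w i.succ) h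
    simp only [insertFirst_succ] at this
    exact Fin.succAbove_right_injective this
  · simp [Fintype.card_perm, Nat.factorial_succ]

theorem sum_fin_lt {m : ℕ} (k : ℕ) (hk : k ≤ m) : (∑ i : Fin m, if (i : ℕ) < k then 1 else 0) = k := by
  rw [← Finset.sum_range (fun i => if i < k then 1 else 0), Finset.sum_boole]
  have : (Finset.range m).filter (fun i => i < k) = Finset.range k := by
    ext i
    simp only [Finset.mem_filter, Finset.mem_range]
    omega
  rw [this]
  simp

theorem invCount_insertFirst (k : Fin (n + 1)) (u : Equiv.Perm (Fin n)) :
    invCount (insertFirst k u) = k + invCount u := by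
  rw [invCount_eq_sum, invCount_eq_sum, Fin.sum_univ_succ]
  congr 1
  · rw [Fin.sum_univ_succ]
    simp only [insertFirst_zero, insertFirst_succ, lt_irrefl, false_and, if_false, zero_add,
      Fin.succ_pos, true_and]
    rw [Equiv.sum_comp u (fun m => if ¬ k < k.succAbove m then 1 else 0),
      ← sum_fin_lt (k : ℕ) (Nat.le_of_lt_succ k.2)]
    refine Finset.sum_congr rfl fun m _ => ?_
    congr 1
    rw [Fin.lt_succAbove_iff_le_castSucc, not_le]
    rfl
  · refine Finset.sum_congr rfl fun i _ => ?_
    rw [Fin.sum_univ_succ]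
    simp only [insertFirst_succ, Fin.not_lt_zero, false_and, if_false, zero_add, Fin.succ_lt_succ_iff,
      Fin.succAbove_lt_succAbove_iff]

theorem comp_insertFirst_eq_iff {μ : Fin (n + 1) → ℤ} (hμ : Antitone μ) (k : Fin (n + 1))
    (u : Equiv.Perm (Fin n)) : μ ∘ insertFirst k u = μ ↔
      μ k = μ 0 ∧ (μ ∘ Fin.succ) ∘ u = μ ∘ Fin.succ := by
  have key : μ k = μ 0 → ∀ j, μ (k.succAbove j) = μ j.succ := by
    intro h j
    by_cases hj : j.castSucc < k
    · rw [Fin.succAbove_of_castSucc_lt _ _ hj]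
      have h1 : ∀ i, i ≤ k → μ i = μ 0 := fun i hi =>
        le_antisymm (hμ (Fin.zero_le i)) (h ▸ hμ hi)
      rw [h1 _ hj.le, h1 _ (Fin.castSucc_lt_iff_succ_le.1 hj)]
    · rw [Fin.succAbove_of_le_castSucc _ _ (not_lt.1 hj)]
  constructor
  · intro h
    have h0 : μ k = μ 0 := by
      have := congrFun h 0
      rwa [Function.comp_apply, insertFirst_zero] at this
    refine ⟨h0, ?_⟩
    ext i
    have := congrFun h i.succ
    rw [Function.comp_apply, insertFirst_succ, key h0] at this
    exact this
  · rintro ⟨h0, h1⟩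
    ext i
    refine Fin.cases ?_ (fun i => ?_) i
    · rw [Function.comp_apply, insertFirst_zero, h0]
    · rw [Function.comp_apply, insertFirst_succ, key h0]
      exact congrFun h1 i

theorem eq_range_card_of_isLowerSet {S : Finset ℕ} (h : ∀ x ∈ S, ∀ y ≤ x, y ∈ S) :
    S = Finset.range S.card := by
  apply Finset.eq_of_subset_of_card_le
  · intro x hx
    have : Finset.range (x + 1) ⊆ S := by
      intro y hy
      rw [Finset.mem_range] at hy
      exact h x hx y (by omega)
    have := Finset.card_le_card this
    rw [Finset.card_range] at this
    rw [Finset.mem_range]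
    omega
  · simp

theorem sum_pow_level_zero {R : Type*} [CommRing R] (t : R) {μ : Fin (n + 1) → ℤ} (hμ : Antitone μ) :
    ∑ k ∈ Finset.univ.filter (fun k => μ k = μ 0), t ^ (k : ℕ) =
      ∑ e ∈ Finset.range (Finset.univ.filter (fun k => μ k = μ 0)).card, t ^ e := by
  set S := (Finset.univ.filter (fun k => μ k = μ 0)).map Fin.valEmbedding with hS
  have h1 : S = Finset.range S.card := by
    apply eq_range_card_of_isLowerSet
    intro x hx y hy
    rw [hS, Finset.mem_map] at hx
    obtain ⟨k, hk, rfl⟩ := hx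
    rw [Finset.mem_filter] at hk
    have hy' : y ≤ (k : ℕ) := hy
    have hle : (⟨y, by omega⟩ : Fin (n + 1)) ≤ k := hy'
    rw [hS, Finset.mem_map]
    refine ⟨⟨y, by omega⟩, ?_, rfl⟩
    rw [Finset.mem_filter]
    exact ⟨Finset.mem_univ _, le_antisymm (hμ (Fin.zero_le _)) (hk.2 ▸ hμ hle)⟩
  have h2 : S.card = (Finset.univ.filter (fun k => μ k = μ 0)).card := Finset.card_map _
  rw [← h2, ← h1, hS, Finset.sum_map]
  rfl

/-- The generating function of the inversions over the stabilizer of `μ` is the product of the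
`tFactorial`s of the multiplicities of the values of `μ`. -/
theorem sum_stabilizer_pow_invCount {R : Type*} [CommRing R] (t : R) (A : Finset ℤ) :
    ∀ {n : ℕ} {μ : Fin n → ℤ}, Antitone μ → (∀ i, μ i ∈ A) →
    ∑ w ∈ Finset.univ.filter (fun w : Equiv.Perm (Fin n) => μ ∘ w = μ), t ^ invCount w =
      ∏ a ∈ A, tFactorial t (Finset.univ.filter (fun i => μ i = a)).card := by
  intro n
  induction n with
  | zero =>
    intro μ _ _
    have h1 : ∀ w : Equiv.Perm (Fin 0), μ ∘ w = μ := fun w => funext fun i => i.elim0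
    simp [h1, invCount, ltPairs, tFactorial]
  | succ n ih =>
    intro μ hμ hA
    have hcard : ∀ a, (Finset.univ.filter (fun i => μ i = a)).card =
        (if μ 0 = a then 1 else 0) + (Finset.univ.filter (fun i : Fin n => (μ ∘ Fin.succ) i = a)).card := by
      intro a
      rw [Finset.card_filter, Finset.card_filter, Fin.sum_univ_succ]
      rfl
    have h1 := ih (μ := μ ∘ Fin.succ) (fun i j hij => hμ (Fin.succ_le_succ_iff.2 hij))
      (fun i => hA _)
    have h2 : ∑ w ∈ Finset.univ.filter (fun w : Equiv.Perm (Fin (n + 1)) => μ ∘ w = μ),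
        t ^ invCount w = (∑ k ∈ Finset.univ.filter (fun k => μ k = μ 0), t ^ (k : ℕ)) *
          ∑ u ∈ Finset.univ.filter (fun u : Equiv.Perm (Fin n) => (μ ∘ Fin.succ) ∘ u = μ ∘ Fin.succ),
            t ^ invCount u := by
      rw [Finset.sum_filter, ← insertFirst_bijective.sum_comp (fun w => if μ ∘ w = μ then t ^ invCount w else 0),
        Fintype.sum_prod_type, Finset.sum_mul_sum, Finset.sum_filter]
      refine Finset.sum_congr rfl fun k _ => ?_
      simp only [comp_insertFirst_eq_iff hμ, invCount_insertFirst]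
      split_ifs with hk
      · rw [Finset.sum_filter]
        refine Finset.sum_congr rfl fun u _ => ?_
        simp only [hk, true_and, pow_add]
      · simp [hk]
    rw [h2, h1, sum_pow_level_zero t hμ, ← Finset.mul_prod_erase A _ (hA 0),
      ← Finset.mul_prod_erase A (fun a => tFactorial t (Finset.univ.filter (fun i => μ i = a)).card) (hA 0),
      ← mul_assoc]
    congr 1
    · rw [hcard (μ 0), if_pos rfl, add_comm 1, tFactorial, tFactorial, Finset.prod_range_succ, mul_comm]
    · refine Finset.prod_congr rfl fun a ha => ?_
      rw [hcard a, if_neg (Finset.ne_of_mem_erase ha).symm, zero_add]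

end

/-! ### Expansion of alternating elements in alternants -/

section

variable {n : ℕ}

/-- The nonnegative exponents. -/
def nonnegExp (n : ℕ) : AddSubmonoid (ℕ × (Fin n → ℤ)) where
  carrier := {p | 0 ≤ p.2}
  zero_mem' := show (0 : Fin n → ℤ) ≤ 0 from le_rfl
  add_mem' := by
    intro a b (ha : 0 ≤ a.2) (hb : 0 ≤ b.2)
    exact show 0 ≤ a.2 + b.2 from add_nonneg ha hb

theorem mem_nonnegExp {d : ℕ} {α : Fin n → ℤ} : (d, α) ∈ nonnegExp n ↔ 0 ≤ α := Iff.rfl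

theorem tSer_mem_supportedIn {M : AddSubmonoid (ℕ × (Fin n → ℤ))} (h : (1, 0) ∈ M) :
    tSer n ∈ supportedIn M := by
  have := tSer_mul_mon_mem_supportedIn h
  rwa [mon_zero, mul_one] at this

theorem expo_nonneg (i : Fin n) : 0 ≤ expo i := by
  intro j
  rw [expo, Pi.single_apply]
  split_ifs <;> simp

theorem altCoeff_sub (μ : Fin n → ℤ) (F G : LaurentSer n) :
    altCoeff μ (F - G) = altCoeff μ F - altCoeff μ G := by
  rw [altCoeff, sub_mul, map_sub, altCoeff, altCoeff]

theorem altCoeff_sum {ι : Type*} (s : Finset ι) (μ : Fin n → ℤ) (F : ι → LaurentSer n) :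
    altCoeff μ (∑ i ∈ s, F i) = ∑ i ∈ s, altCoeff μ (F i) := by
  simp only [altCoeff, Finset.sum_mul, map_sum]

theorem altCoeff_constSer_mul (μ : Fin n → ℤ) (p : PowerSeries ℚ) (F : LaurentSer n) :
    altCoeff μ (constSer n p * F) = p * altCoeff μ F := by
  rw [altCoeff, mul_assoc, coeffAt_constSer_mul, altCoeff]

theorem permVar_constSer (w : Equiv.Perm (Fin n)) (p : PowerSeries ℚ) :
    permVar w (constSer n p) = constSer n p := by
  ext1 d
  rw [permVar, substAut, constSer, PowerSeries.coeff_map, PowerSeries.coeff_map,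
    AddMonoidAlgebra.coe_algebraMap]
  simp

theorem IsAlternating.mul_symmetric {F g : LaurentSer n} (hF : IsAlternating F)
    (hg : ∀ w, permVar w g = g) : IsAlternating (F * g) := by
  intro w
  rw [map_mul, hF, hg, mul_assoc]

theorem IsAlternating.sub {F G : LaurentSer n} (hF : IsAlternating F) (hG : IsAlternating G) :
    IsAlternating (F - G) := by
  intro w
  rw [map_sub, hF, hG, mul_sub]

theorem isAlternating_sum {ι : Type*} (s : Finset ι) {F : ι → LaurentSer n}
    (hF : ∀ i ∈ s, IsAlternating (F i)) : IsAlternating (∑ i ∈ s, F i) := by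
  intro w
  rw [map_sum, Finset.mul_sum]
  exact Finset.sum_congr rfl fun i hi => hF i hi w

theorem alternant_mem_nonneg {μ : Fin n → ℤ} (hμ : 0 ≤ μ) :
    alternant μ ∈ supportedIn (nonnegExp n) := by
  have ht : tSer n ∈ supportedIn (nonnegExp n) := tSer_mem_supportedIn (mem_nonnegExp.2 le_rfl)
  have he : ∀ i : Fin n, mon (expo i) ∈ supportedIn (nonnegExp n) := fun i =>
    mon_mem_supportedIn (mem_nonnegExp.2 (expo_nonneg i))
  refine sum_mem fun w _ => mul_mem (intCast_mem _ _) ?_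
  rw [map_mul, tVand, map_prod]
  refine mul_mem ?_ (prod_mem fun p _ => ?_)
  · rw [permVar, substAut_mon]
    exact mon_mem_supportedIn (mem_nonnegExp.2 fun i => hμ _)
  · rw [map_sub, map_mul, permVar, substAut_mon, substAut_mon, substAut_tSer, permExp_expo,
      permExp_expo]
    exact sub_mem (he _) (mul_mem ht (he _))

theorem vand_mem_nonneg : vand n ∈ supportedIn (nonnegExp n) :=
  prod_mem fun _ _ => sub_mem (mon_mem_supportedIn (mem_nonnegExp.2 (expo_nonneg _)))
    (mon_mem_supportedIn (mem_nonnegExp.2 (expo_nonneg _)))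

theorem rho_apply (i : Fin n) : rho n i = n - 1 - (i : ℤ) := by
  have h : rho n i = ∑ j, if i < j then (1 : ℤ) else 0 := by
    rw [rho, Finset.sum_apply, ltPairs, Finset.sum_filter, Fintype.sum_prod_type,
      Finset.sum_eq_single i]
    · simp [expo]
    · intro j _ hj
      refine Finset.sum_eq_zero fun k _ => ?_
      split_ifs
      · simp [expo, hj.symm]
      · rfl
    · simp
  rw [h, Finset.sum_boole]
  have : (Finset.univ.filter fun j => i < j) = Finset.Ioi i := by ext; simp
  rw [this, Fin.card_Ioi]
  have := i.2
  omega

theorem coeff_zero_geomPos : PowerSeries.coeff 0 (geomPos n) = 1 := by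
  rw [PowerSeries.coeff_zero_eq_constantCoeff_apply, geomPos, map_prod]
  refine Finset.prod_eq_one fun p _ => ?_
  rw [← PowerSeries.coeff_zero_eq_constantCoeff_apply, geom, PowerSeries.coeff_mk, zero_smul]
  rfl

theorem strictAnti_add_le {β : Fin n → ℤ} (hβ : StrictAnti β) (d : ℕ) :
    ∀ i j : Fin n, (j : ℕ) = i + d → β j + d ≤ β i := by
  induction d with
  | zero => intro i j h; rw [Fin.ext (by simpa using h : (j : ℕ) = i)]; simp
  | succ d ih =>
    intro i j h
    have h1 := ih i ⟨i + d, by omega⟩ rfl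
    have h2 : β j < β ⟨i + d, by omega⟩ := hβ (show (i : ℕ) + d < j by omega)
    push_cast
    omega

/-- The lowest nonzero coefficient in `t` of an alternating element would be an alternating Laurent
polynomial without strictly decreasing exponents. -/
theorem IsAlternating.eq_zero {F : LaurentSer n} (hF : IsAlternating F)
    (hsupp : F ∈ supportedIn (nonnegExp n))
    (h : ∀ μ : Fin n → ℤ, Antitone μ → 0 ≤ μ → altCoeff μ F = 0) : F = 0 := by
  by_contra hne
  have hex : ∃ d, PowerSeries.coeff d F ≠ 0 := by
    by_contra hcon
    push Not at hcon
    exact hne (by ext1 d; rw [hcon d, map_zero])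
  classical
  set d := Nat.find hex with hd
  have hd1 : PowerSeries.coeff d F ≠ 0 := Nat.find_spec hex
  have hd2 : ∀ e < d, PowerSeries.coeff e F = 0 := fun e he => not_not.1 (Nat.find_min hex he)
  have hlow : PowerSeries.coeff d (F * geomPos n) = PowerSeries.coeff d F := by
    rw [PowerSeries.coeff_mul, Finset.sum_eq_single (d, 0)]
    · rw [coeff_zero_geomPos, mul_one]
    · rintro ⟨a, b⟩ hab hne'
      rw [Finset.HasAntidiagonal.mem_antidiagonal] at hab
      have : a < d := by
        rcases Nat.lt_or_ge a d with h | h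
        · exact h
        · exfalso
          simp only at hab
          exact hne' (Prod.ext (by simp only; omega) (by simp only; omega))
      simp only
      rw [hd2 a this, zero_mul]
    · intro h0
      exact absurd (Finset.HasAntidiagonal.mem_antidiagonal.2 (by simp)) h0
  have hdom : ∀ μ : Fin n → ℤ, Antitone μ → 0 ≤ μ → (PowerSeries.coeff d F).coeff (μ + rho n) = 0 := by
    intro μ h1 h2
    have := congrArg (PowerSeries.coeff d) (h μ h1 h2)
    rwa [altCoeff, coeff_coeffAt, hlow, map_zero] at this
  have halt : ∀ (w : Equiv.Perm (Fin n)) (α : Fin n → ℤ), (PowerSeries.coeff d F).coeff α =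
      ((Equiv.Perm.sign w : ℤ) : ℚ) * (PowerSeries.coeff d F).coeff (permExp w α) := by
    intro w α
    have h1 := coeffAt_substAut (permExp w) α F
    have h2 := hF w
    rw [permVar] at h2
    rw [h2, sgn, ← zsmul_eq_mul, map_zsmul] at h1
    have h3 := congrArg (PowerSeries.coeff d) h1
    rw [map_zsmul, coeff_coeffAt, coeff_coeffAt, zsmul_eq_mul] at h3
    exact h3.symm
  apply hd1
  ext α
  rw [AddMonoidAlgebra.coeff_zero, Finsupp.zero_apply]
  by_contra hα
  have hα0 : 0 ≤ α := mem_nonnegExp.1 (hsupp d α hα)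
  by_cases hinj : Function.Injective α
  · -- sort the exponents
    set σ := Tuple.sort (fun i => -α i) with hσ
    have hmono : Monotone ((fun i => -α i) ∘ σ) := Tuple.monotone_sort _
    set β : Fin n → ℤ := permExp σ⁻¹ α with hβ
    have hβapp : ∀ i, β i = α (σ i) := fun i => rfl
    have hβs : StrictAnti β := by
      refine Antitone.strictAnti_of_injective (fun i j hij => ?_) ?_
      · have := hmono hij
        simp only [Function.comp] at this
        rw [hβapp, hβapp]
        omega
      · intro i j hij
        rw [hβapp, hβapp] at hij
        exact σ.injective (hinj hij)
    have h1 := hdom (β - rho n) (fun i j hij => ?_) (fun i => ?_)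
    · rw [sub_add_cancel] at h1
      rw [halt σ⁻¹ α, ← hβ, h1, mul_zero] at hα
      exact hα rfl
    · rw [Pi.sub_apply, Pi.sub_apply, rho_apply, rho_apply]
      have hij' : (i : ℕ) ≤ j := hij
      have := strictAnti_add_le hβs ((j : ℕ) - i) i j (by omega)
      push_cast [hij'] at this
      omega
    · rw [Pi.sub_apply, rho_apply, Pi.zero_apply]
      have hi := i.2
      have h2 := strictAnti_add_le hβs (n - 1 - i) i ⟨n - 1, by omega⟩ (by simp only; omega)
      have h3 : 0 ≤ β ⟨n - 1, by omega⟩ := hα0 _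
      have h4 : ((n - 1 - i : ℕ) : ℤ) = n - 1 - i := by omega
      have h5 : (0 : ℤ) ≤ β i - (n - 1 - i) := by omega
      exact h5
  · -- a repeated exponent is fixed by a transposition
    unfold Function.Injective at hinj
    push Not at hinj
    obtain ⟨i, j, hij, hne'⟩ := hinj
    have h1 := halt (Equiv.swap i j) α
    have h2 : permExp (Equiv.swap i j) α = α := by
      ext k
      rw [permExp_apply, Equiv.symm_swap]
      rcases eq_or_ne k i with rfl | hki
      · rw [Equiv.swap_apply_left, hij]
      · rcases eq_or_ne k j with rfl | hkj
        · rw [Equiv.swap_apply_right, hij]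
        · rw [Equiv.swap_apply_of_ne_of_ne hki hkj]
    rw [h2, Equiv.Perm.sign_swap hne'] at h1
    push_cast at h1
    exact hα (by linarith)

theorem constantCoeff_tFactorial (m : ℕ) :
    PowerSeries.constantCoeff (tFactorial (PowerSeries.X : PowerSeries ℚ) m) = 1 := by
  rw [tFactorial, map_prod]
  refine Finset.prod_eq_one fun i _ => ?_
  rw [Finset.sum_range_succ', map_add, map_sum]
  simp

theorem altCoeff_alternant_self_eq {μ : Fin n → ℤ} (hμ : Antitone μ) (A : Finset ℤ)
    (hA : ∀ i, μ i ∈ A) : altCoeff μ (alternant μ) =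
      ∏ a ∈ A, tFactorial PowerSeries.X (Finset.univ.filter (fun i => μ i = a)).card := by
  rw [altCoeff_alternant_self hμ, ← sum_stabilizer_pow_invCount PowerSeries.X A hμ hA]
  rfl

theorem constantCoeff_altCoeff_alternant_self {μ : Fin n → ℤ} (hμ : Antitone μ) :
    PowerSeries.constantCoeff (altCoeff μ (alternant μ)) = 1 := by
  rw [altCoeff_alternant_self_eq hμ (Finset.univ.image μ) (fun i => Finset.mem_image_of_mem _ (Finset.mem_univ i)),
    map_prod]
  exact Finset.prod_eq_one fun a _ => constantCoeff_tFactorial _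

/-- The expansion of an alternating element in alternants. By `IsAlternating.eq_zero` it suffices to compare
the values of the functionals `altCoeff ν`, which are orthogonal to the alternants. -/
theorem IsAlternating.eq_sum {F : LaurentSer n} (hF : IsAlternating F)
    (hsupp : F ∈ supportedIn (nonnegExp n)) (Λ : Finset (Fin n → ℤ))
    (hΛ : ∀ μ ∈ Λ, Antitone μ ∧ 0 ≤ μ)
    (h : ∀ μ : Fin n → ℤ, Antitone μ → 0 ≤ μ → μ ∉ Λ → altCoeff μ F = 0) :
    F = ∑ μ ∈ Λ, constSer n (altCoeff μ F * (altCoeff μ (alternant μ))⁻¹) * alternant μ := by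
  rw [← sub_eq_zero]
  have hcs : ∀ p, constSer n p ∈ supportedIn (nonnegExp n) := by
    intro p d α hne
    rw [constSer, PowerSeries.coeff_map, AddMonoidAlgebra.coe_algebraMap] at hne
    simp only [Function.comp, AddMonoidAlgebra.coeff_single, Finsupp.single_apply] at hne
    split_ifs at hne with h0
    · rw [← h0]; exact mem_nonnegExp.2 le_rfl
    · exact absurd rfl hne
  apply IsAlternating.eq_zero
  · refine hF.sub (isAlternating_sum _ fun μ _ => ?_)
    rw [mul_comm]
    exact (isAlternating_alternant μ).mul_symmetric fun w => permVar_constSer w _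
  · exact sub_mem hsupp (sum_mem fun μ hμ => mul_mem (hcs _) (alternant_mem_nonneg (hΛ μ hμ).2))
  · intro ν hν hν0
    rw [altCoeff_sub, altCoeff_sum]
    simp only [altCoeff_constSer_mul]
    by_cases hmem : ν ∈ Λ
    · rw [Finset.sum_eq_single ν, mul_assoc, PowerSeries.inv_mul_cancel, mul_one, sub_self]
      · rw [constantCoeff_altCoeff_alternant_self hν]; exact one_ne_zero
      · intro μ hμ hne
        have : altCoeff ν (alternant μ) = 0 := by
          by_contra hcon
          exact hne (eq_of_altCoeff_alternant_ne_zero hν (hΛ μ hμ).1 hcon).symm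
        rw [this, mul_zero]
      · exact fun h0 => absurd hmem h0
    · rw [h ν hν hν0 hmem, zero_sub, neg_eq_zero]
      refine Finset.sum_eq_zero fun μ hμ => ?_
      have : altCoeff ν (alternant μ) = 0 := by
        by_contra hcon
        have := eq_of_altCoeff_alternant_ne_zero hν (hΛ μ hμ).1 hcon
        exact hmem (this ▸ hμ)
      rw [this, mul_zero]

end

/-! ### The coefficients of power sums -/

section

variable {n : ℕ}

/-- The expansion of `(x_i - x_j) / (x_i - t x_j)`. -/
def kerFactor (i j : Fin n) : LaurentSer n := (1 - mon (root i j)) * geom (root i j)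

/-- The expansion of the product of the `(x_i - x_j) / (x_i - t x_j)`, `i < j`. -/
def kernel (n : ℕ) : LaurentSer n := ∏ p ∈ ltPairs n, kerFactor p.1 p.2

/-- The power sum in `n` variables. -/
def powSer (n r : ℕ) : LaurentSer n := ∑ i : Fin n, mon (r • expo i)

/-- The product of the power sums with indices in `s`. -/
def powProd (n : ℕ) (s : Multiset ℕ) : LaurentSer n := (s.map (powSer n)).prod

/-- The coefficient of `x ^ α` in the product of the power sums and the kernel. For a partition `α` it
is the coordinate of the product of the power sums at `P_α`. -/
def hlCoeff (n : ℕ) (s : Multiset ℕ) (α : Fin n → ℤ) : PowerSeries ℚ :=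
  coeffAt α (powProd n s * kernel n)

theorem vand_mul_geomPos : vand n * geomPos n = mon (rho n) * kernel n := by
  rw [vand, geomPos, kernel, rho, ← prod_mon, ← Finset.prod_mul_distrib, ← Finset.prod_mul_distrib]
  refine Finset.prod_congr rfl fun p _ => ?_
  rw [kerFactor, ← mon_expo_mul p.1 p.2]
  ring

/-- The functional `altCoeff α` divides by `∏ (x_i - t x_j)`, so applied to the Vandermonde product times
the power sums it is a coefficient of the power sums times the kernel. -/
theorem altCoeff_vand_mul (α : Fin n → ℤ) (s : Multiset ℕ) :
    altCoeff α (vand n * powProd n s) = hlCoeff n s α := by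
  have : vand n * powProd n s * geomPos n = mon (rho n) * (powProd n s * kernel n) := by
    linear_combination powProd n s * vand_mul_geomPos
  rw [altCoeff, this, coeffAt_mon_mul, add_sub_cancel_right, hlCoeff]

theorem permVar_powProd (w : Equiv.Perm (Fin n)) (s : Multiset ℕ) :
    permVar w (powProd n s) = powProd n s := by
  have h : ∀ r, permVar w (powSer n r) = powSer n r := by
    intro r
    rw [powSer, map_sum]
    refine Fintype.sum_equiv w _ _ fun i => ?_
    rw [permVar, substAut_mon, map_nsmul, permExp_expo]
  rw [powProd, map_multiset_prod, Multiset.map_map]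
  simp only [Function.comp_def, h]

theorem powProd_mem_nonneg (s : Multiset ℕ) : powProd n s ∈ supportedIn (nonnegExp n) := by
  refine multiset_prod_mem _ fun g hg => ?_
  obtain ⟨r, -, rfl⟩ := Multiset.mem_map.1 hg
  exact sum_mem fun i _ => mon_mem_supportedIn (mem_nonnegExp.2 (nsmul_nonneg (expo_nonneg i) r))

theorem hlCoeff_cons (r : ℕ) (s : Multiset ℕ) (α : Fin n → ℤ) :
    hlCoeff n (r ::ₘ s) α = ∑ i, hlCoeff n s (α - r • expo i) := by
  rw [hlCoeff, powProd, Multiset.map_cons, Multiset.prod_cons, powSer, mul_assoc, Finset.sum_mul,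
    map_sum]
  simp only [coeffAt_mon_mul]
  rfl

theorem hlCoeff_zero (α : Fin n → ℤ) : hlCoeff n 0 α = coeffAt α (kernel n) := by
  rw [hlCoeff, powProd, Multiset.map_zero, Multiset.prod_zero, one_mul]

theorem kerFactor_mem {M : AddSubmonoid (ℕ × (Fin n → ℤ))} {i j : Fin n} (h0 : (0, root i j) ∈ M)
    (h1 : (1, root i j) ∈ M) : kerFactor i j ∈ supportedIn M :=
  mul_mem (sub_mem (one_mem _) (mon_mem_supportedIn h0)) (geom_mem_supportedIn h1)

theorem kernel_mem {M : AddSubmonoid (ℕ × (Fin n → ℤ))}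
    (h0 : ∀ i j : Fin n, i < j → (0, root i j) ∈ M) (h1 : ∀ i j : Fin n, i < j → (1, root i j) ∈ M) :
    kernel n ∈ supportedIn M := by
  refine prod_mem fun p hp => ?_
  simp only [ltPairs, Finset.mem_filter, Finset.mem_univ, true_and] at hp
  exact kerFactor_mem (h0 _ _ hp) (h1 _ _ hp)

/-- The degree in the variables `x_i`. -/
def degExp : (Fin n → ℤ) →+ ℤ where
  toFun α := ∑ i, α i
  map_zero' := by simp
  map_add' α β := by simp [Finset.sum_add_distrib]

theorem degExp_expo (i : Fin n) : degExp (expo i) = 1 := by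
  simp [degExp, expo]

/-- The kernel is homogeneous of degree `0` in the variables `x_i`. -/
theorem sum_eq_of_hlCoeff_ne_zero (s : Multiset ℕ) : ∀ α : Fin n → ℤ, hlCoeff n s α ≠ 0 →
    ∑ i, α i = (s.sum : ℤ) := by
  induction s using Multiset.induction_on with
  | empty =>
    intro α h
    let M : AddSubmonoid (ℕ × (Fin n → ℤ)) :=
      AddSubmonoid.comap (degExp.comp (AddMonoidHom.snd ℕ (Fin n → ℤ))) ⊥
    have hM : ∀ d α, (d, α) ∈ M ↔ degExp α = 0 := fun d α => Iff.rfl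
    have hroot : ∀ d (i j : Fin n), (d, root i j) ∈ M := by
      intro d i j
      rw [hM, root, map_sub, degExp_expo, degExp_expo, sub_self]
    have hk : kernel n ∈ supportedIn M := kernel_mem (fun i j _ => hroot 0 i j) fun i j _ => hroot 1 i j
    by_contra hcon
    apply h
    rw [hlCoeff_zero]
    apply coeffAt_eq_zero_of_supportedIn hk
    intro d hd
    rw [hM] at hd
    apply hcon
    rw [Multiset.sum_zero]
    exact hd
  | cons r s ih =>
    intro α h
    rw [hlCoeff_cons] at h
    obtain ⟨i, -, hi⟩ := Finset.exists_ne_zero_of_sum_ne_zero h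
    have h1 := ih _ hi
    have h2 : degExp (α - r • expo i) = degExp α - r := by
      rw [map_sub, map_nsmul, degExp_expo, nsmul_eq_mul, mul_one]
    have h3 : degExp (α - r • expo i) = (s.sum : ℤ) := h1
    have h4 : degExp α = (r : ℤ) + s.sum := by linarith
    rw [Multiset.sum_cons, Nat.cast_add]
    exact h4

/-- The power of `t` in a term of the kernel is bounded by minus the level of its exponent. -/
theorem exists_polynomial_eq_hlCoeff (s : Multiset ℕ) : ∀ α : Fin n → ℤ,
    ∃ q : ℚ[X], (q : PowerSeries ℚ) = hlCoeff n s α := by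
  induction s using Multiset.induction_on with
  | empty =>
    intro α
    let M : AddSubmonoid (ℕ × (Fin n → ℤ)) :=
      { carrier := {p | (p.1 : ℤ) ≤ -level p.2}
        zero_mem' := by simp
        add_mem' := by
          intro a b (ha : (a.1 : ℤ) ≤ -level a.2) (hb : (b.1 : ℤ) ≤ -level b.2)
          show ((a.1 + b.1 : ℕ) : ℤ) ≤ -level (a.2 + b.2)
          rw [map_add]
          push_cast
          linarith }
    have hM : ∀ d α, (d, α) ∈ M ↔ (d : ℤ) ≤ -level α := fun d α => Iff.rfl
    have hroot : ∀ d ≤ 1, ∀ i j : Fin n, i < j → (d, root i j) ∈ M := by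
      intro d hd i j hij
      have : (i : ℕ) < j := hij
      rw [hM, level_root]
      omega
    have hk : kernel n ∈ supportedIn M := kernel_mem (hroot 0 (by omega)) (hroot 1 le_rfl)
    rw [hlCoeff_zero]
    refine ⟨PowerSeries.trunc ((-level α).toNat + 1) (coeffAt α (kernel n)), ?_⟩
    ext d
    rw [Polynomial.coeff_coe, PowerSeries.coeff_trunc]
    split_ifs with hd
    · rfl
    · rw [coeff_coeffAt]
      by_contra hne
      have := (hM _ _).1 (hk d α (Ne.symm hne))
      omega
  | cons r s ih =>
    intro α
    choose q hq using ih
    refine ⟨∑ i, q (α - r • expo i), ?_⟩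
    rw [hlCoeff_cons, ← Polynomial.coeToPowerSeries.ringHom_apply, map_sum]
    exact Finset.sum_congr rfl fun i _ => hq _

/-- `hlCoeff` as a polynomial in `t`. -/
def hlPolyCoeff (n : ℕ) (s : Multiset ℕ) (α : Fin n → ℤ) : ℚ[X] :=
  (exists_polynomial_eq_hlCoeff s α).choose

theorem coe_hlPolyCoeff (s : Multiset ℕ) (α : Fin n → ℤ) :
    (hlPolyCoeff n s α : PowerSeries ℚ) = hlCoeff n s α :=
  (exists_polynomial_eq_hlCoeff s α).choose_spec

theorem hlPolyCoeff_cons (r : ℕ) (s : Multiset ℕ) (α : Fin n → ℤ) :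
    hlPolyCoeff n (r ::ₘ s) α = ∑ i, hlPolyCoeff n s (α - r • expo i) := by
  apply Polynomial.coe_injective ℚ
  rw [coe_hlPolyCoeff, hlCoeff_cons, ← Polynomial.coeToPowerSeries.ringHom_apply, map_sum]
  exact Finset.sum_congr rfl fun i _ => (coe_hlPolyCoeff s _).symm

/-! ### Adding a variable -/

/-- The exponent `α` extended by zero. -/
def snocZero (n : ℕ) : (Fin n → ℤ) →+ (Fin (n + 1) → ℤ) where
  toFun α := Fin.snoc (α := fun _ => ℤ) α 0
  map_zero' := by
    ext i
    refine Fin.lastCases ?_ (fun i => ?_) i <;> simp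
  map_add' α β := by
    ext i
    refine Fin.lastCases ?_ (fun i => ?_) i <;> simp

theorem snocZero_castSucc (α : Fin n → ℤ) (i : Fin n) : snocZero n α i.castSucc = α i := by
  simp [snocZero]

theorem snocZero_last (α : Fin n → ℤ) : snocZero n α (Fin.last n) = 0 := by
  simp [snocZero]

theorem snocZero_injective : Function.Injective (snocZero n) := by
  intro α β h
  ext i
  rw [← snocZero_castSucc α, h, snocZero_castSucc]

theorem snocZero_expo (i : Fin n) : snocZero n (expo i) = expo i.castSucc := by
  ext j
  refine Fin.lastCases ?_ (fun j => ?_) j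
  · rw [snocZero_last, expo, Pi.single_eq_of_ne (Fin.castSucc_lt_last i).ne']
  · rw [snocZero_castSucc]
    simp [expo, Pi.single_apply]

/-- The inclusion of the ring in `n` variables into the ring in `n + 1` variables. -/
def inclVar (n : ℕ) : LaurentSer n →+* LaurentSer (n + 1) :=
  PowerSeries.map (AddMonoidAlgebra.mapDomainRingHom ℚ (snocZero n))

theorem coeffAt_inclVar (α : Fin n → ℤ) (g : LaurentSer n) :
    coeffAt (snocZero n α) (inclVar n g) = coeffAt α g := by
  ext d
  rw [coeff_coeffAt, coeff_coeffAt, inclVar, PowerSeries.coeff_map]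
  exact Finsupp.mapDomain_apply snocZero_injective _ _

theorem inclVar_kerFactor (i j : Fin n) :
    inclVar n (kerFactor i j) = kerFactor i.castSucc j.castSucc := by
  have hroot : snocZero n (root i j) = root i.castSucc j.castSucc := by
    rw [root, map_sub, snocZero_expo, snocZero_expo, root]
  have h1 : inclVar n (mon (root i j)) = mon (root i.castSucc j.castSucc) := by
    rw [← hroot]
    simp [inclVar, mon]
  have h2 : inclVar n (geom (root i j)) = geom (root i.castSucc j.castSucc) := by
    rw [← hroot]
    ext1 d
    simp [inclVar, geom, -nsmul_eq_mul, map_nsmul]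
  rw [kerFactor, map_mul, map_sub, map_one, h1, h2, kerFactor]

theorem kernel_succ : kernel (n + 1) =
    inclVar n (kernel n) * ∏ i : Fin n, kerFactor i.castSucc (Fin.last n) := by
  have h : ∀ m (f : Fin m → Fin m → LaurentSer (n + 1)), ∏ p ∈ ltPairs m, f p.1 p.2 =
      ∏ i, ∏ j, if i < j then f i j else 1 := by
    intro m f
    rw [ltPairs, Finset.prod_filter, Fintype.prod_prod_type]
  rw [kernel, kernel, map_prod, h]
  simp only [inclVar_kerFactor]
  rw [h n (fun i j => kerFactor i.castSucc j.castSucc), Fin.prod_univ_castSucc,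
    ← Finset.prod_mul_distrib]
  have hlast : ∏ j, (if Fin.last n < j then kerFactor (Fin.last n) j else 1) = 1 := by
    refine Finset.prod_eq_one fun j _ => ?_
    rw [if_neg (not_lt.2 (Fin.le_last j))]
  rw [hlast, mul_one]
  refine Finset.prod_congr rfl fun i _ => ?_
  rw [Fin.prod_univ_castSucc, if_pos (Fin.castSucc_lt_last i)]
  congr 1

/-- The exponents with nonnegative last entry. -/
def nonnegLast (n : ℕ) : AddSubmonoid (ℕ × (Fin (n + 1) → ℤ)) where
  carrier := {p | 0 ≤ p.2 (Fin.last n)}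
  zero_mem' := by simp
  add_mem' := by
    intro a b (ha : 0 ≤ a.2 (Fin.last n)) (hb : 0 ≤ b.2 (Fin.last n))
    exact show 0 ≤ a.2 (Fin.last n) + b.2 (Fin.last n) from add_nonneg ha hb

theorem mem_nonnegLast {d : ℕ} {α : Fin (n + 1) → ℤ} :
    (d, α) ∈ nonnegLast n ↔ 0 ≤ α (Fin.last n) := Iff.rfl

theorem root_last {i j : Fin (n + 1)} (h : i < j) :
    root i j (Fin.last n) = if j = Fin.last n then 1 else 0 := by
  have h1 : i ≠ Fin.last n := fun hi => absurd (Fin.le_last j) (not_le.2 (hi ▸ h))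
  rw [root, Pi.sub_apply, expo, expo, Pi.single_eq_of_ne h1.symm, sub_zero, Pi.single_apply]
  simp only [eq_comm]

theorem kerFactor_mem_nonnegLast {i j : Fin (n + 1)} (h : i < j) :
    kerFactor i j ∈ supportedIn (nonnegLast n) := by
  have : ∀ d, (d, root i j) ∈ nonnegLast n := by
    intro d
    rw [mem_nonnegLast, root_last h]
    split_ifs <;> simp
  exact kerFactor_mem (this 0) (this 1)

/-- All the terms but `1` of a factor with the last variable `x_n` involve a positive power of `x_n`. -/
theorem coeffAt_mul_prod_kerFactor_last (α : Fin n → ℤ) (s : Finset (Fin n)) :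
    ∀ g ∈ supportedIn (nonnegLast n),
      coeffAt (snocZero n α) (g * ∏ i ∈ s, kerFactor i.castSucc (Fin.last n)) =
        coeffAt (snocZero n α) g := by
  induction s using Finset.induction_on with
  | empty => intro g _; rw [Finset.prod_empty, mul_one]
  | insert a s ha ih =>
    intro g hg
    have hlt := Fin.castSucc_lt_last a
    set γ := root a.castSucc (Fin.last n) with hγ
    have hγ1 : γ (Fin.last n) = 1 := by rw [hγ, root_last hlt, if_pos rfl]
    have hγM : ∀ d, (d, γ) ∈ nonnegLast n := fun d => mem_nonnegLast.2 (by rw [hγ1]; exact zero_le_one)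
    have ht : tSer (n + 1) ∈ supportedIn (nonnegLast n) :=
      tSer_mem_supportedIn (mem_nonnegLast.2 (by simp))
    -- `(1 - z) / (1 - t z) = 1 + z (t - 1) / (1 - t z)`
    have hk : g * kerFactor a.castSucc (Fin.last n) =
        g + mon γ * (g * ((tSer (n + 1) - 1) * geom γ)) := by
      rw [kerFactor, ← hγ]
      linear_combination g * one_sub_mul_geom γ
    have hrest : g * ((tSer (n + 1) - 1) * geom γ) ∈ supportedIn (nonnegLast n) :=
      mul_mem hg (mul_mem (sub_mem ht (one_mem _)) (geom_mem_supportedIn (hγM 1)))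
    rw [Finset.prod_insert ha, ← mul_assoc,
      ih _ (mul_mem hg (kerFactor_mem_nonnegLast hlt)), hk, map_add, coeffAt_mon_mul,
      coeffAt_eq_zero_of_supportedIn hrest, add_zero]
    intro d hd
    rw [mem_nonnegLast, Pi.sub_apply, snocZero_last, hγ1] at hd
    omega

theorem hlCoeff_eq_zero_of_last_neg (s : Multiset ℕ) : ∀ α : Fin (n + 1) → ℤ, α (Fin.last n) < 0 →
    hlCoeff (n + 1) s α = 0 := by
  induction s using Multiset.induction_on with
  | empty =>
    intro α hα
    rw [hlCoeff_zero]
    have hk : kernel (n + 1) ∈ supportedIn (nonnegLast n) := by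
      refine prod_mem fun p hp => ?_
      simp only [ltPairs, Finset.mem_filter, Finset.mem_univ, true_and] at hp
      exact kerFactor_mem_nonnegLast hp
    exact coeffAt_eq_zero_of_supportedIn hk fun d hd => absurd (mem_nonnegLast.1 hd) (by omega)
  | cons r s ih =>
    intro α hα
    rw [hlCoeff_cons]
    refine Finset.sum_eq_zero fun i _ => ih _ ?_
    rw [Pi.sub_apply, Pi.smul_apply]
    have : 0 ≤ r • expo i (Fin.last n) := nsmul_nonneg (expo_nonneg i _) r
    omega

/-- Stability: the coefficient does not change when a variable is added with exponent zero. -/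
theorem hlCoeff_snocZero (s : Multiset ℕ) (hs : ∀ a ∈ s, 0 < a) : ∀ α : Fin n → ℤ,
    hlCoeff (n + 1) s (snocZero n α) = hlCoeff n s α := by
  induction s using Multiset.induction_on with
  | empty =>
    intro α
    rw [hlCoeff_zero, hlCoeff_zero, kernel_succ, coeffAt_mul_prod_kerFactor_last, coeffAt_inclVar]
    rw [kernel, map_prod]
    refine prod_mem fun p hp => ?_
    simp only [ltPairs, Finset.mem_filter, Finset.mem_univ, true_and] at hp
    rw [inclVar_kerFactor]
    exact kerFactor_mem_nonnegLast (Fin.castSucc_lt_castSucc_iff.2 hp)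
  | cons r s ih =>
    intro α
    rw [hlCoeff_cons, hlCoeff_cons, Fin.sum_univ_castSucc]
    have h1 : hlCoeff (n + 1) s (snocZero n α - r • expo (Fin.last n)) = 0 := by
      apply hlCoeff_eq_zero_of_last_neg
      have := hs r (Multiset.mem_cons_self r s)
      rw [Pi.sub_apply, Pi.smul_apply, snocZero_last, expo, Pi.single_eq_same]
      simp only [nsmul_eq_mul, mul_one]
      omega
    rw [h1, add_zero]
    refine Finset.sum_congr rfl fun i _ => ?_
    rw [← ih (fun a ha => hs a (Multiset.mem_cons_of_mem ha)), map_sub, map_nsmul, snocZero_expo]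

end

/-! ### The values at `t = -1` -/

section

variable {n : ℕ}

theorem permVar_kerFactor (w : Equiv.Perm (Fin n)) (i j : Fin n) :
    permVar w (kerFactor i j) = kerFactor (w i) (w j) := by
  rw [kerFactor, map_mul, map_sub, map_one, permVar, substAut_mon, substAut_geom, permExp_root,
    kerFactor]

/-- The transposition of two neighbouring positions keeps the order of every other pair of positions. -/
theorem swap_lt_swap {i i' a b : Fin n} (hi : (i : ℕ) + 1 = i') (hab : a < b)
    (hne : (a, b) ≠ (i, i')) : Equiv.swap i i' a < Equiv.swap i i' b := by
  have hab' : (a : ℕ) < b := hab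
  have hne' : ¬ ((a : ℕ) = i ∧ (b : ℕ) = i') := by
    rintro ⟨h1, h2⟩
    exact hne (Prod.ext (Fin.ext h1) (Fin.ext h2))
  rw [Fin.lt_def]
  simp only [Equiv.swap_apply_def]
  split_ifs <;> simp only [Fin.ext_iff] at * <;> omega

theorem permVar_swap_prod_erase {i i' : Fin n} (hi : (i : ℕ) + 1 = i') :
    permVar (Equiv.swap i i') (∏ p ∈ (ltPairs n).erase (i, i'), kerFactor p.1 p.2) =
      ∏ p ∈ (ltPairs n).erase (i, i'), kerFactor p.1 p.2 := by
  have hmem : ∀ p ∈ (ltPairs n).erase (i, i'),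
      (Equiv.swap i i' p.1, Equiv.swap i i' p.2) ∈ (ltPairs n).erase (i, i') := by
    intro p hp
    simp only [ltPairs, Finset.mem_erase, Finset.mem_filter, Finset.mem_univ, true_and] at hp ⊢
    refine ⟨fun h => ?_, swap_lt_swap hi hp.2 hp.1⟩
    have h1 : p.1 = i' := by
      have := congrArg (Equiv.swap i i') (Prod.ext_iff.1 h).1
      simpa using this
    have h2 : p.2 = i := by
      have := congrArg (Equiv.swap i i') (Prod.ext_iff.1 h).2
      simpa using this
    have h3 : (p.1 : ℕ) < p.2 := hp.2
    rw [h1, h2] at h3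
    omega
  rw [map_prod]
  refine Finset.prod_bij' (fun p _ => (Equiv.swap i i' p.1, Equiv.swap i i' p.2))
    (fun p _ => (Equiv.swap i i' p.1, Equiv.swap i i' p.2)) hmem hmem ?_ ?_ ?_
  · intro p _; simp
  · intro p _; simp
  · intro p _; exact permVar_kerFactor _ _ _

/-- For neighbouring positions `i, i'`, the product of the power sums and the kernel is
`(x_i' - t x_i) / (x_i x_i')` times this element, which is antisymmetric in `x_i, x_i'`. -/
def exchangeElt (s : Multiset ℕ) (i i' : Fin n) : LaurentSer n :=
  (mon (expo i) - mon (expo i')) * (geom (root i i') * geom (root i' i)) * powProd n s *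
    ∏ p ∈ (ltPairs n).erase (i, i'), kerFactor p.1 p.2

theorem permVar_swap_exchangeElt (s : Multiset ℕ) {i i' : Fin n} (hi : (i : ℕ) + 1 = i') :
    permVar (Equiv.swap i i') (exchangeElt s i i') = -exchangeElt s i i' := by
  have h1 : permVar (Equiv.swap i i') (mon (expo i) - mon (expo i')) =
      mon (expo i') - mon (expo i) := by
    rw [map_sub, permVar, substAut_mon, substAut_mon, permExp_expo, permExp_expo,
      Equiv.swap_apply_left, Equiv.swap_apply_right]
  have h2 : permVar (Equiv.swap i i') (geom (root i i') * geom (root i' i)) =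
      geom (root i' i) * geom (root i i') := by
    rw [map_mul, permVar, substAut_geom, substAut_geom, permExp_root, permExp_root,
      Equiv.swap_apply_left, Equiv.swap_apply_right]
  rw [exchangeElt, map_mul, map_mul _ _ (powProd n s), map_mul _ (mon (expo i) - _),
    permVar_swap_prod_erase hi, permVar_powProd, h1, h2]
  ring

theorem hlCoeff_eq_exchangeElt (s : Multiset ℕ) {i i' : Fin n} (hi : (i : ℕ) + 1 = i')
    (α : Fin n → ℤ) : hlCoeff n s α = coeffAt (α + expo i) (exchangeElt s i i') -
      PowerSeries.X * coeffAt (α + expo i') (exchangeElt s i i') := by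
  have hmem : (i, i') ∈ ltPairs n := by
    simp only [ltPairs, Finset.mem_filter, Finset.mem_univ, true_and, Fin.lt_def]
    omega
  have h1 : mon (expo i + expo i') * (powProd n s * kernel n) =
      mon (expo i') * exchangeElt s i i' - tSer n * (mon (expo i) * exchangeElt s i i') := by
    rw [kernel, ← Finset.mul_prod_erase _ _ hmem, exchangeElt, ← mon_mul_mon]
    simp only [kerFactor]
    have h2 := mon_expo_mul i i'
    have h3 := mon_expo_mul i' i
    have h4 := one_sub_mul_geom (root i' i)
    generalize ∏ p ∈ (ltPairs n).erase (i, i'), (1 - mon (root p.1 p.2)) * geom (root p.1 p.2) = S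
    generalize powProd n s = P
    generalize geom (root i' i) = g' at *
    generalize geom (root i i') = g at *
    generalize mon (root i i') = z at *
    generalize mon (root i' i) = z' at *
    generalize mon (expo i) = u at *
    generalize mon (expo i') = v at *
    linear_combination (-v * P * S * g) * h2 - (u - v) * g * P * S * tSer n * g' * h3 -
      (u - v) * g * P * S * v * h4
  have h2 : coeffAt (α + (expo i + expo i')) (mon (expo i + expo i') * (powProd n s * kernel n)) =
      hlCoeff n s α := by
    rw [coeffAt_mon_mul, add_sub_cancel_right, hlCoeff]
  rw [← h2, h1, map_sub, coeffAt_tSer_mul, coeffAt_mon_mul, coeffAt_mon_mul]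
  congr 3 <;> abel_nf

theorem coeffAt_exchangeElt_swap (s : Multiset ℕ) {i i' : Fin n} (hi : (i : ℕ) + 1 = i')
    {γ : Fin n → ℤ} (hγ : γ i = γ i') (a b : ℤ) :
    coeffAt (γ + b • expo i + a • expo i') (exchangeElt s i i') =
      -coeffAt (γ + a • expo i + b • expo i') (exchangeElt s i i') := by
  have h1 : permExp (Equiv.swap i i') (γ + a • expo i + b • expo i') =
      γ + b • expo i + a • expo i' := by
    have h2 : permExp (Equiv.swap i i') γ = γ := by
      ext j
      rw [permExp_apply, Equiv.symm_swap, Equiv.swap_apply_def]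
      split_ifs with h h
      · rw [h, hγ]
      · rw [h, hγ]
      · rfl
    rw [map_add, map_add, map_zsmul, map_zsmul, h2, permExp_expo, permExp_expo,
      Equiv.swap_apply_left, Equiv.swap_apply_right]
    abel
  rw [← h1, ← coeffAt_substAut (permExp (Equiv.swap i i')) (γ + a • expo i + b • expo i'), ← permVar,
    permVar_swap_exchangeElt s hi, map_neg, neg_neg]

/-- The value at `t = -1` of the coefficient of `x ^ α`, normalized by the sign which makes the
exchange relations uniform. -/
def hlValue (n : ℕ) (s : Multiset ℕ) (α : Fin n → ℤ) : ℚ :=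
  (-1) ^ level α * (hlPolyCoeff n s α).eval (-1)

theorem coe_hlPolyCoeff_exchange (s : Multiset ℕ) {i i' : Fin n} (hi : (i : ℕ) + 1 = i')
    (γ : Fin n → ℤ) (a b : ℤ) :
    (hlPolyCoeff n s (γ + a • expo i + b • expo i') : PowerSeries ℚ) =
      coeffAt (γ + (a + 1) • expo i + b • expo i') (exchangeElt s i i') -
        PowerSeries.X * coeffAt (γ + a • expo i + (b + 1) • expo i') (exchangeElt s i i') := by
  rw [coe_hlPolyCoeff, hlCoeff_eq_exchangeElt s hi]
  congr 3 <;> rw [add_smul, one_smul] <;> abel_nf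

theorem neg_one_zpow_even_add {a b : ℤ} (h : Even (a - b)) : (-1 : ℚ) ^ a = (-1) ^ b := by
  rw [← sub_add_cancel a b, zpow_add₀ (by norm_num), h.neg_one_zpow, one_mul]

theorem neg_one_zpow_odd_add {a b : ℤ} (h : Odd (a - b)) : (-1 : ℚ) ^ a = -(-1) ^ b := by
  rw [← sub_add_cancel a b, zpow_add₀ (by norm_num), h.neg_one_zpow, neg_one_mul]

theorem level_add_add (γ : Fin n → ℤ) (i i' : Fin n) (a b : ℤ) :
    level (γ + a • expo i + b • expo i') = level γ - a * i - b * i' := by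
  rw [map_add, map_add, map_zsmul, map_zsmul, level_expo, level_expo, smul_eq_mul, smul_eq_mul]
  ring

theorem hlValue_exchange_even (s : Multiset ℕ) {i i' : Fin n} (hi : (i : ℕ) + 1 = i')
    {γ : Fin n → ℤ} (hγ : γ i = γ i') (c m : ℤ) :
    hlValue n s (γ + (c + m) • expo i + (c - m) • expo i') +
      hlValue n s (γ + (c - m) • expo i + (c + m) • expo i') =
        2 * hlValue n s (γ + c • expo i + c • expo i') := by
  have h := exchange_even (g := fun a b => hlPolyCoeff n s (γ + a • expo i + b • expo i'))
    (fun a b => coeffAt_exchangeElt_swap s hi hγ a b)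
    (fun a b => coe_hlPolyCoeff_exchange s hi γ a b) c m
  have hi' : (i' : ℤ) = i + 1 := by omega
  simp only [hlValue, level_add_add, hi']
  have h1 : (-1 : ℚ) ^ (level γ - (c - m) * i - (c + m) * ((i : ℤ) + 1)) =
      (-1) ^ (level γ - (c + m) * i - (c - m) * ((i : ℤ) + 1)) :=
    neg_one_zpow_even_add ⟨-m, by ring⟩
  have h2 : (-1 : ℚ) ^ (level γ - (c + m) * i - (c - m) * ((i : ℤ) + 1)) =
      (-1) ^ (level γ - c * i - c * ((i : ℤ) + 1)) * (-1) ^ m := by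
    rw [← zpow_add₀ (by norm_num)]
    congr 1
    ring
  have h3 : (-1 : ℚ) ^ m * (-1) ^ m = 1 := by
    rw [← mul_zpow]
    simp
  rw [h1, ← mul_add, h, h2]
  linear_combination 2 * (-1 : ℚ) ^ (level γ - c * i - c * ((i : ℤ) + 1)) *
    (hlPolyCoeff n s (γ + c • expo i + c • expo i')).eval (-1) * h3

theorem hlValue_exchange_odd (s : Multiset ℕ) {i i' : Fin n} (hi : (i : ℕ) + 1 = i')
    {γ : Fin n → ℤ} (hγ : γ i = γ i') {a b : ℤ} (hab : Odd (a - b)) :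
    hlValue n s (γ + a • expo i + b • expo i') = hlValue n s (γ + b • expo i + a • expo i') := by
  have h := exchange_odd (g := fun a b => hlPolyCoeff n s (γ + a • expo i + b • expo i'))
    (fun a b => coeffAt_exchangeElt_swap s hi hγ a b)
    (fun a b => coe_hlPolyCoeff_exchange s hi γ a b) a b hab
  have hi' : (i' : ℤ) = i + 1 := by omega
  simp only [hlValue, level_add_add, hi']
  have h1 : (-1 : ℚ) ^ (level γ - a * i - b * ((i : ℤ) + 1)) =
      -(-1) ^ (level γ - b * i - a * ((i : ℤ) + 1)) := by
    apply neg_one_zpow_odd_add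
    have : level γ - a * i - b * ((i : ℤ) + 1) - (level γ - b * i - a * ((i : ℤ) + 1)) = a - b := by
      ring
    rwa [this]
  rw [h1]
  linear_combination -(-1 : ℚ) ^ (level γ - b * i - a * ((i : ℤ) + 1)) * h

theorem hlValue_cons (k : ℕ) (s : Multiset ℕ) (α : Fin n → ℤ) :
    hlValue n ((2 * k) ::ₘ s) α = ∑ i, hlValue n s (α - (2 * k : ℤ) • expo i) := by
  rw [hlValue, hlPolyCoeff_cons, Polynomial.eval_finsetSum, Finset.mul_sum]
  refine Finset.sum_congr rfl fun i _ => ?_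
  rw [hlValue, map_sub, map_zsmul]
  have h : (2 * k) • expo i = (2 * k : ℤ) • expo i := by
    rw [← natCast_zsmul]
    push_cast
    rfl
  rw [h, neg_one_zpow_even_add (a := level α) (b := level α - (2 * k : ℤ) • level (expo i))]
  exact ⟨k * level (expo i), by rw [smul_eq_mul]; ring⟩

theorem level_snocZero (α : Fin n → ℤ) : level (snocZero n α) = level α := by
  show ∑ i : Fin (n + 1), -(i : ℤ) * snocZero n α i = ∑ i : Fin n, -(i : ℤ) * α i
  rw [Fin.sum_univ_castSucc, snocZero_last, mul_zero, add_zero]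
  simp only [snocZero_castSucc, Fin.val_castSucc]

theorem hlValue_snocZero {s : Multiset ℕ} (hs : ∀ a ∈ s, 0 < a) (α : Fin n → ℤ) :
    hlValue (n + 1) s (snocZero n α) = hlValue n s α := by
  rw [hlValue, hlValue, level_snocZero]
  congr 2
  apply Polynomial.coe_injective ℚ
  rw [coe_hlPolyCoeff, coe_hlPolyCoeff, hlCoeff_snocZero s hs]

theorem hlValue_eq_zero (s : Multiset ℕ) {α : Fin (n + 1) → ℤ} (hα : α (Fin.last n) < 0) :
    hlValue (n + 1) s α = 0 := by
  have : hlPolyCoeff (n + 1) s α = 0 := by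
    apply Polynomial.coe_injective ℚ
    rw [coe_hlPolyCoeff, hlCoeff_eq_zero_of_last_neg s α hα, Polynomial.coe_zero]
  rw [hlValue, this, eval_zero, mul_zero]

/-- A list as an exponent. -/
def listExp (n : ℕ) (l : List ℤ) : Fin n → ℤ := fun i => l.getD i 0

/-- The normalized value at `t = -1` of the coefficient whose exponent is a list. -/
def listValue (s : Multiset ℕ) (l : List ℤ) : ℚ := hlValue l.length s (listExp l.length l)

theorem listValue_eq (s : Multiset ℕ) {l : List ℤ} (h : l.length = n) :
    listValue s l = hlValue n s (listExp n l) := by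
  subst h
  rfl

theorem listExp_append_cons (l r : List ℤ) (a : ℤ) {i : Fin n} (hi : (i : ℕ) = l.length) :
    listExp n (l ++ a :: r) = listExp n (l ++ 0 :: r) + a • expo i := by
  ext j
  simp only [listExp, Pi.add_apply, Pi.smul_apply, expo, Pi.single_apply, Fin.ext_iff, hi]
  rcases lt_trichotomy (j : ℕ) l.length with h | h | h
  · rw [List.getD_append _ _ _ _ h, List.getD_append _ _ _ _ h, if_neg h.ne]
    simp
  · rw [List.getD_append_right _ _ _ _ h.ge, List.getD_append_right _ _ _ _ h.ge, if_pos h, h]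
    simp
  · rw [List.getD_append_right _ _ _ _ h.le, List.getD_append_right _ _ _ _ h.le, if_neg h.ne']
    obtain ⟨d, hd⟩ : ∃ d, (j : ℕ) - l.length = d + 1 := ⟨j - l.length - 1, by omega⟩
    rw [hd]
    simp

theorem listExp_append_cons_cons (l r : List ℤ) (a b : ℤ) {i i' : Fin n} (hi : (i : ℕ) = l.length)
    (hi' : (i : ℕ) + 1 = i') : listExp n (l ++ a :: b :: r) =
      listExp n (l ++ 0 :: 0 :: r) + a • expo i + b • expo i' := by
  rw [listExp_append_cons l (b :: r) a hi]
  have h := listExp_append_cons (n := n) (l ++ [0]) r b (i := i') (by simp; omega)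
  simp only [List.append_assoc, List.singleton_append] at h
  rw [h]
  abel

theorem listExp_zero_zero (l r : List ℤ) {i i' : Fin n} (hi : (i : ℕ) = l.length)
    (hi' : (i : ℕ) + 1 = i') :
    listExp n (l ++ 0 :: 0 :: r) i = listExp n (l ++ 0 :: 0 :: r) i' := by
  simp only [listExp]
  rw [List.getD_append_right _ _ _ _ (by omega), List.getD_append_right _ _ _ _ (by omega), ← hi',
    hi]
  simp

theorem listExp_append_zero (l : List ℤ) :
    listExp (l.length + 1) (l ++ [0]) = snocZero l.length (listExp l.length l) := by
  ext j
  refine Fin.lastCases ?_ (fun j => ?_) j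
  · rw [snocZero_last]
    simp [listExp]
  · rw [snocZero_castSucc, listExp, listExp, Fin.val_castSucc, List.getD_append _ _ _ _ j.isLt]

/-- At `t = -1` the coefficients satisfy the exchange relations; the sign in `hlValue` absorbs the `(-1) ^ m`
of `exchange_even`. -/
theorem exchangeRule_listValue {s : Multiset ℕ} (hs : ∀ a ∈ s, 0 < a) :
    ExchangeRule (listValue s) where
  even l r c m := by
    have hlen : ∀ a b : ℤ, (l ++ a :: b :: r).length = l.length + 2 + r.length := by
      intro a b; simp; omega
    have hi' : ((⟨l.length, by omega⟩ : Fin (l.length + 2 + r.length)) : ℕ) + 1 =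
      ((⟨l.length + 1, by omega⟩ : Fin (l.length + 2 + r.length)) : ℕ) := rfl
    rw [listValue_eq s (hlen _ _), listValue_eq s (hlen _ _), listValue_eq s (hlen _ _),
      listExp_append_cons_cons l r (c + m) (c - m) rfl hi',
      listExp_append_cons_cons l r (c - m) (c + m) rfl hi',
      listExp_append_cons_cons l r c c rfl hi']
    exact hlValue_exchange_even s hi' (listExp_zero_zero l r rfl hi') c m
  odd l r a b hab := by
    have hlen : ∀ a b : ℤ, (l ++ a :: b :: r).length = l.length + 2 + r.length := by
      intro a b; simp; omega
    have hi' : ((⟨l.length, by omega⟩ : Fin (l.length + 2 + r.length)) : ℕ) + 1 =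
      ((⟨l.length + 1, by omega⟩ : Fin (l.length + 2 + r.length)) : ℕ) := rfl
    rw [listValue_eq s (hlen _ _), listValue_eq s (hlen _ _),
      listExp_append_cons_cons l r a b rfl hi', listExp_append_cons_cons l r b a rfl hi']
    exact hlValue_exchange_odd s hi' (listExp_zero_zero l r rfl hi') hab
  zero l := by
    rw [listValue_eq s (n := l.length + 1) (by simp), listExp_append_zero, hlValue_snocZero hs,
      listValue]
  neg l a ha := by
    rw [listValue_eq s (n := l.length + 1) (by simp)]
    apply hlValue_eq_zero
    simpa [listExp] using ha

theorem lowerSum_listValue (s : Multiset ℕ) (d : ℤ) (l : List ℤ) : ∀ p : List ℤ,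
    p.length + l.length = n → lowerSum (listValue s) d p l =
      ∑ i ∈ Finset.univ.filter (fun i : Fin n => p.length ≤ (i : ℕ)),
        hlValue n s (listExp n (p ++ l) - d • expo i) := by
  induction l with
  | nil =>
    intro p hp
    rw [lowerSum]
    symm
    apply Finset.sum_eq_zero
    intro i hi
    rw [Finset.mem_filter] at hi
    have := i.isLt
    simp only [List.length_nil] at hp
    omega
  | cons a l ih =>
    intro p hp
    have hlt : p.length < n := by simp only [List.length_cons] at hp; omega
    have hset : Finset.univ.filter (fun i : Fin n => p.length ≤ (i : ℕ)) = insert ⟨p.length, hlt⟩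
        (Finset.univ.filter (fun i : Fin n => (p ++ [a]).length ≤ (i : ℕ))) := by
      ext i
      simp only [Finset.mem_filter, Finset.mem_univ, true_and, Finset.mem_insert, Fin.ext_iff,
        List.length_append, List.length_singleton]
      omega
    rw [lowerSum, ih (p ++ [a]) (by simp only [List.length_cons] at hp; simp; omega), hset,
      Finset.sum_insert (by simp), List.append_assoc, List.singleton_append,
      listValue_eq s (n := n) (by simpa using hp),
      listExp_append_cons p l (a - d) (i := ⟨p.length, hlt⟩) rfl,
      listExp_append_cons p l a (i := ⟨p.length, hlt⟩) rfl]
    congr 2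
    rw [sub_smul]
    abel

/-- Multiplication by the power sum `p_{2k}` lowers one of the entries by `2k`; as `2k` is even, the sign
in `hlValue` is not affected. -/
theorem listValue_cons (k : ℕ) (s : Multiset ℕ) (l : List ℤ) :
    listValue ((2 * k) ::ₘ s) l = lowerSum (listValue s) (2 * k) [] l := by
  rw [lowerSum_listValue (n := l.length) s (2 * k) l [] (by simp), listValue, hlValue_cons]
  simp

end

/-! ### Partitions as exponents -/

section

variable {n : ℕ}

/-- A partition as an exponent: the first `n` rows. -/
def rowExp (n : ℕ) (lam : Ptn) : Fin n → ℤ := fun i => lam.row i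

theorem rowExp_apply (lam : Ptn) (i : Fin n) : rowExp n lam i = lam.row i := rfl

theorem antitone_rowExp (lam : Ptn) : Antitone (rowExp n lam) := by
  intro i j hij
  rw [rowExp_apply, rowExp_apply, Nat.cast_le]
  exact lam.row_antitone hij

theorem rowExp_nonneg (lam : Ptn) : 0 ≤ rowExp n lam := fun i => Nat.cast_nonneg (lam.row i)

theorem Ptn.row_eq_zero {lam : Ptn} {r : ℕ} (h : lam.length ≤ r) : lam.row r = 0 := by
  by_contra hne
  exact absurd ((lam.row_pos_iff r).1 (Nat.pos_of_ne_zero hne)) (not_lt.2 h)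

theorem sum_row {lam : Ptn} (h : lam.length ≤ n) (f : ℕ → ℕ) :
    ∑ i : Fin n, f (lam.row i) = (lam.1.map f).sum + (n - lam.length) * f 0 := by
  rw [Fin.sum_univ_eq_sum_range (fun r => f (lam.row r)), ← lam.map_row_range f]
  obtain ⟨d, rfl⟩ := Nat.exists_eq_add_of_le h
  rw [Finset.sum_range_add, Nat.add_sub_cancel_left]
  congr 1
  rw [Finset.sum_congr rfl fun i _ => by rw [Ptn.row_eq_zero (Nat.le_add_right _ _)]]
  simp

theorem card_row_eq {lam : Ptn} (h : lam.length ≤ n) (a : ℕ) :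
    (Finset.univ.filter fun i : Fin n => lam.row i = a).card =
      if a = 0 then n - lam.length else lam.mult a := by
  have h0 : lam.1.count 0 = 0 := Multiset.count_eq_zero.2 fun h => absurd (lam.2 0 h) (lt_irrefl 0)
  have h1 := sum_row h fun x => if a = x then 1 else 0
  rw [Finset.card_filter]
  simp only [eq_comm (b := a)]
  rw [h1, Ptn.mult]
  have h2 : ∀ s : Multiset ℕ, (s.map fun x => if a = x then 1 else 0).sum = s.count a := by
    intro s
    induction s using Multiset.induction_on with
    | empty => simp
    | cons x s ih => rw [Multiset.map_cons, Multiset.sum_cons, ih, Multiset.count_cons, add_comm]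
  rw [h2]
  split_ifs with ha
  · rw [ha, h0, mul_one, zero_add]
  · rw [mul_zero, add_zero]

/-- A partition with at most `n` parts is determined by its first `n` rows. -/
theorem rowExp_injOn {lam mu : Ptn} (hlam : lam.length ≤ n) (hmu : mu.length ≤ n)
    (h : rowExp n lam = rowExp n mu) : lam = mu := by
  apply Subtype.ext
  ext a
  by_cases ha : a = 0
  · rw [ha, Multiset.count_eq_zero.2 fun h => absurd (lam.2 0 h) (lt_irrefl 0),
      Multiset.count_eq_zero.2 fun h => absurd (mu.2 0 h) (lt_irrefl 0)]
  · have h1 := card_row_eq hlam a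
    have h2 := card_row_eq hmu a
    rw [if_neg ha] at h1 h2
    rw [← Ptn.mult, ← Ptn.mult, ← h1, ← h2]
    congr 2
    ext i
    have := congrFun h i
    rw [rowExp_apply, rowExp_apply, Nat.cast_inj] at this
    rw [this]

theorem sum_rowExp {lam : Ptn} (h : lam.length ≤ n) : ∑ i, rowExp n lam i = lam.size := by
  have := sum_row h id
  simp only [id, mul_zero, add_zero, Multiset.map_id'] at this
  rw [Ptn.size, ← this, Nat.cast_sum]
  rfl

theorem exists_rowExp_eq {μ : Fin n → ℤ} (hμ : Antitone μ) (h0 : 0 ≤ μ) :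
    ∃ lam : Ptn, lam.length ≤ n ∧ rowExp n lam = μ := by
  set lam := Ptn.ofMultiset (Finset.univ.val.map fun i => (μ i).toNat) with hlam
  have hcnt : ∀ x, lam.1.countP (fun a => x < a) =
      (Finset.univ.filter fun i => (x : ℤ) < μ i).card := by
    intro x
    rw [hlam, Ptn.ofMultiset, Multiset.countP_filter, Multiset.countP_map, Finset.card_def,
      Finset.filter_val]
    congr 1
    refine Multiset.filter_congr fun i _ => ?_
    omega
  refine ⟨lam, ?_, ?_⟩
  · rw [← lam.countP_pos_eq_length, hcnt]
    exact (Finset.card_le_univ _).trans_eq (Fintype.card_fin n)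
  · have key : ∀ (x : ℕ) (r : Fin n), x < lam.row r ↔ (x : ℤ) < μ r := by
      intro x r
      rw [lam.lt_row_iff, hcnt]
      constructor
      · intro h
        by_contra hcon
        have hsub : (Finset.univ.filter fun i => (x : ℤ) < μ i) ⊆ Finset.Iio r := by
          intro i hi
          rw [Finset.mem_filter] at hi
          rw [Finset.mem_Iio]
          by_contra hri
          exact hcon (hi.2.trans_le (hμ (not_lt.1 hri)))
        have := Finset.card_le_card hsub
        rw [Fin.card_Iio] at this
        omega
      · intro h
        have hsub : Finset.Iic r ⊆ (Finset.univ.filter fun i => (x : ℤ) < μ i) := by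
          intro i hi
          rw [Finset.mem_filter]
          exact ⟨Finset.mem_univ _, h.trans_le (hμ (Finset.mem_Iic.1 hi))⟩
        have := Finset.card_le_card hsub
        rw [Fin.card_Iic] at this
        omega
    ext r
    have h1 := key (lam.row r) r
    have h2 := key ((μ r).toNat) r
    have h3 := h0 r
    simp only [Pi.zero_apply] at h3
    rw [rowExp_apply]
    omega

theorem rowExp_succ {lam : Ptn} (h : lam.length ≤ n) :
    rowExp (n + 1) lam = snocZero n (rowExp n lam) := by
  ext i
  refine Fin.lastCases ?_ (fun i => ?_) i
  · rw [snocZero_last, rowExp_apply, Fin.val_last, Ptn.row_eq_zero h, Nat.cast_zero]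
  · rw [snocZero_castSucc]
    rfl

/-- The partitions of a given size. -/
def ptnsOfSize (N : ℕ) : Finset Ptn :=
  (Finset.univ : Finset (Nat.Partition N)).map
    ⟨fun p => ⟨p.parts, fun _ => p.parts_pos⟩, fun _ _ h => Nat.Partition.ext (Subtype.ext_iff.1 h)⟩

theorem mem_ptnsOfSize {N : ℕ} {lam : Ptn} : lam ∈ ptnsOfSize N ↔ lam.size = N := by
  rw [ptnsOfSize, Finset.mem_map]
  constructor
  · rintro ⟨p, -, rfl⟩
    exact p.parts_sum
  · intro h
    exact ⟨⟨lam.1, fun {i} hi => lam.2 i hi, h⟩, Finset.mem_univ _, rfl⟩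

/-! ### The coordinates of power sums -/

/-- The coordinate of the power sum of `rho` at the Hall-Littlewood function of `lam`. -/
def hlCoord (rho lam : Ptn) : ℚ[X] := hlPolyCoeff lam.length rho.1 (rowExp lam.length lam)

theorem coe_hlCoord (rho : Ptn) {lam : Ptn} (h : lam.length ≤ n) :
    (hlCoord rho lam : PowerSeries ℚ) = hlCoeff n rho.1 (rowExp n lam) := by
  rw [hlCoord, coe_hlPolyCoeff]
  induction n, h using Nat.le_induction with
  | base => rfl
  | succ m hm ih => rw [ih, rowExp_succ hm, hlCoeff_snocZero _ rho.2]

theorem mem_of_hlCoord_ne_zero {rho lam : Ptn} (h : hlCoord rho lam ≠ 0) :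
    lam ∈ ptnsOfSize rho.size := by
  rw [mem_ptnsOfSize]
  have h1 : hlCoeff lam.length rho.1 (rowExp lam.length lam) ≠ 0 := by
    rw [← coe_hlCoord rho le_rfl]
    intro h0
    exact h (Polynomial.coe_injective ℚ (by rw [h0, Polynomial.coe_zero]))
  have h2 := sum_eq_of_hlCoeff_ne_zero _ _ h1
  rw [sum_rowExp le_rfl, Nat.cast_inj] at h2
  exact h2

/-- The product of `t`-factorials which normalizes the Hall-Littlewood polynomial. -/
def stabSer (n : ℕ) (lam : Ptn) : PowerSeries ℚ :=
  altCoeff (rowExp n lam) (alternant (rowExp n lam))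

theorem stabSer_mul_inv (lam : Ptn) : stabSer n lam * (stabSer n lam)⁻¹ = 1 := by
  apply PowerSeries.mul_inv_cancel
  rw [stabSer, constantCoeff_altCoeff_alternant_self (antitone_rowExp lam)]
  exact one_ne_zero

theorem stabSer_eq {lam : Ptn} (h : lam.length ≤ n) : stabSer n lam =
    tFactorial PowerSeries.X (n - lam.length) *
      ∏ a ∈ lam.1.toFinset, tFactorial PowerSeries.X (lam.mult a) := by
  have h0 : 0 ∉ lam.1.toFinset := fun h => absurd (lam.2 0 (Multiset.mem_toFinset.1 h)) (lt_irrefl 0)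
  rw [stabSer, altCoeff_alternant_self_eq (antitone_rowExp lam)
    ((insert 0 lam.1.toFinset).map Nat.castEmbedding)]
  · rw [Finset.prod_map, Finset.prod_insert h0]
    have hc : ∀ a : ℕ, (Finset.univ.filter fun i => rowExp n lam i = Nat.castEmbedding a).card =
        if a = 0 then n - lam.length else lam.mult a := by
      intro a
      rw [← card_row_eq h a]
      congr 2
      ext i
      exact Nat.cast_inj
    rw [hc, if_pos rfl]
    congr 1
    refine Finset.prod_congr rfl fun a ha => ?_
    rw [hc, if_neg]
    rintro rfl
    exact h0 ha
  · intro i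
    rw [Finset.mem_map]
    refine ⟨lam.row i, ?_, rfl⟩
    rw [Finset.mem_insert, or_iff_not_imp_left]
    intro hne
    rw [Multiset.mem_toFinset, ← Multiset.count_pos, ← Ptn.mult]
    have h1 := card_row_eq h (lam.row i)
    rw [if_neg hne] at h1
    rw [← h1, Finset.card_pos]
    exact ⟨i, Finset.mem_filter.2 ⟨Finset.mem_univ _, rfl⟩⟩

/-- The expansion of a power sum in Hall-Littlewood polynomials, multiplied by the Vandermonde product. -/
theorem vand_mul_powProd (rho : Ptn) : vand n * powProd n rho.1 =
    ∑ lam ∈ (ptnsOfSize rho.size).filter (fun lam => lam.length ≤ n),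
      constSer n (hlCoord rho lam * (stabSer n lam)⁻¹) * alternant (rowExp n lam) := by
  have hinj : Set.InjOn (rowExp n)
      ((ptnsOfSize rho.size).filter (fun lam => lam.length ≤ n) : Finset Ptn) := by
    intro lam hlam mu hmu h
    exact rowExp_injOn (Finset.mem_filter.1 hlam).2 (Finset.mem_filter.1 hmu).2 h
  have h := (isAlternating_vand.mul_symmetric fun w => permVar_powProd w rho.1).eq_sum
    (mul_mem vand_mem_nonneg (powProd_mem_nonneg rho.1))
    (((ptnsOfSize rho.size).filter (fun lam => lam.length ≤ n)).image (rowExp n)) ?_ ?_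
  · rw [h, Finset.sum_image hinj]
    refine Finset.sum_congr rfl fun lam hlam => ?_
    rw [altCoeff_vand_mul, ← coe_hlCoord rho (Finset.mem_filter.1 hlam).2, stabSer]
  · intro μ hμ
    obtain ⟨lam, -, rfl⟩ := Finset.mem_image.1 hμ
    exact ⟨antitone_rowExp lam, rowExp_nonneg lam⟩
  · intro μ hμ h0 hnot
    rw [altCoeff_vand_mul]
    by_contra hne
    obtain ⟨lam, hlen, rfl⟩ := exists_rowExp_eq hμ h0
    refine hnot (Finset.mem_image.2 ⟨lam, Finset.mem_filter.2 ⟨mem_ptnsOfSize.2 ?_, hlen⟩, rfl⟩)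
    have := sum_eq_of_hlCoeff_ne_zero _ _ hne
    rw [sum_rowExp hlen, Nat.cast_inj] at this
    exact this

end

/-! ### The transition matrix -/

section

variable {n : ℕ}

/-- The inclusion of `ℚ[t][x_0, …, x_{n-1}]` into the ring of power series in `t`. -/
def polyEmb (n : ℕ) : MvPolynomial (Fin n) ℚ[X] →+* LaurentSer n :=
  MvPolynomial.eval₂Hom ((constSer n).comp Polynomial.coeToPowerSeries.ringHom)
    fun i => mon (expo i)

theorem polyEmb_C (c : ℚ[X]) : polyEmb n (MvPolynomial.C c) = constSer n c := by
  rw [polyEmb, MvPolynomial.eval₂Hom_C]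
  rfl

theorem polyEmb_X (i : Fin n) : polyEmb n (MvPolynomial.X i) = mon (expo i) := by
  rw [polyEmb, MvPolynomial.eval₂Hom_X']

theorem prod_mon_expo_pow (m : Fin n → ℕ) :
    ∏ i, mon (expo i) ^ m i = mon fun i => (m i : ℤ) := by
  simp only [mon_pow, prod_mon]
  congr 1
  ext j
  simp [expo, Finset.sum_apply, Pi.single_apply]

theorem coeffAt_polyEmb (m : Fin n →₀ ℕ) (p : MvPolynomial (Fin n) ℚ[X]) :
    coeffAt (fun i => (m i : ℤ)) (polyEmb n p) = ((MvPolynomial.coeff m p : ℚ[X]) : PowerSeries ℚ) := by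
  induction p using MvPolynomial.induction_on' with
  | monomial u a =>
    rw [polyEmb, MvPolynomial.eval₂Hom_monomial, Finsupp.prod_fintype _ _ (fun _ => pow_zero _),
      prod_mon_expo_pow, RingHom.comp_apply, Polynomial.coeToPowerSeries.ringHom_apply,
      coeffAt_constSer_mul, ← mul_one (mon _), coeffAt_mon_mul, coeffAt_one,
      MvPolynomial.coeff_monomial]
    by_cases h : u = m
    · rw [h, sub_self, if_pos rfl, if_pos rfl, mul_one]
    · rw [if_neg h, if_neg, mul_zero, Polynomial.coe_zero]
      intro h0
      apply h
      ext i
      have := congrFun h0 i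
      simp only [Pi.sub_apply, Pi.zero_apply] at this
      omega
  | add p q hp hq =>
    rw [map_add, map_add, hp, hq, MvPolynomial.coeff_add, Polynomial.coe_add]

theorem polyEmb_injective : Function.Injective (polyEmb n) := by
  intro p q h
  ext1 m
  apply Polynomial.coe_injective ℚ
  rw [← coeffAt_polyEmb, h, coeffAt_polyEmb]

/-- The inclusion of the ring of power series in `t` into its field of fractions. -/
def serEmb (n : ℕ) : LaurentSer n →+* FractionRing (LaurentSer n) :=
  algebraMap (LaurentSer n) (FractionRing (LaurentSer n))

theorem serEmb_injective : Function.Injective (serEmb n) := IsFractionRing.injective _ _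

theorem serEmb_comp_polyEmb_injective : Function.Injective ((serEmb n).comp (polyEmb n)) :=
  serEmb_injective.comp polyEmb_injective

/-- The embedding of the field of rational functions into the field of fractions of the ring of power
series in `t`. -/
def ratEmb (n : ℕ) : RatFun n →+* FractionRing (LaurentSer n) :=
  IsFractionRing.lift serEmb_comp_polyEmb_injective

theorem ratEmb_algebraMap (p : MvPolynomial (Fin n) ℚ[X]) :
    ratEmb n (algebraMap _ _ p) = serEmb n (polyEmb n p) := by
  rw [ratEmb, IsFractionRing.lift_algebraMap]
  rfl

theorem ratEmb_xVar (i : Fin n) : ratEmb n (xVar i) = serEmb n (mon (expo i)) := by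
  rw [xVar, ratEmb_algebraMap, polyEmb_X]

theorem ratEmb_tVar : ratEmb n (tVar n) = serEmb n (tSer n) := by
  rw [tVar, ratEmb_algebraMap, polyEmb_C, Polynomial.coe_X, constSer_X]

theorem ratEmb_smul (c : ℚ[X]) (f : RatFun n) :
    ratEmb n (c • f) = serEmb n (constSer n c) * ratEmb n f := by
  rw [Algebra.smul_def, map_mul, IsScalarTower.algebraMap_apply ℚ[X] (MvPolynomial (Fin n) ℚ[X]),
    ratEmb_algebraMap, MvPolynomial.algebraMap_eq, polyEmb_C]

theorem mon_expo_ne {i j : Fin n} (h : i ≠ j) : mon (expo i) - mon (expo j) ≠ 0 := by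
  intro h0
  have h1 := congrArg (coeffAt (expo i)) h0
  rw [map_sub, map_zero, ← mul_one (mon (expo i)), ← mul_one (mon (expo j)), coeffAt_mon_mul,
    coeffAt_mon_mul, sub_self, coeffAt_one, coeffAt_one, if_pos rfl, if_neg, sub_zero] at h1
  · exact one_ne_zero h1
  · intro h2
    have h3 := congrFun h2 i
    simp [expo, h] at h3

theorem vand_ne_zero : vand n ≠ 0 := by
  rw [vand, Finset.prod_ne_zero_iff]
  intro p hp
  simp only [ltPairs, Finset.mem_filter, Finset.mem_univ, true_and] at hp
  exact mon_expo_ne hp.ne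

theorem ratEmb_powerSum (rho : Ptn) :
    ratEmb n (powerSum rho n) = serEmb n (powProd n rho.1) := by
  rw [powerSum, powProd, map_multiset_prod, map_multiset_prod, Multiset.map_map, Multiset.map_map]
  congr 1
  refine Multiset.map_congr rfl fun r _ => ?_
  simp only [Function.comp, powSer, map_sum, map_pow, ratEmb_xVar, ← mon_pow]

theorem ratEmb_vFactor (m : ℕ) :
    ratEmb n (vFactor n m) = serEmb n (constSer n (tFactorial PowerSeries.X m)) := by
  simp only [vFactor, tFactorial, map_prod, map_sum, map_pow, ratEmb_tVar, constSer_X]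

theorem ratEmb_vLam {lam : Ptn} (h : lam.length ≤ n) :
    ratEmb n (vLam n lam) = serEmb n (constSer n (stabSer n lam)) := by
  rw [vLam, stabSer_eq h]
  simp only [map_mul, map_prod, ratEmb_vFactor]

/-- The Hall-Littlewood polynomial is a normalized alternant divided by the Vandermonde product. -/
theorem vand_mul_ratEmb_hlPoly {lam : Ptn} (h : lam.length ≤ n) :
    serEmb n (vand n) * ratEmb n (hlPoly n lam) =
      serEmb n (constSer n (stabSer n lam)⁻¹ * alternant (rowExp n lam)) := by
  have hterm : ∀ w : Equiv.Perm (Fin n), serEmb n (vand n) *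
      ratEmb n ((∏ i : Fin n, xVar (w i) ^ lam.row i) *
        ∏ i : Fin n, ∏ j ∈ Finset.univ.filter (fun j : Fin n => i < j),
          (xVar (w i) - tVar n * xVar (w j)) / (xVar (w i) - xVar (w j))) =
      serEmb n (sgn w * permVar w (mon (rowExp n lam) * tVand n)) := by
    intro w
    have hx : ∀ i, permVar w (mon (expo i)) = mon (expo (w i)) := by
      intro i
      rw [permVar, substAut_mon, permExp_expo]
    have h1 : ratEmb n (∏ i : Fin n, xVar (w i) ^ lam.row i) =
        serEmb n (permVar w (mon (rowExp n lam))) := by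
      have : mon (rowExp n lam) = ∏ i, mon (expo i) ^ lam.row i := (prod_mon_expo_pow _).symm
      rw [this]
      simp only [map_prod, map_pow, ratEmb_xVar, hx]
    have h2 : ratEmb n (∏ i : Fin n, ∏ j ∈ Finset.univ.filter (fun j : Fin n => i < j),
          (xVar (w i) - tVar n * xVar (w j)) / (xVar (w i) - xVar (w j))) *
        serEmb n (permVar w (vand n)) = serEmb n (permVar w (tVand n)) := by
      have h3 : ∏ i : Fin n, ∏ j ∈ Finset.univ.filter (fun j : Fin n => i < j),
          (xVar (w i) - tVar n * xVar (w j)) / (xVar (w i) - xVar (w j)) = ∏ p ∈ ltPairs n,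
          (xVar (w p.1) - tVar n * xVar (w p.2)) / (xVar (w p.1) - xVar (w p.2)) := by
        rw [ltPairs, Finset.prod_filter, Fintype.prod_prod_type]
        simp only [Finset.prod_filter]
      rw [h3, vand, tVand]
      simp only [map_prod]
      rw [← Finset.prod_mul_distrib]
      refine Finset.prod_congr rfl fun p hp => ?_
      simp only [ltPairs, Finset.mem_filter, Finset.mem_univ, true_and] at hp
      have hne : serEmb n (mon (expo (w p.1))) - serEmb n (mon (expo (w p.2))) ≠ 0 := by
        rw [← map_sub, map_ne_zero_iff _ serEmb_injective]
        exact mon_expo_ne fun h => hp.ne (w.injective h)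
      have ht : permVar w (tSer n) = tSer n := substAut_tSer _
      simp only [map_div₀, map_sub, map_mul, ratEmb_xVar, ratEmb_tVar, hx, ht]
      exact div_mul_cancel₀ _ hne
    have h4 : vand n = sgn w * permVar w (vand n) := by
      rw [isAlternating_vand w, ← mul_assoc, sgn_mul_self, one_mul]
    rw [h4, map_mul (ratEmb n), map_mul (serEmb n), map_mul (serEmb n), map_mul (permVar w),
      map_mul (serEmb n), h1, ← h2]
    ring
  have h5 : serEmb n (constSer n (stabSer n lam)) * serEmb n (constSer n (stabSer n lam)⁻¹) = 1 := by
    rw [← map_mul, ← map_mul, stabSer_mul_inv, map_one, map_one]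
  rw [hlPoly, if_pos h, map_mul, map_inv₀, ratEmb_vLam h, map_sum, mul_left_comm, Finset.mul_sum,
    Finset.sum_congr rfl fun w _ => hterm w, ← map_sum, ← alternant, map_mul,
    inv_eq_of_mul_eq_one_right h5]

theorem powerSum_eq_sum (rho : Ptn) (n : ℕ) :
    powerSum rho n = ∑ lam ∈ ptnsOfSize rho.size, hlCoord rho lam • hlPoly n lam := by
  apply (ratEmb n).injective
  apply mul_left_cancel₀ ((map_ne_zero_iff _ serEmb_injective).2 (vand_ne_zero (n := n)))
  rw [ratEmb_powerSum, ← map_mul, vand_mul_powProd, map_sum, map_sum, Finset.mul_sum,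
    Finset.sum_filter]
  refine Finset.sum_congr rfl fun lam _ => ?_
  split_ifs with h
  · rw [ratEmb_smul, mul_left_comm, vand_mul_ratEmb_hlPoly h, ← map_mul, map_mul (constSer n),
      mul_assoc]
  · rw [hlPoly, if_neg h, smul_zero, map_zero, mul_zero]

/-- The family of the coordinates of a power sum. -/
def hlCoordFinsupp (rho : Ptn) : Ptn →₀ ℚ[X] :=
  Finsupp.onFinset (ptnsOfSize rho.size) (hlCoord rho) fun _ h => mem_of_hlCoord_ne_zero h

theorem powerSum_eq_linearCombination (rho : Ptn) :
    Finsupp.linearCombination ℚ[X] hlP (hlCoordFinsupp rho) = powerSum rho := by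
  rw [hlCoordFinsupp, Finsupp.linearCombination_onFinset]
  ext1 n
  rw [powerSum_eq_sum, Finset.sum_apply]
  rfl

/-- A linear relation among the Hall-Littlewood functions is detected by `altCoeff` in as many variables
as the longest partition which occurs has parts. -/
theorem linearCombination_hlP_injective :
    Function.Injective (fun c : Ptn →₀ ℚ[X] => (Finsupp.linearCombination ℚ[X] hlP c : SymSeq)) := by
  show Function.Injective (Finsupp.linearCombination ℚ[X] hlP)
  rw [injective_iff_map_eq_zero]
  intro c hc
  set n := c.support.sup Ptn.length with hn
  have hlen : ∀ lam ∈ c.support, lam.length ≤ n := fun lam h => Finset.le_sup (f := Ptn.length) h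
  have h1 : ∑ lam ∈ c.support, c lam • hlPoly n lam = 0 := by
    have := congrFun hc n
    rw [Finsupp.linearCombination_apply, Finsupp.sum, Finset.sum_apply] at this
    exact this
  have h2 : ∑ lam ∈ c.support,
      constSer n (c lam * (stabSer n lam)⁻¹) * alternant (rowExp n lam) = 0 := by
    apply serEmb_injective
    have h3 := congrArg (fun f => serEmb n (vand n) * ratEmb n f) h1
    simp only [map_zero, mul_zero, map_sum, Finset.mul_sum] at h3
    rw [map_zero, ← h3, map_sum]
    refine Finset.sum_congr rfl fun lam hlam => ?_
    rw [ratEmb_smul, mul_left_comm, vand_mul_ratEmb_hlPoly (hlen lam hlam), ← map_mul,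
      map_mul (constSer n), mul_assoc]
  ext1 mu
  rw [Finsupp.zero_apply]
  by_contra hmu
  have hmem : mu ∈ c.support := Finsupp.mem_support_iff.2 hmu
  have h3 := congrArg (altCoeff (rowExp n mu)) h2
  rw [altCoeff_sum, Finset.sum_eq_single mu, altCoeff_constSer_mul, ← stabSer, mul_assoc,
    mul_comm _ (stabSer n mu), stabSer_mul_inv, mul_one, altCoeff, zero_mul, map_zero] at h3
  · exact hmu (Polynomial.coe_injective ℚ (by rw [h3, Polynomial.coe_zero]))
  · intro lam hlam hne
    rw [altCoeff_constSer_mul]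
    by_contra h4
    exact hne (rowExp_injOn (hlen mu hmem) (hlen lam hlam)
      (eq_of_altCoeff_alternant_ne_zero (antitone_rowExp mu) (antitone_rowExp lam)
        (right_ne_zero_of_mul h4))).symm
  · exact fun h => absurd hmem h

/-- The transition coefficients are the coefficients of the products of the power sums with the
kernel. -/
theorem transition_apply (rho lam : Ptn) : transition rho lam = hlCoord rho lam := by
  rw [transition, ← powerSum_eq_linearCombination rho]
  rw [Function.leftInverse_invFun linearCombination_hlP_injective]
  rfl

end

/-! ### Green polynomials at `t = -1` -/

theorem inv_neg_one_pow (m : ℕ) : ((-1 : ℚ) ^ m)⁻¹ = (-1) ^ m := by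
  rw [← inv_pow, inv_neg_one]

theorem eval₂_toLaurent_neg_one (q : ℚ[X]) :
    LaurentPolynomial.eval₂ (RingHom.id ℚ) (-1 : ℚˣ)
      (LaurentPolynomial.invert (Polynomial.toLaurent q)) = q.eval (-1) := by
  induction q using Polynomial.induction_on' with
  | add p q hp hq => rw [map_add, map_add, map_add, hp, hq, eval_add]
  | monomial m a =>
    rw [← Polynomial.C_mul_X_pow_eq_monomial, Polynomial.toLaurent_C_mul_X_pow, map_mul, map_mul,
      LaurentPolynomial.invert_C, LaurentPolynomial.invert_T, LaurentPolynomial.eval₂_C,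
      LaurentPolynomial.eval₂_T, eval_mul, eval_C, eval_pow, eval_X, RingHom.id_apply]
    congr 1
    simp only [zpow_neg, zpow_natCast, Units.val_inv_eq_inv_val, Units.val_pow_eq_pow_val,
      Units.val_neg, Units.val_one, inv_neg_one_pow]

theorem level_rowExp (lam : Ptn) : level (rowExp lam.length lam) = -(lam.b : ℤ) := by
  show ∑ i : Fin lam.length, -(i : ℤ) * rowExp lam.length lam i = _
  rw [Ptn.b, Nat.cast_sum, ← Fin.sum_univ_eq_sum_range (fun r => ((r * lam.row r : ℕ) : ℤ)),
    ← Finset.sum_neg_distrib]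
  refine Finset.sum_congr rfl fun i _ => ?_
  rw [rowExp_apply]
  push_cast
  ring

/-- The factor `t ^ b(lam)` of the Green polynomial is the sign in `hlValue`. -/
theorem greenNegOne_eq (lam rho : Ptn) :
    greenNegOne lam rho = sortedValue (listValue rho.1) lam.1 := by
  have hlen : ((lam.1.sort (fun a b => a ≥ b)).map (Nat.cast : ℕ → ℤ)).length = lam.length := by
    rw [List.length_map, Multiset.length_sort, Ptn.length]
  have hexp : listExp lam.length ((lam.1.sort (fun a b => a ≥ b)).map (Nat.cast : ℕ → ℤ)) =
      rowExp lam.length lam := by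
    ext i
    rw [listExp, rowExp_apply, Ptn.row, ← Nat.cast_zero (R := ℤ), List.getD_map]
  rw [greenNegOne, green, map_mul, eval₂_toLaurent_neg_one, LaurentPolynomial.eval₂_T,
    transition_apply, sortedValue, listValue_eq _ hlen, hexp, hlValue, level_rowExp, hlCoord]
  congr 1
  simp only [zpow_neg, zpow_natCast, Units.val_pow_eq_pow_val, Units.val_neg, Units.val_one,
    inv_neg_one_pow]

/-- Zeros at the end of the sequence do not matter, so they need not be dropped from `s`. -/
theorem greenNegOne_ofMultiset (s : Multiset ℕ) (rho : Ptn) :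
    greenNegOne (Ptn.ofMultiset s) rho = sortedValue (listValue rho.1) s := by
  rw [greenNegOne_eq, Ptn.ofMultiset, (exchangeRule_listValue rho.2).sortedValue_filter]

theorem cup_ofMultiset_singleton (rho : Ptn) {a : ℕ} (ha : 0 < a) :
    (rho.cup (Ptn.ofMultiset {a})).1 = a ::ₘ rho.1 := by
  have h : (Ptn.ofMultiset {a}).1 = {a} := by
    rw [Ptn.ofMultiset, Multiset.filter_eq_self]
    intro b hb
    rwa [Multiset.mem_singleton.1 hb]
  rw [Ptn.cup, h, add_comm, Multiset.singleton_add, Ptn.ofMultiset, Multiset.filter_eq_self]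
  intro b hb
  rcases Multiset.mem_cons.1 hb with rfl | hb
  · exact ha
  · exact rho.2 b hb

end GreenHL

end

theorem mainTheorem5 (lam rho : GreenHL.Ptn) (k : ℕ) (hk : 1 ≤ k)
    (hlam : GreenHL.IsJordanTypeB lam ∨ GreenHL.IsJordanTypeC lam ∨ GreenHL.IsJordanTypeD lam)
    (hsize : lam.size = rho.size + 2 * k) :
    GreenHL.greenNegOne lam (rho.cup (GreenHL.Ptn.ofMultiset {2 * k})) =
      (∑ i ∈ lam.1.toFinset.filter (fun i => k ≤ i ∧ 2 ≤ lam.mult i),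
        (2 * (lam.mult i / 2 : ℕ) : ℚ) *
          GreenHL.greenNegOne (lam.replace {i, i} {i - k, i - k}) rho) +
      (∑ i ∈ lam.1.toFinset.filter (fun i => 2 * k ≤ i ∧ Odd (lam.mult i)),
        (-1 : ℚ) ^ (lam.height (lam.replace {i} {i - 2 * k})) *
          GreenHL.greenNegOne (lam.replace {i} {i - 2 * k}) rho) +
      (∑ p ∈ (lam.1.toFinset ×ˢ lam.1.toFinset).filter
          (fun p => p.2 < p.1 ∧ p.1 - p.2 < 2 * k ∧ 2 * k ≤ p.1 + p.2 ∧
            Odd (lam.mult p.1) ∧ Odd (lam.mult p.2)),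
        (-1 : ℚ) ^ (lam.height (lam.replace {p.1} {p.2})) * 2 *
          GreenHL.greenNegOne
            (lam.replace {p.1, p.2} {(p.1 + p.2) / 2 - k, (p.1 + p.2) / 2 - k}) rho) := by
  open GreenHL in
  obtain ⟨e, he⟩ := odd_mult_parity hlam
  have hcup := cup_ofMultiset_singleton rho (a := 2 * k) (by omega)
  have hrule' : ExchangeRule (listValue ((2 * k) ::ₘ rho.1)) :=
    exchangeRule_listValue (hcup ▸ (rho.cup (Ptn.ofMultiset {2 * k})).2)
  rw [greenNegOne_eq, hcup, sortedValue_of_lowerSum (exchangeRule_listValue rho.2) hrule' k hk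
    (listValue_cons k rho.1) lam.1 e he]
  congr 1
  · congr 1
    · refine Finset.sum_congr rfl fun i _ => ?_
      rw [Ptn.replace, greenNegOne_ofMultiset, Ptn.mult]
    · refine Finset.sum_congr rfl fun i hi => ?_
      rw [Finset.mem_filter, Multiset.mem_toFinset] at hi
      rw [lam.height_replace hi.1 (by omega), Ptn.replace, greenNegOne_ofMultiset]
  · refine Finset.sum_congr rfl fun p hp => ?_
    rw [Finset.mem_filter, Finset.mem_product, Multiset.mem_toFinset] at hp
    rw [lam.height_replace hp.1.1 hp.2.1, Ptn.replace, greenNegOne_ofMultiset]
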